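/- Let $n\ge 2$, $q,p\in\mathbb C^{*}$, where $q$ is not a root of unity ($q=1$ is allowed) and $p^b\neq q^{2a}$ for all integers $a\ge 0$, $b\ge 1$. Let $M\in\mathbb Z$, $0\le s\le n-1$ with $M\equiv s \pmod n$, let $r\ge 0$ and $N=s+nr$. **The operators $Y_i$ and the polynomials $\Phi^\lambda$.** On $\mathbb C[z_1^{\pm1},\dots,z_N^{\pm1}]$ let $K_{i,j}$ exchange $z_i$ and $z_j$, let $$g_{i,j}=\frac{q^{-1}z_i-qz_j}{z_i-z_j}(K_{i,j}-1)+q,\qquad \xi_{i,j}=K_{i,j}g_{i,j},$$ let $p^{D_i}$ be the substitution $z_i\mapsto pz_i$, and let $$Y_i=\xi_{i,i+1}^{-1}\cdots\xi_{i,N}^{-1}\,p^{D_i}\,\xi_{1,i}\cdots\xi_{i-1,i}.$$ For $\lambda\in\mathbb Z^N$ let $\lambda^+$ be its non-increasing rearrangement and $\sigma$ the permutation with $\lambda^+_{\sigma(i)}=\lambda_i$ and $\sigma(i)<\sigma(j)$ whenever $i<j$, $\lambda_i=\lambda_j$. Write $\lambda\succ\mu$ if either $\lambda^+\neq\mu^+$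 and $\lambda^+$ dominates $\mu^+$ (all partial sums of $\lambda^+$ are at least those of $\mu^+$, and the total sums agree), or $\lambda^+=\mu^+$ and the last non-zero entry of $\lambda-\mu$ is negative. Let $\Phi^\lambda$ be the non-symmetric Macdonald polynomial: $Y_i\Phi^\lambda=p^{\lambda_i}q^{2\sigma(i)-N-1}\Phi^\lambda$ for all $i$, and $\Phi^\lambda=z^\lambda+\sum_{\mu\prec\lambda}c_\mu z^\mu$. **The $q$-wedge product.** Let $v_1,\dots,v_n$ be the standard basis of $\mathbb C^n$, $E^{a,b}v_c=\delta_{b,c}v_a$, and $$S=-q^{-1}\sum_{a}E^{a,a}\otimes E^{a,a}+(q-q^{-1})\sum_{a<b}E^{a,a}\otimes E^{b,b}-\sum_{a\ne b}E^{a,b}\otimes E^{b,a}.$$ Let $\otimes^NV(z)=\mathbb C[z_1^{\pm1},\dots,z_N^{\pm1}]\otimes(\mathbb C^n)^{\otimes N}$, $\Omega=\sum_{i=1}^{N-1}\operatorname{Ker}(g_{i,i+1}+S_{i,i+1}^{-1})$, $\wedge^NV(z)=\otimes^NV(z)/\Omega$, with quotient map $\Lambda$. The level-0 action $U_0^{(N)}$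 of $U_q'(\widehat{\mathfrak{sl}}_n)$ is given by the operators ($a=0,\dots,n-1$; indices $a,a+1$ of matrix units modulo $n$; $y_i=q^{1-N}Y_i$; $K_i^a=q^{E_i^{a,a}-E_i^{a+1,a+1}}$) $$K_a^{\pm1}=(K_1^a\cdots K_N^a)^{\pm1},\qquad E_a=\sum_{i}y_i^{-\delta_{0,a}}E_i^{a,a+1}K_{i+1}^a\cdots K_N^a,$$ $$F_a=\sum_i y_i^{\delta_{0,a}}(K_1^a)^{-1}\cdots(K_{i-1}^a)^{-1}E_i^{a+1,a}.$$ **The spaces.** Let $\mathcal M_N^n$ be the set of non-decreasing $\mathbf m\in\mathbb Z^N$ in which no value occurs more than $n$ times, and $\mathcal E(\mathbf m)$ the set of $\mathbf e\in\{1,\dots,n\}^N$ with $\epsilon_i>\epsilon_{i+1}$ whenever $m_i=m_{i+1}$. Put $v_{\mathbf e}=v_{\epsilon_1}\otimes\cdots\otimes v_{\epsilon_N}$, $w(\mathbf m,\mathbf e)=\Lambda(z^{\mathbf m}\otimes v_{\mathbf e})$, $\phi(\mathbf m,\mathbf e)=\Lambda(\Phi^{\mathbf m}\otimes v_{\mathbf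 e})$ and $E^{\mathbf m}=\operatorname{span}\{\phi(\mathbf m,\mathbf e)\mid\mathbf e\in\mathcal E(\mathbf m)\}$. Let $m^0=\frac{s-M}{n}$ and let $\mathbf m^0\in\mathbb Z^N$ consist of $s$ entries $m^0$ followed by $n$ entries $m^0+j$ for each $j=1,\dots,r$ in turn. Let $V_M^{N}$ be the span of the $w(\mathbf m,\mathbf e)$ with $\mathbf m\in\mathcal M_N^n$, $m_N\le m_N^0$, $\mathbf e\in\mathcal E(\mathbf m)$, and for $k\ge0$ let $V_M^{N,k}$ be the span of those of them with $\sum_i(m_i^0-m_i)=k$. (For $N=0$ the condition $m_N\le m_N^0$ is void.) **Statement.** The operators $E_a,F_a,K_a^{\pm1}$ preserve $\Omega$ and so act in $\wedge^NV(z)$; the spaces $V_M^{N}$, $V_M^{N,k}$ and $E^{\mathbf m}$ below are invariant under this action $U_0^{(N)}$, and, as $U_0^{(N)}$-modules, $$V_M^{N}=\bigoplus_{\substack{\mathbf m\in\mathcal M_N^n\\ m_N\le m_N^0}}E^{\mathbf m},\qquad V_M^{N,k}=\bigoplus_{\substack{\mathbf m\in\mathcal M_N^n,\ m_N\le m_N^0\\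 \sum_i(m_i^0-m_i)=k}}E^{\mathbf m}\quad(k\ge 0).$$ Moreover the vectors $\phi(\mathbf m,\mathbf e)$, with $\mathbf m$ in the index set of the respective sum and $\mathbf e\in\mathcal E(\mathbf m)$, form a basis of $V_M^N$, respectively of $V_M^{N,k}$. -/

import Mathlib

open scoped TensorProduct

noncomputable section

namespace QWedge

/-! ### Laurent polynomials and the operators acting on them -/

/-- `ℂ[z₁^{±1}, …, z_N^{±1}]`, as the group algebra of `ℤ^N`. -/
abbrev Laurent (N : ℕ) : Type := AddMonoidAlgebra ℂ (Fin N → ℤ)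

/-- The monomial `z^l`. -/
def mono {N : ℕ} (l : Fin N → ℤ) : Laurent N := AddMonoidAlgebra.single l 1

/-- The variable `z_i`. -/
def zvar {N : ℕ} (i : Fin N) : Laurent N := mono (Pi.single i 1)

/-- The linear map with prescribed values on the monomials. -/
def onMono {N : ℕ} (F : (Fin N → ℤ) → Laurent N) : Module.End ℂ (Laurent N) :=
  (AddMonoidAlgebra.basis (Fin N → ℤ) ℂ).constr ℂ F

/-- `K_{i,j}`: the exchange of the variables `z_i` and `z_j`. -/
def permK {N : ℕ} (i j : Fin N) : Module.End ℂ (Laurent N) :=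
  onMono fun l => mono (l ∘ Equiv.swap i j)

/-- The value on `z^l` of `(z_i - z_j)⁻¹ (K_{i,j} - 1)`; see `sub_mul_divDiff`. -/
def divDiffMono {N : ℕ} (i j : Fin N) (l : Fin N → ℤ) : Laurent N :=
  ∑ k ∈ Finset.range (l j - l i).toNat,
      mono (Function.update (Function.update l i (l i + k)) j (l j - 1 - k))
  - ∑ k ∈ Finset.range (l i - l j).toNat,
      mono (Function.update (Function.update l i (l j + k)) j (l i - 1 - k))

/-- The divided difference `(z_i - z_j)⁻¹ (K_{i,j} - 1)`; see `sub_mul_divDiff`. -/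
def divDiff {N : ℕ} (i j : Fin N) : Module.End ℂ (Laurent N) := onMono (divDiffMono i j)

theorem mono_mul_mono {N : ℕ} (a b : Fin N → ℤ) : mono a * mono b = mono (a + b) := by
  simp [mono, AddMonoidAlgebra.single_mul_single]

theorem onMono_mono {N : ℕ} (F : (Fin N → ℤ) → Laurent N) (l : Fin N → ℤ) :
    onMono F (mono l) = F l := by
  have h := (AddMonoidAlgebra.basis (Fin N → ℤ) ℂ).constr_basis ℂ F l
  rwa [AddMonoidAlgebra.basis_apply] at h

theorem sub_mul_sum {N : ℕ} {i j : Fin N} (hij : i ≠ j) (l : Fin N → ℤ) (a b : ℤ) (d : ℕ) :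
    (zvar i - zvar j) * ∑ k ∈ Finset.range d,
        mono (Function.update (Function.update l i (a + k)) j (b - 1 - k))
      = mono (Function.update (Function.update l i (a + d)) j (b - d))
        - mono (Function.update (Function.update l i a) j b) := by
  have key : ∀ k : ℕ, (zvar i - zvar j) *
        mono (Function.update (Function.update l i (a + k)) j (b - 1 - k))
      = mono (Function.update (Function.update l i (a + (k + 1 : ℕ))) j (b - (k + 1 : ℕ)))
        - mono (Function.update (Function.update l i (a + (k : ℕ))) j (b - (k : ℕ))) := by
    intro k
    rw [sub_mul, zvar, zvar, mono_mul_mono, mono_mul_mono]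
    congr 2
    · funext x
      by_cases hx : x = j
      · subst hx; simp [hij.symm]; ring
      · by_cases hy : x = i
        · subst hy; simp [hij]; ring
        · simp [hx, hy]
    · funext x
      by_cases hx : x = j
      · subst hx; simp; ring
      · by_cases hy : x = i
        · subst hy; simp [hij]
        · simp [hx, hy]
  rw [Finset.mul_sum, Finset.sum_congr rfl fun k _ => key k, Finset.sum_range_sub fun k : ℕ =>
    mono (Function.update (Function.update l i (a + k)) j (b - k))]
  simp

/-- `divDiff i j` is the divided difference `f ↦ (K_{i,j} f - f) / (z_i - z_j)`. -/
theorem sub_mul_divDiff {N : ℕ} {i j : Fin N} (hij : i ≠ j) (f : Laurent N) :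
    (zvar i - zvar j) * divDiff i j f = permK i j f - f := by
  suffices h : LinearMap.mulLeft ℂ (zvar i - zvar j) * divDiff i j = permK i j - 1 by
    simpa using LinearMap.congr_fun h f
  refine (AddMonoidAlgebra.basis (Fin N → ℤ) ℂ).ext fun l => ?_
  rw [AddMonoidAlgebra.basis_apply]
  change (zvar i - zvar j) * divDiff i j (mono l) = permK i j (mono l) - mono l
  rw [divDiff, permK, onMono_mono, onMono_mono, divDiffMono, mul_sub, sub_mul_sum hij,
    sub_mul_sum hij]
  have e1 : Function.update (Function.update l i (l i)) j (l j) = l := by simp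
  have e2 : Function.update (Function.update l i (l j)) j (l i) = l ∘ Equiv.swap i j := by
    funext x
    by_cases hx : x = j
    · subst hx; simp
    · by_cases hy : x = i
      · subst hy; simp [hij]
      · simp [hx, hy, Equiv.swap_apply_of_ne_of_ne]
  rcases le_total (l i) (l j) with h | h
  · have h1 : (((l j - l i).toNat : ℕ) : ℤ) = l j - l i := Int.toNat_of_nonneg (by omega)
    have h2 : (l i - l j).toNat = 0 := by omega
    rw [h1, h2]
    simp only [Nat.cast_zero, add_zero, sub_zero, sub_self]
    rw [show l i + (l j - l i) = l j by ring, show l j - (l j - l i) = l i by ring, e1, e2]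
  · have h1 : (((l i - l j).toNat : ℕ) : ℤ) = l i - l j := Int.toNat_of_nonneg (by omega)
    have h2 : (l j - l i).toNat = 0 := by omega
    rw [h1, h2]
    simp only [Nat.cast_zero, add_zero, sub_zero, sub_self]
    rw [show l j + (l i - l j) = l i by ring, show l i - (l i - l j) = l j by ring, e1, e2]
    ring

/-- `g_{i,j} = (q⁻¹ z_i - q z_j) (z_i - z_j)⁻¹ (K_{i,j} - 1) + q`. -/
def gOp (q : ℂ) {N : ℕ} (i j : Fin N) : Module.End ℂ (Laurent N) :=
  LinearMap.mulLeft ℂ (q⁻¹ • zvar i - q • zvar j) * divDiff i j + q • 1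

/-- `ξ_{i,j} = K_{i,j} g_{i,j}`. -/
def xiOp (q : ℂ) {N : ℕ} (i j : Fin N) : Module.End ℂ (Laurent N) := permK i j * gOp q i j

/-- `p^{D_i}`: the substitution `z_i ↦ p z_i`. -/
def pShift (p : ℂ) {N : ℕ} (i : Fin N) : Module.End ℂ (Laurent N) :=
  onMono fun l => p ^ (l i) • mono l

/-- The difference operator
`Y_i = ξ_{i,i+1}⁻¹ ⋯ ξ_{i,N}⁻¹ p^{D_i} ξ_{1,i} ⋯ ξ_{i-1,i}`. -/
def yOp (q p : ℂ) {N : ℕ} (i : Fin N) : Module.End ℂ (Laurent N) :=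
  (((List.finRange N).filter (fun j => i < j)).map (fun j => Ring.inverse (xiOp q i j))).prod
    * pShift p i
    * (((List.finRange N).filter (fun j => j < i)).map (fun j => xiOp q j i)).prod

/-- The affine Hecke generator `y_i = q^{1-N} Y_i`. -/
def yHecke (q p : ℂ) {N : ℕ} (i : Fin N) : Module.End ℂ (Laurent N) :=
  q ^ (1 - (N : ℤ)) • yOp q p i

/-! ### The order on `ℤ^N` and the non-symmetric Macdonald polynomials -/

/-- The permutation `σ` with `l⁺_{σ(i)} = l_i` and `σ(i) < σ(j)` for `i < j`, `l_i = l_j`, where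
`l⁺` is `l` in non-increasing order (`Tuple.sort` is the stable sorting permutation). -/
def rankPerm {N : ℕ} (l : Fin N → ℤ) : Equiv.Perm (Fin N) := (Tuple.sort fun i => -l i)⁻¹

/-- `l⁺`: the non-increasing rearrangement of `l`. -/
def plus {N : ℕ} (l : Fin N → ℤ) : Fin N → ℤ := fun i => l ((rankPerm l)⁻¹ i)

/-- The dominance order `a ⪰ b` (used for non-increasing sequences). -/
def Dominates {N : ℕ} (a b : Fin N → ℤ) : Prop :=
  (∀ i, ∑ j ∈ Finset.Iic i, b j ≤ ∑ j ∈ Finset.Iic i, a j) ∧ ∑ j, a j = ∑ j, b j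

/-- The strict order `l ≻ m` on `ℤ^N`: either `l⁺ ≻ m⁺`, or `l⁺ = m⁺` and the last non-zero
entry of `l - m` is negative. -/
def StrictlyAbove {N : ℕ} (l m : Fin N → ℤ) : Prop :=
  (Dominates (plus l) (plus m) ∧ plus l ≠ plus m) ∨
    (plus l = plus m ∧ ∃ i, l i - m i < 0 ∧ ∀ j, i < j → l j - m j = 0)

/-- `ζ_i(l) = p^{l_i} q^{2σ(i)-N-1}` (the `+ 1` turns the index `0, …, N-1` of a place into
`1, …, N`). -/
def zeta (q p : ℂ) {N : ℕ} (l : Fin N → ℤ) (i : Fin N) : ℂ :=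
  p ^ (l i) * q ^ (2 * (((rankPerm l i : ℕ) : ℤ) + 1) - N - 1)

/-- `f` is the non-symmetric Macdonald polynomial with label `l`: a joint eigenfunction of the
`Y_i` with eigenvalues `ζ_i(l)`, of the form `z^l + ∑_{l ≻ m} c_m z^m`. -/
def IsMacdonald (q p : ℂ) {N : ℕ} (l : Fin N → ℤ) (f : Laurent N) : Prop :=
  (∀ i, yOp q p i f = zeta q p l i • f) ∧
    f - mono l ∈ Submodule.span ℂ (mono '' {m | StrictlyAbove l m})

open Classical in
/-- The non-symmetric Macdonald polynomial `Φ^l` (`0` if there is none). -/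
def macdonald (q p : ℂ) {N : ℕ} (l : Fin N → ℤ) : Laurent N :=
  if h : ∃ f, IsMacdonald q p l f then h.choose else 0

/-! ### The tensor power of `ℂⁿ` -/

/-- `(ℂⁿ)^{⊗N}`, through its standard basis `v_e = v_{e₁} ⊗ ⋯ ⊗ v_{e_N}`.  The basis vectors
`v_1, …, v_n` of `ℂⁿ` are indexed by `Fin n`, that is by `0, …, n-1`. -/
abbrev Spin (n N : ℕ) : Type := (Fin N → Fin n) →₀ ℂ

/-- The basis vector `v_e`. -/
def vec {n N : ℕ} (e : Fin N → Fin n) : Spin n N := Finsupp.single e 1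

/-- The linear map with prescribed values on the `v_e`. -/
def onVec {n N : ℕ} (F : (Fin N → Fin n) → Spin n N) : Module.End ℂ (Spin n N) :=
  Finsupp.linearCombination ℂ F

/-- `E_i^{a,b}`: the matrix unit `v_b ↦ v_a` in the `i`-th tensor factor. -/
def matUnit {n N : ℕ} (i : Fin N) (a b : Fin n) : Module.End ℂ (Spin n N) :=
  onVec fun e => if e i = b then vec (Function.update e i a) else 0

/-- The Hecke operator `S`, acting in the tensor factors `i` and `j`. -/
def sOp (q : ℂ) {n N : ℕ} (i j : Fin N) : Module.End ℂ (Spin n N) :=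
  -(q⁻¹ • ∑ a : Fin n, matUnit i a a * matUnit j a a)
    + (q - q⁻¹) • ∑ a : Fin n, ∑ b : Fin n,
        (if a < b then matUnit i a a * matUnit j b b else 0)
    - ∑ a : Fin n, ∑ b : Fin n, (if a ≠ b then matUnit i a b * matUnit j b a else 0)

/-! ### The `q`-wedge product -/

/-- `⊗^N V(z) = ℂ[z₁^{±1}, …, z_N^{±1}] ⊗ (ℂⁿ)^{⊗N}`. -/
abbrev Tens (n N : ℕ) : Type := Laurent N ⊗[ℂ] Spin n N

/-- `Ω = ∑_i Ker (g_{i,i+1} + S_{i,i+1}⁻¹)`. -/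
def Omega (q : ℂ) (n N : ℕ) : Submodule ℂ (Tens n N) :=
  ⨆ (i : Fin N) (j : Fin N) (_ : (i : ℕ) + 1 = j),
    LinearMap.ker
      (TensorProduct.map (gOp q i j) LinearMap.id
        + TensorProduct.map LinearMap.id (Ring.inverse (sOp q i j)) : Module.End ℂ (Tens n N))

/-- The `q`-wedge product `⋀^N V(z) = ⊗^N V(z) / Ω`. -/
abbrev Wedge (q : ℂ) (n N : ℕ) : Type := Tens n N ⧸ Omega q n N

/-- The quotient map `Λ`. -/
def Lam (q : ℂ) (n N : ℕ) : Tens n N →ₗ[ℂ] Wedge q n N := (Omega q n N).mkQ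

/-- The set `𝓜_N^n` of non-decreasing sequences of integers in which no value occurs more than
`n` times. -/
def seqM (n N : ℕ) : Set (Fin N → ℤ) :=
  {m | Monotone m ∧ ∀ c : ℤ, (Finset.univ.filter fun i => m i = c).card ≤ n}

/-- The set `𝓔(m)`. -/
def seqE (n : ℕ) {N : ℕ} (m : Fin N → ℤ) : Set (Fin N → Fin n) :=
  {e | ∀ i j : Fin N, (i : ℕ) + 1 = j → m i = m j → e j < e i}

/-- `w(m, e) = Λ(z^m ⊗ v_e)`; for `m ∈ 𝓜_N^n`, `e ∈ 𝓔(m)` it is a normally ordered wedge. -/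
def wedgeVec (q : ℂ) {n N : ℕ} (m : Fin N → ℤ) (e : Fin N → Fin n) : Wedge q n N :=
  Lam q n N (mono m ⊗ₜ[ℂ] vec e)

/-- `φ(m, e) = Λ(Φ^m ⊗ v_e)`. -/
def phiVec (q p : ℂ) {n N : ℕ} (m : Fin N → ℤ) (e : Fin N → Fin n) : Wedge q n N :=
  Lam q n N (macdonald q p m ⊗ₜ[ℂ] vec e)

/-- `E^m`, the span of the `φ(m, e)` with `e ∈ 𝓔(m)`. -/
def blockE (q p : ℂ) (n : ℕ) {N : ℕ} (m : Fin N → ℤ) : Submodule ℂ (Wedge q n N) :=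
  Submodule.span ℂ (phiVec q p m '' seqE n m)

/-! ### The action `U_0^{(N)}` -/

/-- Labels of the generators `E_a`, `F_a`, `K_a`, `K_a⁻¹` of `U'_q(ŝl_n)`, `a = 0, …, n-1`. -/
inductive Gen (n : ℕ) : Type
  | E (a : Fin n)
  | F (a : Fin n)
  | K (a : Fin n)
  | Kinv (a : Fin n)

/-- As the index of a basis vector of `ℂⁿ`, with `v_1, …, v_n` numbered by `0, …, n-1`, the label
`a + 1` is `a`, and the label `a` (modulo `n`) is the cyclic predecessor of `a`. -/
def prevIdx {n : ℕ} (a : Fin n) : Fin n :=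
  ⟨((a : ℕ) + n - 1) % n, Nat.mod_lt _ (Nat.lt_of_le_of_lt (Nat.zero_le _) a.isLt)⟩

/-- The eigenvalue of `E^{a,a} - E^{a+1,a+1}` (labels modulo `n`) on a basis vector. -/
def wt {n : ℕ} (a b : Fin n) : ℤ :=
  (if b = prevIdx a then 1 else 0) - (if b = a then 1 else 0)

/-- `(K_i^a)^t` with `K_i^a = q^{E_i^{a,a} - E_i^{a+1,a+1}}`. -/
def kLoc (q : ℂ) {n N : ℕ} (a : Fin n) (t : ℤ) (i : Fin N) : Module.End ℂ (Spin n N) :=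
  onVec fun e => q ^ (t * wt a (e i)) • vec e

/-- The operators on `⊗^N V(z)` given by the generators, with `y_i = q^{1-N} Y_i`:
`K_a = K_1^a ⋯ K_N^a`, `E_a = ∑_i y_i^{-δ_{0,a}} E_i^{a,a+1} K_{i+1}^a ⋯ K_N^a`,
`F_a = ∑_i y_i^{δ_{0,a}} (K_1^a)⁻¹ ⋯ (K_{i-1}^a)⁻¹ E_i^{a+1,a}`. -/
def tensAct (q p : ℂ) (n N : ℕ) : Gen n → Module.End ℂ (Tens n N)
  | .E a => ∑ i : Fin N, TensorProduct.map
      (if (a : ℕ) = 0 then Ring.inverse (yHecke q p i) else 1)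
      (matUnit i (prevIdx a) a
        * (((List.finRange N).filter (fun j => i < j)).map (kLoc q a 1)).prod)
  | .F a => ∑ i : Fin N, TensorProduct.map
      (if (a : ℕ) = 0 then yHecke q p i else 1)
      ((((List.finRange N).filter (fun j => j < i)).map (kLoc q a (-1))).prod
        * matUnit i a (prevIdx a))
  | .K a => TensorProduct.map 1 ((List.finRange N).map (kLoc q a 1)).prod
  | .Kinv a => TensorProduct.map 1 ((List.finRange N).map (kLoc q a (-1))).prod

/-- The operator `T` on `⊗^N V(z)` descends to `⋀^N V(z)`. -/
def Descends {q : ℂ} {n N : ℕ} (T : Module.End ℂ (Tens n N)) : Prop :=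
  Omega q n N ≤ (Omega q n N).comap T

open Classical in
/-- The operator on `⋀^N V(z)` induced by the operator of a generator on `⊗^N V(z)` (`0` if the
latter did not descend). -/
def wedgeAct (q p : ℂ) (n N : ℕ) (x : Gen n) : Module.End ℂ (Wedge q n N) :=
  if h : Descends (q := q) (tensAct q p n N x) then
    (Omega q n N).mapQ (Omega q n N) (tensAct q p n N x) h
  else 0

/-- `U_0^{(N)}`: the algebra of operators on `⋀^N V(z)` by which `U'_q(ŝl_n)` acts. -/
def U0 (q p : ℂ) (n N : ℕ) : Subalgebra ℂ (Module.End ℂ (Wedge q n N)) :=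
  Algebra.adjoin ℂ (Set.range (wedgeAct q p n N))

/-- `P` is a `U_0^{(N)}`-submodule of `⋀^N V(z)`. -/
def IsU0Submodule (q p : ℂ) {n N : ℕ} (P : Submodule ℂ (Wedge q n N)) : Prop :=
  ∀ u ∈ U0 q p n N, ∀ w ∈ P, u w ∈ P

/-! ### The truncated spaces -/

/-- The vacuum sequence `m⁰`: the entry `(s - M) / n` occurs `s` times, and is followed by
`n` entries `(s - M) / n + 1`, `n` entries `(s - M) / n + 2`, and so on. -/
def vacuum (n s : ℕ) (M : ℤ) {N : ℕ} (i : Fin N) : ℤ :=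
  ((s : ℤ) - M) / n + (if (i : ℕ) < s then 0 else ((((i : ℕ) - s) / n + 1 : ℕ) : ℤ))

/-- The sequences `m ∈ 𝓜_N^n` with `m_N ≤ m⁰_N` (no condition on `m_N` if `N = 0`). -/
def truncM (n s : ℕ) (M : ℤ) (N : ℕ) : Set (Fin N → ℤ) :=
  {m | m ∈ seqM n N ∧ ∀ i : Fin N, (i : ℕ) + 1 = N → m i ≤ vacuum n s M i}

/-- The degree `∑_i (m⁰_i - m_i)`. -/
def degM (n s : ℕ) (M : ℤ) {N : ℕ} (m : Fin N → ℤ) : ℤ := ∑ i, (vacuum n s M i - m i)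

/-- The sequences in `truncM` of degree `k`. -/
def truncMk (n s : ℕ) (M : ℤ) (N k : ℕ) : Set (Fin N → ℤ) :=
  {m | m ∈ truncM n s M N ∧ degM n s M m = k}

/-- The pairs `(m, e)` with `m ∈ A` and `e ∈ 𝓔(m)`. -/
def pairs (n : ℕ) {N : ℕ} (A : Set (Fin N → ℤ)) : Set ((Fin N → ℤ) × (Fin N → Fin n)) :=
  {x | x.1 ∈ A ∧ x.2 ∈ seqE n x.1}

/-- `V_M^N`, the span of the `w(m, e)` with `m ∈ 𝓜_N^n`, `m_N ≤ m⁰_N`, `e ∈ 𝓔(m)`. -/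
def spaceV (q : ℂ) (n s : ℕ) (M : ℤ) (N : ℕ) : Submodule ℂ (Wedge q n N) :=
  Submodule.span ℂ ((fun x => wedgeVec q x.1 x.2) '' pairs n (truncM n s M N))

/-- `V_M^{N,k}`, the span of those of these `w(m, e)` that have degree `k`. -/
def spaceVk (q : ℂ) (n s : ℕ) (M : ℤ) (N k : ℕ) : Submodule ℂ (Wedge q n N) :=
  Submodule.span ℂ ((fun x => wedgeVec q x.1 x.2) '' pairs n (truncMk n s M N k))

/-- `V` is a `U_0^{(N)}`-module, the internal direct sum of its `U_0^{(N)}`-submodules `E^m`,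
`m ∈ A`, and the `φ(m, e)` with `m ∈ A`, `e ∈ 𝓔(m)` form a basis of `V`. -/
def DecomposesInto (q p : ℂ) {n N : ℕ} (V : Submodule ℂ (Wedge q n N))
    (A : Set (Fin N → ℤ)) : Prop :=
  IsU0Submodule q p V ∧
  (∀ m ∈ A, IsU0Submodule q p (blockE q p n m)) ∧
  iSupIndep (fun m : A => blockE q p n (m : Fin N → ℤ)) ∧
  (⨆ m : A, blockE q p n (m : Fin N → ℤ)) = V ∧
  LinearIndependent ℂ (fun x : pairs n A => phiVec q p x.1.1 x.1.2) ∧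
  Submodule.span ℂ (Set.range fun x : pairs n A => phiVec q p x.1.1 x.1.2) = V

end QWedge

end

open QWedge

noncomputable section

namespace QWedge

/-! ### Majorization and the order on `ℤ^N` -/

/-! Write κ = q - q⁻¹. The operators g_{i,i+1} and S_{i,i+1} both satisfy x² = 1 + κx and the braid
relation. As q² ≠ -1, the kernel of g + S⁻¹ is the image of g ⊗ 1 - 1 ⊗ S, so the wedge product is
the tensor product of the polynomials and the spins balanced over the finite Hecke algebra
(`Lam_gOp`, `omega_le`). The recursion Y_{i+1} = g Y_i g, the commutation of Y_i with the other g's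
and matching two-place relations on spins make the generators descend (`descends_tensAct`).

The commuting Y_i are triangular on monomials with diagonal ζ_i(l) (`triangular_yOp`), and the joint
spectrum determines l⁺ (`plus_eq_of_zeta_eq`). A non-decreasing m is minimal in its orbit, so every
monomial below z^m has another spectrum, even up to a permutation of the places. A polynomial in the
Y_i that kills these monomials then yields Φ^m. It also yields uniqueness for permuted spectra,
which gives gΦ^m = qΦ^m wherever m_i = m_{i+1} (`IsMacdonald.gOp_eq`). Consequently Λ(Φ^m ⊗ Sv) =
qΛ(Φ^m ⊗ v) at such places, the spin labels can be sorted, and Λ(Φ^m ⊗ v) lies in E^m for every v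
(`Lam_macdonald_mem_blockE`). Since the y_i act on Φ^m by scalars, E^m is invariant.

For the bases, straightening writes every wedge of z^l through normally ordered wedges whose
exponents are majorized by l (`Lam_mono_mem_normalSpan`). Hence φ(m,e) and w(m,e) differ by terms
strictly below m, and both families have the same span over any downward closed index set
(`span_phiVec`). Independence comes from a q-antisymmetrizer that vanishes on Ω and whose leading
coefficients on ordered wedges are unitriangular (`omega_le_ker_antisym`, `wedgeCoeff_Lam`). Both
index sets of the theorem are downward closed, because majorization bounds the largest entry and
preserves the sum. -/

/-- The convex test function `∑_i max (l_i - c, 0)`. -/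
def hinge {N : ℕ} (c : ℤ) (l : Fin N → ℤ) : ℤ := ∑ i, max (l i - c) 0

/-- Majorization `l ⪰ m`, in its rearrangement-invariant form. -/
def Maj {N : ℕ} (l m : Fin N → ℤ) : Prop :=
  ∑ i, l i = ∑ i, m i ∧ ∀ c, hinge c m ≤ hinge c l

/-- `m` is strictly majorized by `l`. -/
def Below {N : ℕ} (l m : Fin N → ℤ) : Prop := Maj l m ∧ ¬ Maj m l

variable {N : ℕ} {l m k : Fin N → ℤ}

theorem Maj.refl (l : Fin N → ℤ) : Maj l l := ⟨rfl, fun _ => le_rfl⟩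

theorem Maj.trans (h : Maj l m) (h' : Maj m k) : Maj l k :=
  ⟨h.1.trans h'.1, fun c => (h'.2 c).trans (h.2 c)⟩

theorem Below.trans_maj (h : Below l m) (h' : Maj m k) : Below l k :=
  ⟨h.1.trans h', fun h2 => h.2 (h'.trans h2)⟩

theorem Maj.trans_below (h : Maj l m) (h' : Below m k) : Below l k :=
  ⟨h.trans h'.1, fun h2 => h'.2 (h2.trans h)⟩

theorem hinge_comp_perm (c : ℤ) (l : Fin N → ℤ) (σ : Equiv.Perm (Fin N)) :
    hinge c (l ∘ σ) = hinge c l :=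
  Equiv.sum_comp σ fun i => max (l i - c) 0

theorem maj_comp_perm (l : Fin N → ℤ) (σ : Equiv.Perm (Fin N)) : Maj l (l ∘ σ) :=
  ⟨(Equiv.sum_comp σ l).symm, fun c => (hinge_comp_perm c l σ).le⟩

theorem comp_perm_maj (l : Fin N → ℤ) (σ : Equiv.Perm (Fin N)) : Maj (l ∘ σ) l :=
  ⟨Equiv.sum_comp σ l, fun c => (hinge_comp_perm c l σ).ge⟩

theorem plus_eq_comp (l : Fin N → ℤ) : plus l = l ∘ Tuple.sort fun i => -l i := by
  funext i
  simp [plus, rankPerm]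

theorem plus_antitone (l : Fin N → ℤ) : Antitone (plus l) := by
  intro i j h
  have := Tuple.monotone_sort (fun i => -l i) h
  simp only [Function.comp] at this
  rw [plus_eq_comp]
  simp only [Function.comp]
  omega

theorem plus_comp_perm (l : Fin N → ℤ) (σ : Equiv.Perm (Fin N)) : plus (l ∘ σ) = plus l := by
  have h1 := plus_antitone (l ∘ σ)
  have h2 := plus_antitone l
  rw [plus_eq_comp] at h1 h2
  rw [plus_eq_comp, plus_eq_comp l]
  exact Tuple.unique_antitone (σ := σ * Tuple.sort fun i => -(l ∘ σ) i) h1 h2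

theorem plus_eq_iff : plus l = plus m ↔ ∃ σ : Equiv.Perm (Fin N), m = l ∘ σ := by
  constructor
  · intro h
    refine ⟨Tuple.sort (fun i => -l i) * (Tuple.sort fun i => -m i)⁻¹, ?_⟩
    rw [plus_eq_comp, plus_eq_comp] at h
    funext i
    have := congrFun h ((Tuple.sort fun i => -m i)⁻¹ i)
    simp only [Function.comp] at this
    simpa using this.symm
  · rintro ⟨σ, rfl⟩
    exact (plus_comp_perm l σ).symm

theorem sum_plus (l : Fin N → ℤ) : ∑ i, plus l i = ∑ i, l i := by
  rw [plus_eq_comp]; exact Equiv.sum_comp _ l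

theorem hinge_plus (c : ℤ) (l : Fin N → ℤ) : hinge c (plus l) = hinge c l := by
  rw [plus_eq_comp]; exact hinge_comp_perm c l _

/-- Dropping the truncation at 0 lowers each summand, and the omitted summands are non-negative.
`hinge_eq_sum_Iic` gives the case of equality, so for non-increasing sequences hinges and partial
sums determine each other. -/
theorem sum_Iic_sub_le_hinge (c : ℤ) (l : Fin N → ℤ) (i : Fin N) :
    ∑ j ∈ Finset.Iic i, (l j - c) ≤ hinge c l :=
  (Finset.sum_le_sum fun _ _ => le_max_left _ _).trans
    (Finset.sum_le_sum_of_subset_of_nonneg (Finset.subset_univ _) fun _ _ _ => le_max_right _ _)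

theorem hinge_eq_sum_Iic {c : ℤ} {l : Fin N → ℤ} {i : Fin N} (h1 : ∀ j ≤ i, c ≤ l j)
    (h2 : ∀ j, i < j → l j ≤ c) : hinge c l = ∑ j ∈ Finset.Iic i, (l j - c) := by
  have : ∑ j ∈ Finset.Iic i, (l j - c) = ∑ j ∈ Finset.Iic i, max (l j - c) 0 :=
    Finset.sum_congr rfl fun j hj => by
      have := h1 j (Finset.mem_Iic.1 hj)
      rw [max_eq_left (by omega)]
  rw [this, hinge]
  symm
  refine Finset.sum_subset (Finset.subset_univ _) fun j _ hj => ?_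
  have := h2 j (by simpa using hj)
  rw [max_eq_right (by omega)]

/-- Each hinge of a non-increasing sequence is 0 or a shifted partial sum, and each partial sum
occurs for the threshold equal to its last entry. The form without rearrangement makes permutation
invariance and local moves easy to check. -/
theorem dominates_plus_iff : Dominates (plus l) (plus m) ↔ Maj l m := by
  have hs : ∀ (c : ℤ) (a : Fin N → ℤ) (i : Fin N), ∑ j ∈ Finset.Iic i, (a j - c)
      = ∑ j ∈ Finset.Iic i, a j - (Finset.Iic i).card * c := by
    intro c a i; simp [Finset.sum_sub_distrib]
  constructor
  · rintro ⟨h1, h2⟩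
    refine ⟨by rwa [sum_plus, sum_plus] at h2, fun c => ?_⟩
    rw [← hinge_plus c l, ← hinge_plus c m]
    by_cases hne : (Finset.univ.filter fun j => c < plus m j).Nonempty
    -- The last place whose entry exceeds c is where the hinge becomes a partial sum.
    · obtain ⟨i, hi, hmax⟩ := Finset.exists_max_image _ id hne
      have e := hinge_eq_sum_Iic (c := c) (l := plus m) (i := i)
        (fun j hj => le_trans (by simpa using (Finset.mem_filter.1 hi).2.le)
          (plus_antitone m hj))
        (fun j hj => by
          by_contra hc
          exact absurd (hmax j (by simpa using hc)) (not_le.2 hj))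
      rw [e]
      refine le_trans ?_ (sum_Iic_sub_le_hinge c (plus l) i)
      rw [hs, hs]
      have := h1 i
      omega
    · have : hinge c (plus m) = 0 := Finset.sum_eq_zero fun j _ => by
        rw [Finset.not_nonempty_iff_eq_empty, Finset.filter_eq_empty_iff] at hne
        have := hne (Finset.mem_univ j)
        rw [max_eq_right (by omega)]
      rw [this]
      exact Finset.sum_nonneg fun _ _ => le_max_right _ _
  · rintro ⟨h1, h2⟩
    refine ⟨fun i => ?_, by rw [sum_plus, sum_plus, h1]⟩
    have e := hinge_eq_sum_Iic (c := plus l i) (l := plus l) (i := i)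
      (fun j hj => plus_antitone l hj) (fun j hj => plus_antitone l hj.le)
    have h3 := h2 (plus l i)
    rw [← hinge_plus _ l, ← hinge_plus _ m, e] at h3
    have h4 := (sum_Iic_sub_le_hinge (plus l i) (plus m) i).trans h3
    rw [hs, hs] at h4
    omega

theorem plus_eq_of_maj_maj (h : Maj l m) (h' : Maj m l) : plus l = plus m := by
  have h1 := (dominates_plus_iff.2 h).1
  have h2 := (dominates_plus_iff.2 h').1
  have key : ∀ n : ℕ, ∀ i : Fin N, (i : ℕ) = n → plus l i = plus m i := by
    intro n
    induction n using Nat.strong_induction_on with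
    | _ n ih =>
      intro i hi
      have e := le_antisymm (h2 i) (h1 i)
      rw [← Finset.Iio_insert, Finset.sum_insert (by simp), Finset.sum_insert (by simp)] at e
      have : ∑ j ∈ Finset.Iio i, plus l j = ∑ j ∈ Finset.Iio i, plus m j :=
        Finset.sum_congr rfl fun j hj => ih j (by
          have := Finset.mem_Iio.1 hj; rw [← hi]; exact this) j rfl
      omega
  funext i
  exact key i i rfl

theorem plus_eq_iff_maj : plus l = plus m ↔ Maj l m ∧ Maj m l := by
  refine ⟨fun h => ?_, fun h => plus_eq_of_maj_maj h.1 h.2⟩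
  obtain ⟨σ, rfl⟩ := plus_eq_iff.1 h
  exact ⟨maj_comp_perm l σ, comp_perm_maj l σ⟩

theorem strictlyAbove_iff : StrictlyAbove l m ↔ Below l m ∨
    (plus l = plus m ∧ ∃ i, l i - m i < 0 ∧ ∀ j, i < j → l j - m j = 0) := by
  rw [StrictlyAbove, dominates_plus_iff]
  refine or_congr_left ⟨fun h => ⟨h.1, fun h' => h.2 (plus_eq_of_maj_maj h.1 h')⟩, fun h =>
    ⟨h.1, fun h' => h.2 (plus_eq_iff_maj.1 h').2⟩⟩

theorem StrictlyAbove.maj (h : StrictlyAbove l m) : Maj l m := by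
  rcases strictlyAbove_iff.1 h with h | h
  · exact h.1
  · exact (plus_eq_iff_maj.1 h.1).1

theorem Below.strictlyAbove (h : Below l m) : StrictlyAbove l m := strictlyAbove_iff.2 (Or.inl h)

theorem StrictlyAbove.trans (h : StrictlyAbove l m) (h' : StrictlyAbove m k) :
    StrictlyAbove l k := by
  rcases strictlyAbove_iff.1 h with h1 | ⟨h1, i, hi, hi'⟩
  · exact (h1.trans_maj h'.maj).strictlyAbove
  · rcases strictlyAbove_iff.1 h' with h2 | ⟨h2, j, hj, hj'⟩
    · exact (h.maj.trans_below h2).strictlyAbove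
    · refine Or.inr ⟨h1.trans h2, max i j, ?_, fun x hx => ?_⟩
      · rcases lt_trichotomy i j with hij | rfl | hij
        · rw [max_eq_right hij.le]; have := hi' j hij; omega
        · rw [max_self]; omega
        · rw [max_eq_left hij.le]; have := hj' i hij; omega
      · have := hi' x ((le_max_left _ _).trans_lt hx)
        have := hj' x ((le_max_right _ _).trans_lt hx)
        omega

theorem StrictlyAbove.irrefl (l : Fin N → ℤ) : ¬ StrictlyAbove l l := by
  intro h
  rcases strictlyAbove_iff.1 h with h | ⟨_, i, hi, _⟩
  · exact h.2 h.1
  · omega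

theorem Maj.le_of_forall_le {b : ℤ} (h : Maj l m) (hb : ∀ i, l i ≤ b) (i : Fin N) : m i ≤ b := by
  have h1 : hinge b l = 0 := Finset.sum_eq_zero fun j _ => by
    have := hb j; rw [max_eq_right (by omega)]
  have h2 : max (m i - b) 0 ≤ hinge b m :=
    Finset.single_le_sum (f := fun i => max (m i - b) 0) (fun _ _ => le_max_right _ _)
      (Finset.mem_univ i)
  have h3 := h.2 b
  have h4 := le_max_left (m i - b) 0
  omega

/-- The entries are at most the largest entry of l, and the fixed total then bounds each of them
from below. -/
theorem finite_maj (l : Fin N → ℤ) : {m | Maj l m}.Finite := by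
  obtain ⟨b, hb⟩ : ∃ b : ℤ, ∀ i, l i ≤ b := by
    obtain ⟨b, hb⟩ := (Set.finite_range l).bddAbove
    exact ⟨b, fun i => hb ⟨i, rfl⟩⟩
  refine (Set.finite_Icc (fun _ : Fin N => ∑ i, l i - (N - 1) * b) fun _ => b).subset ?_
  intro m hm
  have hmb := fun i => Maj.le_of_forall_le hm hb i
  refine ⟨fun i => ?_, hmb⟩
  rw [hm.1]
  have h1 : ∑ j ∈ Finset.univ.erase i, m j ≤ ∑ j ∈ Finset.univ.erase i, b :=
    Finset.sum_le_sum fun j _ => hmb j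
  have hN : 1 ≤ N := by have := i.isLt; omega
  rw [Finset.sum_const, Finset.card_erase_of_mem (Finset.mem_univ i), Finset.card_fin,
    nsmul_eq_mul, Nat.cast_sub hN] at h1
  have h2 := Finset.add_sum_erase Finset.univ m (Finset.mem_univ i)
  push_cast at h1
  show ∑ i, m i - (N - 1) * b ≤ m i
  linarith

/-- The number of sequences majorized by `l`: a rank function for the strict order `Below`. -/
def majRank (l : Fin N → ℤ) : ℕ := {m | Maj l m}.ncard

theorem Below.majRank_lt (h : Below l m) : majRank m < majRank l :=
  Set.ncard_lt_ncard ⟨fun _ hx => h.1.trans hx, fun h2 => h.2 (h2 (Maj.refl l))⟩ (finite_maj l)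

theorem Maj.of_monotone_eq (hl : Monotone l) (hm : Monotone m) (h : Maj l m) (h' : Maj m l) :
    l = m := by
  obtain ⟨σ, rfl⟩ := plus_eq_iff.1 (plus_eq_of_maj_maj h h')
  exact Tuple.unique_monotone (σ := 1) hl hm

/-- A non-decreasing sequence is minimal in its orbit. -/
theorem StrictlyAbove.below_of_monotone (hl : Monotone l) (h : StrictlyAbove l m) : Below l m := by
  rcases strictlyAbove_iff.1 h with h | ⟨h1, i, hi, hi'⟩
  · exact h
  · exfalso
    obtain ⟨σ, rfl⟩ := plus_eq_iff.1 h1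
    -- the multiset of the entries exceeding `l i` is the same for both sequences
    have e : ∑ j, max (l (σ j) - l i) 0 = ∑ j, max (l j - l i) 0 :=
      Equiv.sum_comp σ fun j => max (l j - l i) 0
    have lt : ∑ j, max (l j - l i) 0 < ∑ j, max (l (σ j) - l i) 0 := by
      refine Finset.sum_lt_sum (fun j _ => ?_) ⟨i, Finset.mem_univ _, ?_⟩
      · rcases le_or_gt j i with hj | hj
        · have := hl hj
          rw [max_eq_right (by omega)]
          exact le_max_right _ _
        · have := hi' j hj
          simp only [Function.comp] at this
          rw [show l (σ j) = l j by omega]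
      · simp only [Function.comp] at hi
        rw [sub_self, max_self]
        exact lt_max_of_lt_left (by omega)
    exact lt.ne e.symm

/-! ### The permutation `σ` -/

theorem rankPerm_lt_iff (l : Fin N → ℤ) (i j : Fin N) :
    rankPerm l j < rankPerm l i ↔ l i < l j ∨ (l j = l i ∧ j < i) := by
  obtain ⟨h1, h2⟩ := (Tuple.eq_sort_iff (f := fun i => -l i)).1 rfl
  have key : ∀ i j : Fin N, rankPerm l j < rankPerm l i → l i < l j ∨ (l j = l i ∧ j < i) := by
    intro i j h
    have a := h1 h.le
    have b := h2 _ _ h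
    simp only [Function.comp, rankPerm, Equiv.Perm.coe_inv, Equiv.apply_symm_apply] at a b
    rcases lt_or_eq_of_le a with a | a
    · left; omega
    · right; exact ⟨by omega, b a⟩
  refine ⟨key i j, fun h => ?_⟩
  rcases lt_trichotomy (rankPerm l j) (rankPerm l i) with hh | hh | hh
  · exact hh
  · have := (rankPerm l).injective hh
    subst this
    simp at h
  · have := key j i hh
    omega

/-- This is the count that appears as the exponent of q in the diagonal entries of Y_i. -/
theorem rankPerm_eq_card (l : Fin N → ℤ) (i : Fin N) :
    (rankPerm l i : ℕ) = (Finset.univ.filter fun j => l i < l j ∨ (l j = l i ∧ j < i)).card := by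
  have : (Finset.univ.filter fun j => l i < l j ∨ (l j = l i ∧ j < i))
      = (Finset.Iio (rankPerm l i)).map (rankPerm l)⁻¹.toEmbedding := by
    ext j
    simp only [Finset.mem_filter, Finset.mem_univ, true_and, ← rankPerm_lt_iff]
    constructor
    · intro h
      exact Finset.mem_map.2 ⟨rankPerm l j, by simpa using h, by simp⟩
    · intro h
      obtain ⟨a, ha, rfl⟩ := Finset.mem_map.1 h
      simpa using ha
  rw [this, Finset.card_map, Fin.card_Iio]

theorem rankPerm_succ_of_eq {i j : Fin N} (hij : (i : ℕ) + 1 = j) (h : l i = l j) :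
    (rankPerm l j : ℕ) = rankPerm l i + 1 := by
  rw [rankPerm_eq_card, rankPerm_eq_card, ← Finset.card_insert_of_notMem (a := i) (by simp)]
  congr 1
  ext x
  simp only [Finset.mem_filter, Finset.mem_univ, true_and, Finset.mem_insert, Fin.lt_def,
    Fin.ext_iff]
  rcases lt_trichotomy (x : ℕ) i with hx | hx | hx
  · omega
  · have : x = i := Fin.ext hx
    subst this
    omega
  · omega

/-! ### Separation of the spectrum -/

theorem zeta_eq (q p : ℂ) (l : Fin N → ℤ) (i : Fin N) :
    zeta q p l i = p ^ plus l (rankPerm l i)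
      * q ^ (2 * (((rankPerm l i : ℕ) : ℤ) + 1) - N - 1) := by
  simp [zeta, plus]

section Separation

variable {q p : ℂ}

theorem zpow_ne_of_pos (hp : ∀ a b : ℕ, 0 < b → p ^ b ≠ q ^ (2 * a)) {a b : ℤ}
    (ha : 0 ≤ a) (hb : 0 < b) : p ^ b ≠ q ^ (2 * a) := by
  lift a to ℕ using ha
  lift b to ℕ using hb.le
  have := hp a b (by omega)
  intro h
  apply this
  rw [← zpow_natCast, h, ← zpow_natCast]
  norm_cast

/-- In terms of the sorted sequences the hypothesis says p^(m⁺_k - l⁺_{ρk}) = q^(2(ρk - k)) for a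
permutation ρ. The condition on p and q forbids a positive exponent of p against a non-negative
exponent of q. If q is not a root of unity this forces ρ = 1; if q = 1 it gives m⁺ = l⁺ ∘ ρ
directly. -/
theorem plus_eq_of_zeta_eq (hq0 : q ≠ 0) (hq : ∀ a : ℕ, 0 < a → q ^ a = 1 → q = 1)
    (hp0 : p ≠ 0) (hp : ∀ a b : ℕ, 0 < b → p ^ b ≠ q ^ (2 * a))
    (π : Equiv.Perm (Fin N)) (h : ∀ i, zeta q p m i = zeta q p l (π i)) : plus m = plus l := by
  -- after division by a common factor, in terms of the non-increasing rearrangements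
  obtain ⟨ρ, h⟩ : ∃ ρ : Equiv.Perm (Fin N), ∀ k : Fin N,
      p ^ (plus m k - plus l (ρ k)) = q ^ (2 * (((ρ k : ℕ) : ℤ) - (k : ℕ))) := by
    refine ⟨rankPerm l * π * (rankPerm m)⁻¹, fun k => ?_⟩
    have := h ((rankPerm m)⁻¹ k)
    rw [zeta_eq, zeta_eq] at this
    simp only [Equiv.Perm.coe_inv, Equiv.apply_symm_apply, Equiv.Perm.mul_apply] at this ⊢
    set x := (rankPerm l) (π ((Equiv.symm (rankPerm m)) k))
    rw [zpow_sub₀ hp0, show (2 * (((x : ℕ) : ℤ) - (k : ℕ)))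
      = (2 * (((x : ℕ) : ℤ) + 1) - N - 1) - (2 * (((k : ℕ) : ℤ) + 1) - N - 1) by ring,
      zpow_sub₀ hq0]
    have h1 := zpow_ne_zero (2 * (((k : ℕ) : ℤ) + 1) - N - 1) hq0
    have h2 := zpow_ne_zero (plus l x) hp0
    field_simp
    linear_combination this
  have hne : ∀ a b : ℤ, 0 ≤ a → p ^ b = q ^ (2 * a) → b ≤ 0 := fun a b ha hab => by
    by_contra hb
    exact zpow_ne_of_pos hp ha (by omega) hab
  by_cases hq1 : q = 1
  -- Here q carries no information, but applying the condition to the exponent and to its negative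
  -- gives equality of the entries.
  · subst hq1
    have e : ∀ k, plus m k = plus l (ρ k) := by
      intro k
      have hk := h k
      simp only [one_zpow] at hk
      have h1 := hne 0 _ le_rfl (hk.trans (by simp))
      have h2 := hne 0 (-(plus m k - plus l (ρ k))) le_rfl (by rw [zpow_neg, hk]; simp)
      omega
    have e' : plus m = plus l ∘ ρ := funext e
    have := plus_antitone m
    rw [e'] at this ⊢
    exact Tuple.unique_antitone (σ := ρ) (τ := 1) this (plus_antitone l)
  · have hq' : ∀ a : ℤ, q ^ (2 * a) = 1 → a = 0 := by
      intro a ha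
      by_contra ha0
      apply hq1
      apply hq (2 * a).natAbs (by omega)
      rcases abs_choice (2 * a) with hc | hc
      · rw [← zpow_natCast, Int.natCast_natAbs, hc, ha]
      · rw [← zpow_natCast, Int.natCast_natAbs, hc, zpow_neg, ha, inv_one]
    -- At a least k with ρk ≠ k, both ρk and j = ρ⁻¹k exceed k, and m⁺_k < l⁺_{ρk} ≤ l⁺_k ≤ m⁺_j ≤
    -- m⁺_k is a contradiction. The first inequality is strict because q is not a root of unity.
    have hρ : ∀ n : ℕ, ∀ k : Fin N, (k : ℕ) = n → ρ k = k := by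
      intro n
      induction n using Nat.strong_induction_on with
      | _ n ih =>
        intro k hk
        by_contra hne'
        have hgt : k < ρ k := by
          rcases lt_trichotomy (ρ k) k with hh | hh | hh
          · have := ih (ρ k) (by rw [← hk]; exact hh) (ρ k) rfl
            exact absurd (ρ.injective this) hne'
          · exact absurd hh hne'
          · exact hh
        obtain ⟨j, hj⟩ := ρ.surjective k
        have hjk : k < j := by
          rcases lt_trichotomy j k with hh | hh | hh
          · have := ih j (by rw [← hk]; exact hh) j rfl
            rw [this] at hj
            exact absurd hj hh.ne
          · rw [hh] at hj; exact absurd hj hne'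
          · exact hh
        have h1 : plus m k < plus l (ρ k) := by
          have hle := hne _ _ (by have := Fin.lt_def.1 hgt; omega) (h k)
          rcases lt_or_eq_of_le hle with h0 | h0
          · omega
          · have := h k
            rw [h0, zpow_zero] at this
            have := hq' _ this.symm
            have := Fin.lt_def.1 hgt
            omega
        have h2 : plus l k ≤ plus m j := by
          have hj' := h j
          rw [hj] at hj'
          have := hne (((j : ℕ) : ℤ) - (k : ℕ)) (plus l k - plus m j)
            (by have := Fin.lt_def.1 hjk; omega)
            (by rw [← neg_sub, zpow_neg, hj', ← zpow_neg]; congr 1; ring)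
          omega
        have h3 := plus_antitone l hgt.le
        have h4 := plus_antitone m hjk.le
        omega
    funext k
    have hk := h k
    rw [hρ k k rfl, sub_self, mul_zero, zpow_zero] at hk
    have h1 := hne 0 _ le_rfl (hk.trans (by simp))
    have h2 := hne 0 (-(plus m k - plus l k)) le_rfl (by rw [zpow_neg, hk]; simp)
    omega

end Separation

end QWedge

end

noncomputable section

namespace QWedge

/-! ### The exchange operators and the Hecke operators on Laurent polynomials -/

variable {N : ℕ}

theorem laurent_ext {M : Type*} [AddCommMonoid M] [Module ℂ M] {A B : Laurent N →ₗ[ℂ] M}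
    (h : ∀ l, A (mono l) = B (mono l)) : A = B :=
  (AddMonoidAlgebra.basis (Fin N → ℤ) ℂ).ext fun l => by
    rw [AddMonoidAlgebra.basis_apply]; exact h l

/-- Multiplicativity of an operator. -/
def IsMult (φ : Module.End ℂ (Laurent N)) : Prop := ∀ f g, φ (f * g) = φ f * φ g

theorem isMult_onMono {F : (Fin N → ℤ) → Laurent N} (h : ∀ a b, F (a + b) = F a * F b) :
    IsMult (onMono F) := by
  have : (LinearMap.mul ℂ (Laurent N)).compr₂ (onMono F)
      = (LinearMap.mul ℂ (Laurent N)).compl₁₂ (onMono F) (onMono F) := by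
    refine laurent_ext fun a => laurent_ext fun b => ?_
    simp [mono_mul_mono, onMono_mono, h]
  intro f g
  exact LinearMap.congr_fun (LinearMap.congr_fun this f) g

theorem IsMult.mul {φ ψ : Module.End ℂ (Laurent N)} (hφ : IsMult φ) (hψ : IsMult ψ) :
    IsMult (φ * ψ) := fun f g => by
  simp only [Module.End.mul_apply, hψ f g, hφ _ _]

theorem permK_mono (i j : Fin N) (l : Fin N → ℤ) :
    permK i j (mono l) = mono (l ∘ Equiv.swap i j) := onMono_mono _ _

theorem isMult_permK (i j : Fin N) : IsMult (permK i j) :=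
  isMult_onMono fun a b => by rw [mono_mul_mono]; rfl

theorem pShift_mono (p : ℂ) (i : Fin N) (l : Fin N → ℤ) :
    pShift p i (mono l) = p ^ l i • mono l := onMono_mono _ _

theorem isMult_pShift {p : ℂ} (hp : p ≠ 0) (i : Fin N) : IsMult (pShift p i) :=
  isMult_onMono fun a b => by
    rw [smul_mul_smul_comm, mono_mul_mono, Pi.add_apply, zpow_add₀ hp]

theorem permK_comm (i j : Fin N) : permK i j = permK j i :=
  laurent_ext fun l => by rw [permK_mono, permK_mono, Equiv.swap_comm]

theorem permK_mul_self (i j : Fin N) : permK i j * permK i j = 1 :=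
  laurent_ext fun l => by
    rw [Module.End.mul_apply, permK_mono, permK_mono, Module.End.one_apply]
    congr 1
    funext x
    simp

theorem permK_conj (i j k l : Fin N) :
    permK i j * permK k l = permK (Equiv.swap i j k) (Equiv.swap i j l) * permK i j :=
  laurent_ext fun a => by
    simp only [Module.End.mul_apply, permK_mono]
    congr 1
    funext x
    simp only [Function.comp]
    rw [Equiv.swap_apply_apply, Equiv.Perm.mul_apply, Equiv.Perm.mul_apply]
    simp

theorem permK_zvar (i j k : Fin N) : permK i j (zvar k) = zvar (Equiv.swap i j k) := by
  rw [zvar, permK_mono, zvar]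
  congr 1
  funext x
  simp only [Function.comp, Pi.single_apply]
  congr 1
  rw [eq_iff_iff]
  constructor
  · intro h; rw [← h]; simp
  · rintro rfl; simp

theorem mono_injective : Function.Injective (mono : (Fin N → ℤ) → Laurent N) := by
  intro a b h
  have := (AddMonoidAlgebra.basis (Fin N → ℤ) ℂ).injective
  apply this
  rw [AddMonoidAlgebra.basis_apply, AddMonoidAlgebra.basis_apply]
  exact h

theorem zvar_sub_ne_zero {i j : Fin N} (h : i ≠ j) : (zvar i - zvar j : Laurent N) ≠ 0 := by
  rw [sub_ne_zero]
  intro h'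
  have := congrFun (mono_injective h') i
  simp [h] at this

variable {q : ℂ}

/-- Clearing the denominator loses nothing, since the Laurent polynomials form a domain; identities
between the g's are tested in this form. -/
theorem sub_mul_gOp {i j : Fin N} (hij : i ≠ j) (f : Laurent N) :
    (zvar i - zvar j) * gOp q i j f
      = (q⁻¹ • zvar i - q • zvar j) * permK i j f + (q - q⁻¹) • (zvar i * f) := by
  have h := sub_mul_divDiff hij f
  simp only [gOp, LinearMap.add_apply, Module.End.mul_apply, LinearMap.mulLeft_apply,
    LinearMap.smul_apply, Module.End.one_apply]
  rw [mul_add, mul_left_comm, h]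
  simp only [Algebra.smul_def, map_sub]
  ring

/-- A multiplicative operator that carries the variables `z_i, z_j` to a common multiple of
`z_i', z_j'` intertwines the Hecke operators. -/
theorem IsMult.mul_gOp {φ : Module.End ℂ (Laurent N)} (hφ : IsMult φ) {i j i' j' : Fin N}
    (hij : i ≠ j) (hij' : i' ≠ j') {c : ℂ} (hc : c ≠ 0) (hi : φ (zvar i) = c • zvar i')
    (hj : φ (zvar j) = c • zvar j') (hK : φ * permK i j = permK i' j' * φ) :
    φ * gOp q i j = gOp q i' j' * φ := by
  refine LinearMap.ext fun f => ?_
  have h := congrArg φ (sub_mul_gOp (q := q) hij f)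
  rw [hφ, map_add, hφ, map_smul, hφ, map_sub, map_sub, map_smul, map_smul, hi, hj,
    ← Module.End.mul_apply φ (permK i j), hK] at h
  have h' := sub_mul_gOp (q := q) hij' (φ f)
  have hne : (c • (zvar i' - zvar j') : Laurent N) ≠ 0 := smul_ne_zero hc (zvar_sub_ne_zero hij')
  apply mul_left_cancel₀ hne
  rw [Module.End.mul_apply, Module.End.mul_apply, smul_mul_assoc, smul_mul_assoc, h',
    ← smul_mul_assoc, smul_sub, h]
  simp only [Algebra.smul_def, Module.End.mul_apply]
  ring

theorem permK_mul_gOp (a b : Fin N) {i j : Fin N} (hij : i ≠ j) :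
    permK a b * gOp q i j
      = gOp q (Equiv.swap a b i) (Equiv.swap a b j) * permK a b :=
  (isMult_permK a b).mul_gOp hij ((Equiv.swap a b).injective.ne hij) one_ne_zero
    (by rw [permK_zvar, one_smul]) (by rw [permK_zvar, one_smul]) (permK_conj a b i j)

theorem gOp_mul_permK (a b : Fin N) {i j : Fin N} (hij : i ≠ j) :
    gOp q i j * permK a b
      = permK a b * gOp q (Equiv.swap a b i) (Equiv.swap a b j) := by
  rw [permK_mul_gOp a b ((Equiv.swap a b).injective.ne hij)]
  simp

/-- The Hecke operators are linear over the Laurent polynomials symmetric in `z_i, z_j`. -/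
theorem gOp_mul_of_symm {i j : Fin N} (hij : i ≠ j) {h : Laurent N} (hh : permK i j h = h)
    (f : Laurent N) : gOp q i j (h * f) = h * gOp q i j f := by
  apply mul_left_cancel₀ (zvar_sub_ne_zero hij)
  rw [sub_mul_gOp hij (h * f), mul_left_comm (zvar i - zvar j) h, sub_mul_gOp hij f,
    isMult_permK i j, hh]
  simp only [Algebra.smul_def]
  ring

/-- One operator is linear over polynomials in z_k and z_l and commutes with K_{k,l}, so it passes
through the cleared form of the other. -/
theorem gOp_commute {i j k l : Fin N} (hij : i ≠ j) (hkl : k ≠ l) (hik : i ≠ k) (hil : i ≠ l)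
    (hjk : j ≠ k) (hjl : j ≠ l) : Commute (gOp q i j) (gOp q k l) := by
  refine LinearMap.ext fun f => ?_
  simp only [Module.End.mul_apply]
  have hK : ∀ u, permK k l (gOp q i j u) = gOp q i j (permK k l u) := fun u => by
    have := permK_mul_gOp (q := q) k l hij
    rw [Equiv.swap_apply_of_ne_of_ne hik hil, Equiv.swap_apply_of_ne_of_ne hjk hjl] at this
    exact LinearMap.congr_fun this u
  have hz : permK i j (zvar k) = zvar k := by
    rw [permK_zvar, Equiv.swap_apply_of_ne_of_ne hik.symm hjk.symm]
  have hz' : permK i j (zvar l) = zvar l := by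
    rw [permK_zvar, Equiv.swap_apply_of_ne_of_ne hil.symm hjl.symm]
  apply mul_left_cancel₀ (zvar_sub_ne_zero hkl)
  rw [← gOp_mul_of_symm hij (by rw [map_sub, hz, hz']), sub_mul_gOp hkl, sub_mul_gOp hkl, map_add,
    map_smul, gOp_mul_of_symm hij hz, gOp_mul_of_symm hij (by
      rw [map_sub, map_smul, map_smul, hz, hz']), hK]

/-- The Hecke relation. -/
theorem gOp_mul_self (hq0 : q ≠ 0) {i j : Fin N} (hij : i ≠ j) :
    gOp q i j * gOp q i j = 1 + (q - q⁻¹) • gOp q i j := by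
  refine LinearMap.ext fun f => ?_
  simp only [Module.End.mul_apply, LinearMap.add_apply, LinearMap.smul_apply, Module.End.one_apply]
  have hK : permK i j (gOp q i j f) = gOp q j i (permK i j f) := by
    have := LinearMap.congr_fun (permK_mul_gOp (q := q) i j hij) f
    simpa using this
  have hKK : permK j i (permK i j f) = f := by
    rw [permK_comm j i]; exact LinearMap.congr_fun (permK_mul_self i j) f
  have h1 := sub_mul_gOp (q := q) hij f
  have h2 := sub_mul_gOp (q := q) hij (gOp q i j f)
  have h3 := sub_mul_gOp (q := q) hij.symm (permK i j f)
  rw [hKK] at h3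
  rw [hK] at h2
  have hQ : algebraMap ℂ (Laurent N) q * algebraMap ℂ (Laurent N) q⁻¹ = 1 := by
    rw [← map_mul, mul_inv_cancel₀ hq0, map_one]
  -- Two factors z_i - z_j are needed, one for each application of g.
  apply mul_left_cancel₀ (zvar_sub_ne_zero hij)
  apply mul_left_cancel₀ (zvar_sub_ne_zero hij)
  rw [h2, mul_add, mul_left_comm, ← neg_sub (zvar j) (zvar i), neg_mul _ (gOp q j i _), h3]
  simp only [Algebra.smul_def, map_sub] at h1 ⊢
  set Q := algebraMap ℂ (Laurent N) q
  set Q' := algebraMap ℂ (Laurent N) q⁻¹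
  set G := gOp q i j f
  set x : Laurent N := zvar i
  set y : Laurent N := zvar j
  linear_combination ((Q - Q') * x - (x - y) * (Q - Q')) * h1 + (x - y) ^ 2 * f * hQ


theorem gOp_commute_shift {p : ℂ} (hp : p ≠ 0) {i j k : Fin N} (hij : i ≠ j) (hki : k ≠ i)
    (hkj : k ≠ j) : Commute (pShift p k) (gOp q i j) := by
  refine (isMult_pShift hp k).mul_gOp hij hij one_ne_zero ?_ ?_ ?_
  · rw [zvar, pShift_mono, Pi.single_eq_of_ne hki, zpow_zero]
  · rw [zvar, pShift_mono, Pi.single_eq_of_ne hkj, zpow_zero]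
  · refine laurent_ext fun l => ?_
    simp only [Module.End.mul_apply, permK_mono, pShift_mono, map_smul, Function.comp,
      Equiv.swap_apply_of_ne_of_ne hki hkj]

theorem pShift_commute (p : ℂ) (i j : Fin N) : Commute (pShift p i) (pShift p j) :=
  laurent_ext fun l => by
    simp only [Module.End.mul_apply, pShift_mono, map_smul, smul_smul, mul_comm]

theorem permK_mul_pShift (p : ℂ) (i j k : Fin N) :
    permK i j * pShift p k = pShift p (Equiv.swap i j k) * permK i j :=
  laurent_ext fun l => by
    simp [Module.End.mul_apply, permK_mono, pShift_mono, map_smul]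

/-- The joint shift scales z_i and z_j by the same p, and g is homogeneous of degree 0; this is the
case c = p of `IsMult.mul_gOp`. -/
theorem gOp_commute_shift_mul {p : ℂ} (hp : p ≠ 0) {i j : Fin N} (hij : i ≠ j) :
    Commute (pShift p i * pShift p j) (gOp q i j) := by
  refine ((isMult_pShift hp i).mul (isMult_pShift hp j)).mul_gOp hij hij hp ?_ ?_ ?_
  · simp [zvar, pShift_mono, hij.symm]
  · simp [zvar, pShift_mono, hij]
  · rw [← mul_assoc, permK_mul_pShift, mul_assoc _ (permK i j), permK_mul_pShift,
      Equiv.swap_apply_left, Equiv.swap_apply_right, ← mul_assoc, (pShift_commute p j i).eq]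

/-- The braid relation. -/
theorem gOp_braid (hq0 : q ≠ 0) {a b c : Fin N} (hab : a ≠ b) (hac : a ≠ c) (hbc : b ≠ c) :
    gOp q a b * gOp q b c * gOp q a b = gOp q b c * gOp q a b * gOp q b c := by
  -- In the fraction field each g is an explicit combination of f and its exchange. Both sides then
  -- expand over the six permutations of z_a, z_b, z_c applied to f.
  have hι : Function.Injective (algebraMap (Laurent N) (FractionRing (Laurent N))) :=
    IsFractionRing.injective _ _
  set ι := algebraMap (Laurent N) (FractionRing (Laurent N))
  set Q := ι (algebraMap ℂ (Laurent N) q) with hQ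
  have hQ0 : Q ≠ 0 := by
    rw [hQ]
    exact (((isUnit_iff_ne_zero.2 hq0).map (algebraMap ℂ (Laurent N))).map ι).ne_zero
  have hQi : ι (algebraMap ℂ (Laurent N) q⁻¹) = Q⁻¹ := by
    apply eq_inv_of_mul_eq_one_left
    rw [hQ, ← map_mul, ← map_mul, inv_mul_cancel₀ hq0, map_one, map_one]
  have hne : ∀ {i j : Fin N}, i ≠ j → ι (zvar i) - ι (zvar j) ≠ 0 := fun h => by
    rw [← map_sub, map_ne_zero_iff ι hι]; exact zvar_sub_ne_zero h
  have key : ∀ {i j : Fin N}, i ≠ j → ∀ f, ι (gOp q i j f)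
      = ((Q⁻¹ * ι (zvar i) - Q * ι (zvar j)) * ι (permK i j f) + (Q - Q⁻¹) * ι (zvar i) * ι f)
        / (ι (zvar i) - ι (zvar j)) := fun {i j} h f => by
    rw [eq_div_iff (hne h), mul_comm, ← map_sub, ← map_mul, sub_mul_gOp h]
    simp only [Algebra.smul_def, map_add, map_sub, map_mul, hQi, ← hQ]
    ring
  have conj : ∀ (a b : Fin N) {i j : Fin N}, i ≠ j → ∀ f, permK a b (gOp q i j f)
      = gOp q (Equiv.swap a b i) (Equiv.swap a b j) (permK a b f) := fun a b {i j} h f =>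
    LinearMap.congr_fun (permK_mul_gOp (q := q) a b h) f
  have sq : ∀ (a b : Fin N) f, permK a b (permK a b f) = f := fun a b f =>
    LinearMap.congr_fun (permK_mul_self a b) f
  have pc : ∀ (i j k l : Fin N) f, permK i j (permK k l f)
      = permK (Equiv.swap i j k) (Equiv.swap i j l) (permK i j f) := fun i j k l f =>
    LinearMap.congr_fun (permK_conj i j k l) f
  have s1 : Equiv.swap a b c = c := Equiv.swap_apply_of_ne_of_ne hac.symm hbc.symm
  have s2 : Equiv.swap b c a = a := Equiv.swap_apply_of_ne_of_ne hab hac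
  have s3 : Equiv.swap a c b = b := Equiv.swap_apply_of_ne_of_ne hab.symm hbc
  have cab : ∀ f, permK a c (permK a b f) = permK a b (permK b c f) := fun f => by
    rw [pc a b b c, Equiv.swap_apply_right, s1]
  have cbc : ∀ f, permK a c (permK b c f) = permK b c (permK a b f) := fun f => by
    rw [pc b c a b, Equiv.swap_apply_left, s2]
  have bab : ∀ f, permK b c (permK a b (permK b c f)) = permK a c f := fun f => by
    rw [pc b c a b, Equiv.swap_apply_left, s2, sq]
  have aba : ∀ f, permK a b (permK b c (permK a b f)) = permK a c f := fun f => by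
    rw [pc a b b c, Equiv.swap_apply_right, s1, sq]
  have c1 := conj a b hbc
  have c2 := conj a b hab
  have c3 := conj b c hab
  have c4 := conj b c hbc
  have c5 := conj a c hab.symm
  have c6 := conj a c hbc.symm
  rw [Equiv.swap_apply_right, s1] at c1
  rw [Equiv.swap_apply_right, Equiv.swap_apply_left] at c2
  rw [Equiv.swap_apply_left, s2] at c3
  rw [Equiv.swap_apply_left, Equiv.swap_apply_right] at c4
  rw [Equiv.swap_apply_left, s3] at c5
  rw [Equiv.swap_apply_right, s3] at c6
  refine LinearMap.ext fun f => hι ?_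
  simp only [Module.End.mul_apply]
  -- The exchanges are pushed inwards onto f and their words reduced to six normal forms; what
  -- remains is an identity of rational functions in x, y, z and Q.
  simp only [key hab, key hbc, key hac, key hab.symm, key hbc.symm, c1, c2, c3, c4, c5, c6, cab, cbc,
    bab, aba, permK_comm b a, permK_comm c b, sq]
  have h1 := hne hab
  have h2 := hne hac
  have h3 := hne hbc
  rw [← neg_sub (ι (zvar a)) (ι (zvar b)), ← neg_sub (ι (zvar b)) (ι (zvar c))]
  generalize ι (permK a b (permK b c f)) = u
  generalize ι (permK b c (permK a b f)) = v
  generalize ι (permK a b f) = fab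
  generalize ι (permK b c f) = fbc
  generalize ι (permK a c f) = fac
  generalize ι f = f' at *
  generalize ι (zvar a) = x at *
  generalize ι (zvar b) = y at *
  generalize ι (zvar c) = z at *
  clear_value Q
  clear key conj sq pc cab cbc bab aba c1 c2 c3 c4 c5 c6 hne hQ hQi
  field_simp
  ring

end QWedge

end

noncomputable section

namespace QWedge

/-! ### The affine Hecke algebra relations -/

variable {N : ℕ} {q p : ℂ}

theorem permK_commute_gOp {i j k l : Fin N} (hij : i ≠ j) (hik : i ≠ k) (hil : i ≠ l)
    (hjk : j ≠ k) (hjl : j ≠ l) : Commute (permK k l) (gOp q i j) := by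
  have := permK_mul_gOp (q := q) k l hij
  rwa [Equiv.swap_apply_of_ne_of_ne hik hil, Equiv.swap_apply_of_ne_of_ne hjk hjl] at this

theorem permK_commute {i j k l : Fin N} (hik : i ≠ k) (hil : i ≠ l) (hjk : j ≠ k) (hjl : j ≠ l) :
    Commute (permK k l) (permK i j) := by
  have := permK_conj k l i j
  rwa [Equiv.swap_apply_of_ne_of_ne hik hil, Equiv.swap_apply_of_ne_of_ne hjk hjl] at this

/-- The inverse of `ξ_{i,j}`. -/
def xiInv (q : ℂ) (i j : Fin N) : Module.End ℂ (Laurent N) :=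
  (gOp q i j - (q - q⁻¹) • 1) * permK i j

theorem gOp_mul_sub (hq0 : q ≠ 0) {i j : Fin N} (hij : i ≠ j) :
    gOp q i j * (gOp q i j - (q - q⁻¹) • 1) = 1 := by
  rw [mul_sub, gOp_mul_self hq0 hij, mul_smul_comm, mul_one, add_sub_cancel_right]

theorem sub_mul_gOp_self (hq0 : q ≠ 0) {i j : Fin N} (hij : i ≠ j) :
    (gOp q i j - (q - q⁻¹) • 1) * gOp q i j = 1 := by
  rw [sub_mul, gOp_mul_self hq0 hij, smul_mul_assoc, one_mul, add_sub_cancel_right]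

theorem isUnit_gOp (hq0 : q ≠ 0) {i j : Fin N} (hij : i ≠ j) : IsUnit (gOp q i j) :=
  ⟨⟨_, _, gOp_mul_sub hq0 hij, sub_mul_gOp_self hq0 hij⟩, rfl⟩

theorem xiOp_mul_xiInv (hq0 : q ≠ 0) {i j : Fin N} (hij : i ≠ j) :
    xiOp q i j * xiInv q i j = 1 := by
  rw [xiOp, xiInv, mul_assoc, ← mul_assoc (gOp q i j), gOp_mul_sub hq0 hij, one_mul,
    permK_mul_self]

theorem xiInv_mul_xiOp (hq0 : q ≠ 0) {i j : Fin N} (hij : i ≠ j) :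
    xiInv q i j * xiOp q i j = 1 := by
  rw [xiOp, xiInv, mul_assoc, ← mul_assoc (permK i j), permK_mul_self, one_mul,
    sub_mul_gOp_self hq0 hij]

theorem isUnit_xiOp (hq0 : q ≠ 0) {i j : Fin N} (hij : i ≠ j) : IsUnit (xiOp q i j) :=
  ⟨⟨_, _, xiOp_mul_xiInv hq0 hij, xiInv_mul_xiOp hq0 hij⟩, rfl⟩

theorem isUnit_xiInv (hq0 : q ≠ 0) {i j : Fin N} (hij : i ≠ j) : IsUnit (xiInv q i j) :=
  ⟨⟨_, _, xiInv_mul_xiOp hq0 hij, xiOp_mul_xiInv hq0 hij⟩, rfl⟩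

theorem inverse_xiOp (hq0 : q ≠ 0) {i j : Fin N} (hij : i ≠ j) :
    Ring.inverse (xiOp q i j) = xiInv q i j :=
  Ring.inverse_unit ⟨_, _, xiOp_mul_xiInv hq0 hij, xiInv_mul_xiOp hq0 hij⟩

/-- The places after `i`, and the places before `i`, in order. -/
def after (i : Fin N) : List (Fin N) := (List.finRange N).filter (fun j => i < j)

/-- The places before `i`, in order. -/
def before (i : Fin N) : List (Fin N) := (List.finRange N).filter (fun j => j < i)

theorem mem_after {i j : Fin N} : j ∈ after i ↔ i < j := by simp [after]

theorem mem_before {i j : Fin N} : j ∈ before i ↔ j < i := by simp [before]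

theorem pairwise_after (i : Fin N) : (after i).Pairwise (· < ·) :=
  (List.pairwise_lt_finRange N).filter _

theorem pairwise_before (i : Fin N) : (before i).Pairwise (· < ·) :=
  (List.pairwise_lt_finRange N).filter _

theorem after_eq_cons {i j : Fin N} (hij : (i : ℕ) + 1 = j) : after i = j :: after j := by
  refine (pairwise_after i).eq_of_mem_iff (List.pairwise_cons.2
    ⟨fun k hk => mem_after.1 hk, pairwise_after j⟩) fun k => ?_
  simp only [List.mem_cons, mem_after, Fin.lt_def, Fin.ext_iff]
  omega

theorem before_eq_append {i j : Fin N} (hij : (i : ℕ) + 1 = j) : before j = before i ++ [i] := by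
  refine (pairwise_before j).eq_of_mem_iff (List.pairwise_append.2 ⟨pairwise_before i,
    List.pairwise_singleton _ _, fun a ha b hb => ?_⟩) fun k => ?_
  · rw [List.mem_singleton.1 hb]; exact mem_before.1 ha
  · simp only [List.mem_append, List.mem_singleton, mem_before, Fin.lt_def, Fin.ext_iff]
    omega

theorem after_split {i j k : Fin N} (hij : i < j) (hjk : (j : ℕ) + 1 = k) :
    ∃ L, (∀ a ∈ L, i < a ∧ a < j) ∧ after i = L ++ j :: k :: after k := by
  refine ⟨(after i).filter (· < j), fun a ha => by simpa [mem_after] using ha, ?_⟩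
  refine (pairwise_after i).eq_of_mem_iff (List.pairwise_append.2
    ⟨(pairwise_after i).filter _, ?_, fun a ha b hb => ?_⟩) fun a => ?_
  · rw [← after_eq_cons hjk]
    exact List.pairwise_cons.2 ⟨fun k hk => mem_after.1 hk, pairwise_after j⟩
  · rw [← after_eq_cons hjk, List.mem_cons, mem_after] at hb
    simp only [List.mem_filter, mem_after, decide_eq_true_eq] at ha
    rcases hb with rfl | hb
    · exact ha.2
    · exact ha.2.trans hb
  · simp only [List.mem_append, List.mem_filter, List.mem_cons, mem_after, Fin.lt_def, Fin.ext_iff,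
      decide_eq_true_eq] at hij ⊢
    omega

theorem yOp_eq (hq0 : q ≠ 0) (p : ℂ) (i : Fin N) : yOp q p i
    = ((after i).map (xiInv q i)).prod * pShift p i
      * ((before i).map fun j => xiOp q j i).prod := by
  rw [yOp, ← after, ← before]
  congr 3
  exact List.map_congr_left fun j hj => inverse_xiOp hq0 (mem_after.1 hj).ne

/-! #### Relations of the `ξ_{i,j}` -/

theorem permK_mul_xiInv {i j k : Fin N} (hki : k ≠ i) (hkj : k ≠ j) :
    permK i j * xiInv q i k = xiInv q j k * permK i j := by
  have h1 := permK_mul_gOp (q := q) i j hki.symm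
  have h2 := permK_conj i j i k
  rw [Equiv.swap_apply_left, Equiv.swap_apply_of_ne_of_ne hki hkj] at h1 h2
  have h3 : permK i j * (gOp q i k - (q - q⁻¹) • 1)
      = (gOp q j k - (q - q⁻¹) • 1) * permK i j := by
    rw [mul_sub, sub_mul, h1, mul_smul_comm, smul_mul_assoc, mul_one, one_mul]
  rw [xiInv, xiInv, mul_assoc, ← h2, ← mul_assoc, ← mul_assoc, h3]

theorem permK_mul_xiOp {i j k : Fin N} (hki : k ≠ i) (hkj : k ≠ j) :
    permK i j * xiOp q k i = xiOp q k j * permK i j := by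
  have h1 := permK_mul_gOp (q := q) i j hki
  have h2 := permK_conj i j k i
  rw [Equiv.swap_apply_left, Equiv.swap_apply_of_ne_of_ne hki hkj] at h1 h2
  rw [xiOp, xiOp, mul_assoc, ← h1, ← mul_assoc, ← mul_assoc, h2]

theorem list_prod_conj {M ι : Type*} [Monoid M] (x : M) (f g : ι → M) (L : List ι)
    (h : ∀ a ∈ L, x * f a = g a * x) : x * (L.map f).prod = (L.map g).prod * x := by
  induction L with
  | nil => simp
  | cons a L ih =>
    simp only [List.map_cons, List.prod_cons]
    rw [← mul_assoc, h a (by simp), mul_assoc, ih fun b hb => h b (by simp [hb]), mul_assoc]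

/-- The recursion `Y_{i+1} = g_{i,i+1} Y_i g_{i,i+1}`. -/
theorem yOp_succ (hq0 : q ≠ 0) (p : ℂ) {i j : Fin N} (hij : (i : ℕ) + 1 = j) :
    yOp q p j = gOp q i j * yOp q p i * gOp q i j := by
  have hne : i ≠ j := fun h => by rw [h] at hij; omega
  rw [yOp_eq hq0, yOp_eq hq0, after_eq_cons hij, before_eq_append hij]
  simp only [List.map_cons, List.prod_cons, List.map_append, List.prod_append, List.map_nil,
    List.prod_nil, mul_one]
  have h1 := list_prod_conj (permK i j) (xiInv q i) (xiInv q j) (after j) fun a ha => by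
    have := mem_after.1 ha
    exact permK_mul_xiInv (fun h => by rw [h, Fin.lt_def] at this; omega) this.ne'
  have h2 := permK_mul_pShift p i j i
  have h3 := list_prod_conj (permK i j) (fun a => xiOp q a i) (fun a => xiOp q a j) (before i)
    fun a ha => by
      have := mem_before.1 ha
      exact permK_mul_xiOp this.ne (fun h => by rw [h, Fin.lt_def] at this; omega)
  rw [Equiv.swap_apply_left] at h2
  set A := ((after j).map (xiInv q i)).prod
  set A' := ((after j).map (xiInv q j)).prod
  set B := ((before i).map fun a => xiOp q a i).prod
  set B' := ((before i).map fun a => xiOp q a j).prod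
  -- The factor ξ_{i,j}⁻¹, which only Y_i has, is absorbed by the left g and leaves the exchange
  -- that turns index i into index j in the remaining factors.
  have e : gOp q i j * xiInv q i j = permK i j := by
    rw [xiInv, ← mul_assoc, gOp_mul_sub hq0 hne, one_mul]
  calc A' * pShift p j * (B' * xiOp q i j)
      = A' * pShift p j * (B' * permK i j) * gOp q i j := by simp only [xiOp, mul_assoc]
    _ = A' * (pShift p j * permK i j) * B * gOp q i j := by rw [← h3]; simp only [mul_assoc]
    _ = (A' * permK i j) * pShift p i * B * gOp q i j := by rw [← h2]; simp only [mul_assoc]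
    _ = permK i j * A * pShift p i * B * gOp q i j := by rw [← h1]
    _ = _ := by rw [← e]; simp only [mul_assoc]

/-- The Yang–Baxter equation. -/
theorem xiOp_yang_baxter (hq0 : q ≠ 0) {i j k : Fin N} (hij : i ≠ j) (hik : i ≠ k) (hjk : j ≠ k) :
    xiOp q i j * xiOp q i k * xiOp q j k = xiOp q j k * xiOp q i k * xiOp q i j := by
  have s1 : Equiv.swap j k i = i := Equiv.swap_apply_of_ne_of_ne hij hik
  have s2 : Equiv.swap i k j = j := Equiv.swap_apply_of_ne_of_ne hij.symm hjk
  have s3 : Equiv.swap i j k = k := Equiv.swap_apply_of_ne_of_ne hik.symm hjk.symm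
  have a1 := gOp_mul_permK (q := q) j k hik
  have a2 := gOp_mul_permK (q := q) i k hij
  have a3 := gOp_mul_permK (q := q) j k hjk.symm
  have a4 := gOp_mul_permK (q := q) i j hik
  have a5 := gOp_mul_permK (q := q) i k hjk
  have a6 := gOp_mul_permK (q := q) i j hij.symm
  have k1 := permK_conj i j i k
  have k2 := permK_conj j k i k
  have k3 := permK_conj j k i j
  have k4 := permK_conj i j j k
  rw [s1, Equiv.swap_apply_right] at a1 k2
  rw [s1, Equiv.swap_apply_left] at k3
  rw [s3, Equiv.swap_apply_right] at k4
  rw [s2, Equiv.swap_apply_left] at a2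
  rw [Equiv.swap_apply_left, Equiv.swap_apply_right] at a3 a6
  rw [s3, Equiv.swap_apply_left] at a4 k1
  rw [s2, Equiv.swap_apply_right] at a5
  -- After all exchanges are moved to the left, the two sides differ by this relation of
  -- transpositions and by the braid relation of the g's.
  have kk : permK i j * permK i k * permK j k = permK j k * permK i k * permK i j := by
    rw [k1, k2, k3, k4, mul_assoc, mul_assoc, permK_mul_self, permK_mul_self]
  calc xiOp q i j * xiOp q i k * xiOp q j k
      = permK i j * gOp q i j * permK i k * (gOp q i k * permK j k) * gOp q j k := by
        simp only [xiOp, mul_assoc]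
    _ = permK i j * (gOp q i j * permK i k) * permK j k * gOp q i j * gOp q j k := by
        rw [a1]; simp only [mul_assoc]
    _ = permK i j * permK i k * (gOp q k j * permK j k) * gOp q i j * gOp q j k := by
        rw [a2]; simp only [mul_assoc]
    _ = permK i j * permK i k * permK j k * (gOp q j k * gOp q i j * gOp q j k) := by
        rw [a3]; simp only [mul_assoc]
    _ = permK j k * permK i k * permK i j * (gOp q i j * gOp q j k * gOp q i j) := by
        rw [gOp_braid hq0 hij hik hjk, kk]
    _ = permK j k * permK i k * (gOp q j i * permK i j) * gOp q j k * gOp q i j := by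
        rw [a6]; simp only [mul_assoc]
    _ = permK j k * (gOp q j k * permK i k) * permK i j * gOp q j k * gOp q i j := by
        rw [a5]; simp only [mul_assoc]
    _ = permK j k * gOp q j k * permK i k * (gOp q i k * permK i j) * gOp q i j := by
        rw [a4]; simp only [mul_assoc]
    _ = _ := by simp only [xiOp, mul_assoc]

/-- Multiplying by the inverses of y and z on both sides yields the form that moves ξ_{i,j} through
the inverse factors of the Y's. -/
theorem yang_baxter_inv {M : Type*} [Monoid M] {x y z y' z' : M} (h : x * y * z = z * y * x)
    (h1 : y' * y = 1) (h1' : y * y' = 1) (h2 : z' * z = 1) (h2' : z * z' = 1) :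
    x * z' * y' = y' * z' * x := by
  calc x * z' * y' = y' * (z' * z) * y * x * z' * y' := by rw [h2, mul_one, h1, one_mul]
    _ = y' * z' * (z * y * x) * z' * y' := by simp only [mul_assoc]
    _ = y' * z' * x * y * (z * z') * y' := by rw [← h]; simp only [mul_assoc]
    _ = _ := by rw [h2', mul_one, mul_assoc _ y, h1', mul_one]

theorem xiOp_mul_xiInv_mul_xiInv (hq0 : q ≠ 0) {i j k : Fin N} (hij : i ≠ j) (hik : i ≠ k)
    (hjk : j ≠ k) : xiOp q i j * xiInv q j k * xiInv q i k
      = xiInv q i k * xiInv q j k * xiOp q i j :=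
  yang_baxter_inv (xiOp_yang_baxter hq0 hij hik hjk) (xiInv_mul_xiOp hq0 hik)
    (xiOp_mul_xiInv hq0 hik) (xiInv_mul_xiOp hq0 hjk) (xiOp_mul_xiInv hq0 hjk)

/-- Write g_{j,k} = K_{j,k} ξ_{j,k}. By Yang–Baxter ξ_{j,k} passes ξ_{i,k} ξ_{i,j} and reverses
their order, and K_{j,k} restores it; then pass to inverses. -/
theorem gOp_commute_xiInv_mul_xiInv (hq0 : q ≠ 0) {i j k : Fin N} (hij : i ≠ j) (hik : i ≠ k)
    (hjk : j ≠ k) : Commute (gOp q j k) (xiInv q i j * xiInv q i k) := by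
  have h := xiOp_yang_baxter hq0 hij hik hjk
  have e1 := permK_conj j k i j
  have g1 := permK_mul_gOp (q := q) j k hij
  have e2 := permK_conj j k i k
  have g2 := permK_mul_gOp (q := q) j k hik
  have s1 : Equiv.swap j k i = i := Equiv.swap_apply_of_ne_of_ne hij hik
  rw [s1, Equiv.swap_apply_left] at e1 g1
  rw [s1, Equiv.swap_apply_right] at e2 g2
  have f1 : permK j k * xiOp q i j = xiOp q i k * permK j k := by
    rw [xiOp, xiOp, ← mul_assoc, e1, mul_assoc, g1, mul_assoc]
  have f2 : permK j k * xiOp q i k = xiOp q i j * permK j k := by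
    rw [xiOp, xiOp, ← mul_assoc, e2, mul_assoc, g2, mul_assoc]
  have e3 : permK j k * xiOp q j k = gOp q j k := by
    rw [xiOp, ← mul_assoc, permK_mul_self, one_mul]
  have c : Commute (gOp q j k) (xiOp q i k * xiOp q i j) := by
    show _ = _
    calc gOp q j k * (xiOp q i k * xiOp q i j)
        = permK j k * (xiOp q j k * xiOp q i k * xiOp q i j) := by
          rw [← e3]; simp only [mul_assoc]
      _ = (permK j k * xiOp q i j) * xiOp q i k * xiOp q j k := by
          rw [← h]; simp only [mul_assoc]
      _ = xiOp q i k * (permK j k * xiOp q i k) * xiOp q j k := by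
          rw [f1]; simp only [mul_assoc]
      _ = xiOp q i k * xiOp q i j * (permK j k * xiOp q j k) := by
          rw [f2]; simp only [mul_assoc]
      _ = _ := by rw [e3]
  let u : (Module.End ℂ (Laurent N))ˣ := ⟨xiOp q i k * xiOp q i j, xiInv q i j * xiInv q i k,
    by rw [mul_assoc, ← mul_assoc (xiOp q i j), xiOp_mul_xiInv hq0 hij, one_mul,
      xiOp_mul_xiInv hq0 hik],
    by rw [mul_assoc, ← mul_assoc (xiInv q i k), xiInv_mul_xiOp hq0 hik, one_mul,
      xiInv_mul_xiOp hq0 hij]⟩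
  exact Commute.units_inv_right (u := u) c

theorem Commute_xiInv {x : Module.End ℂ (Laurent N)} {i j : Fin N} (h : Commute x (gOp q i j))
    (h' : Commute x (permK i j)) : Commute x (xiInv q i j) :=
  (h.sub_right ((Commute.one_right x).smul_right _)).mul_right h'

theorem gOp_commute_xiInv {i j k l : Fin N} (hij : i ≠ j) (hkl : k ≠ l) (hik : i ≠ k) (hil : i ≠ l)
    (hjk : j ≠ k) (hjl : j ≠ l) : Commute (gOp q i j) (xiInv q k l) :=
  Commute_xiInv (gOp_commute hij hkl hik hil hjk hjl)
    (permK_commute_gOp hij hik hil hjk hjl).symm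

theorem xiInv_commute {i j k l : Fin N} (hij : i ≠ j) (hkl : k ≠ l) (hik : i ≠ k) (hil : i ≠ l)
    (hjk : j ≠ k) (hjl : j ≠ l) : Commute (xiInv q i j) (xiInv q k l) :=
  Commute_xiInv (gOp_commute_xiInv hkl hij hik.symm hjk.symm hil.symm hjl.symm).symm
    (Commute_xiInv (permK_commute_gOp hij hik hil hjk hjl)
      (permK_commute hik hil hjk hjl)).symm

theorem pShift_commute_xiInv (hp0 : p ≠ 0) {i j k : Fin N} (hij : i ≠ j) (hki : k ≠ i)
    (hkj : k ≠ j) : Commute (pShift p k) (xiInv q i j) := by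
  refine Commute_xiInv (gOp_commute_shift hp0 hij hki hkj) ?_
  have := permK_mul_pShift p i j k
  rw [Equiv.swap_apply_of_ne_of_ne hki hkj] at this
  exact this.symm

theorem pShift_mul_commute_xiOp (hp0 : p ≠ 0) {i j : Fin N} (hij : i ≠ j) :
    Commute (pShift p i * pShift p j) (xiOp q i j) := by
  refine Commute.mul_right ?_ (gOp_commute_shift_mul hp0 hij)
  have h1 := permK_mul_pShift p i j i
  have h2 := permK_mul_pShift p i j j
  rw [Equiv.swap_apply_left] at h1
  rw [Equiv.swap_apply_right] at h2
  show _ = _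
  rw [← mul_assoc, h1, mul_assoc _ (permK i j), h2, ← mul_assoc, (pShift_commute p j i).eq]

/-! #### The operators `Y_i` -/

theorem before_eq_nil {i : Fin N} (hi : (i : ℕ) = 0) : before i = [] :=
  List.eq_nil_iff_forall_not_mem.2 fun a ha => by
    have := mem_before.1 ha
    rw [Fin.lt_def] at this
    omega

/-- The first Y has no factors ξ on the right of the shift. Its two neighbouring factors ξ_{i,j}⁻¹
ξ_{i,k}⁻¹ commute with g_{j,k} as a pair, and all other factors involve neither j nor k. -/
theorem gOp_commute_yOp_zero (hq0 : q ≠ 0) (hp0 : p ≠ 0) {i j k : Fin N} (hi : (i : ℕ) = 0)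
    (hij : i < j) (hjk : (j : ℕ) + 1 = k) : Commute (gOp q j k) (yOp q p i) := by
  rw [yOp_eq hq0, before_eq_nil hi]
  obtain ⟨L, hL, hs⟩ := after_split hij hjk
  have hik : i < k := by rw [Fin.lt_def] at *; omega
  have hjk' : j < k := by rw [Fin.lt_def] at *; omega
  rw [hs]
  simp only [List.map_nil, List.prod_nil, mul_one, List.map_append, List.map_cons, List.prod_append,
    List.prod_cons]
  refine Commute.mul_right (Commute.mul_right ?_ ?_)
    (gOp_commute_shift hp0 hjk'.ne hij.ne hik.ne).symm
  · refine Commute.list_prod_right _ _ fun x hx => ?_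
    obtain ⟨a, ha, rfl⟩ := List.mem_map.1 hx
    obtain ⟨h1, h2⟩ := hL a ha
    exact gOp_commute_xiInv hjk'.ne h1.ne hij.ne' h2.ne' hik.ne' (h2.trans hjk').ne'
  · rw [← mul_assoc]
    refine Commute.mul_right (gOp_commute_xiInv_mul_xiInv hq0 hij.ne hik.ne hjk'.ne) ?_
    refine Commute.list_prod_right _ _ fun x hx => ?_
    obtain ⟨a, ha, rfl⟩ := List.mem_map.1 hx
    have := mem_after.1 ha
    exact gOp_commute_xiInv hjk'.ne (hik.trans this).ne hij.ne' (hjk'.trans this).ne hik.ne'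
      this.ne

/-- Induction on i through Y_i = g Y_{i-1} g. The new g commutes with g_{j,k} unless k = i - 1; then
one descends twice, to Y_j, and the braid relation carries g_{j,k} across. -/
theorem gOp_commute_yOp (hq0 : q ≠ 0) (hp0 : p ≠ 0) (i : Fin N) {j k : Fin N}
    (hjk : (j : ℕ) + 1 = k) (hj : j ≠ i) (hk : k ≠ i) : Commute (gOp q j k) (yOp q p i) := by
  obtain ⟨n, hn⟩ : ∃ n, (i : ℕ) = n := ⟨_, rfl⟩
  induction n using Nat.strong_induction_on generalizing i j k with
  | _ n ih =>
    have hj' : (j : ℕ) ≠ i := fun h => hj (Fin.ext h)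
    have hk' : (k : ℕ) ≠ i := fun h => hk (Fin.ext h)
    have hjkne : j ≠ k := fun h => by rw [h] at hjk; omega
    rcases Nat.eq_zero_or_pos n with h0 | h0
    · exact gOp_commute_yOp_zero hq0 hp0 (hn.trans h0) (by rw [Fin.lt_def]; omega) hjk
    · obtain ⟨i', hi'⟩ : ∃ i' : Fin N, (i' : ℕ) + 1 = i :=
        ⟨⟨i - 1, by omega⟩, by simp; omega⟩
      have hi'i : i' ≠ i := fun h => by rw [h] at hi'; omega
      by_cases hki : k = i'
      · have hji : j ≠ i := hj
        have c := ih j (by omega) j (j := i') (k := i) hi' (by rw [← hki]; exact hjkne.symm)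
          hji.symm rfl
        have b := gOp_braid (q := q) hq0 hjkne hji (hki ▸ hi'i : k ≠ i)
        rw [yOp_succ hq0 p hi', ← hki, yOp_succ hq0 p hjk]
        rw [← hki] at c
        set S := gOp q j k
        set T := gOp q k i
        set X := yOp q p j
        show S * (T * (S * X * S) * T) = T * (S * X * S) * T * S
        calc S * (T * (S * X * S) * T) = (S * T * S) * X * S * T := by simp only [mul_assoc]
          _ = T * S * (T * X) * S * T := by rw [b]; simp only [mul_assoc]
          _ = T * S * X * (T * S * T) := by rw [c.eq]; simp only [mul_assoc]
          _ = _ := by rw [← b]; simp only [mul_assoc]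
      · have hji' : j ≠ i' := fun h => by rw [h] at hjk; omega
        have c1 := ih i' (by omega) i' hjk hji' hki rfl
        have c2 : Commute (gOp q j k) (gOp q i' i) := gOp_commute hjkne hi'i hji' hj hki hk
        rw [yOp_succ hq0 p hi']
        exact (c2.mul_right c1).mul_right c2

/-- One Yang–Baxter move per element of the list; factors with four distinct indices are reordered
freely. -/
theorem xiOp_mul_list_prod (hq0 : q ≠ 0) {i j : Fin N} (hij : i ≠ j) (L : List (Fin N))
    (hL : L.Nodup) (hiL : i ∉ L) (hjL : j ∉ L) :
    xiOp q i j * ((L.map (xiInv q j)).prod * (L.map (xiInv q i)).prod)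
      = (L.map (xiInv q i)).prod * (L.map (xiInv q j)).prod * xiOp q i j := by
  induction L with
  | nil => simp
  | cons k L ih =>
    simp only [List.nodup_cons, List.mem_cons, not_or] at hL hiL hjL
    have ih := ih hL.2 hiL.2 hjL.2
    simp only [List.map_cons, List.prod_cons]
    have hc : ∀ {a b : Fin N}, a ≠ b → a ∉ L → b ∉ L → a ≠ k → b ≠ k →
        Commute (L.map (xiInv q a)).prod (xiInv q b k) := fun {a b} hab ha hb hak hbk => by
      refine Commute.list_prod_left _ _ fun x hx => ?_
      obtain ⟨c, hc, rfl⟩ := List.mem_map.1 hx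
      exact xiInv_commute (fun h => ha (h ▸ hc)) hbk hab hak (fun h => hb (h ▸ hc))
        (fun h => hL.1 (h ▸ hc))
    have c1 := hc hij.symm hjL.2 hiL.2 hjL.1 hiL.1
    have c2 := hc hij hiL.2 hjL.2 hiL.1 hjL.1
    have y := xiOp_mul_xiInv_mul_xiInv hq0 hij hiL.1 hjL.1
    set A := (L.map (xiInv q i)).prod
    set B := (L.map (xiInv q j)).prod
    calc xiOp q i j * (xiInv q j k * B * (xiInv q i k * A))
        = xiOp q i j * xiInv q j k * (B * xiInv q i k) * A := by simp only [mul_assoc]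
      _ = (xiOp q i j * xiInv q j k * xiInv q i k) * B * A := by
          rw [c1.eq]; simp only [mul_assoc]
      _ = xiInv q i k * xiInv q j k * (xiOp q i j * (B * A)) := by
          rw [y]; simp only [mul_assoc]
      _ = xiInv q i k * (xiInv q j k * A) * B * xiOp q i j := by
          rw [ih]; simp only [mul_assoc]
      _ = _ := by rw [← c2.eq]; simp only [mul_assoc]

/-- With A, B the products of the ξ_{i,k}⁻¹ and of the ξ_{j,k}⁻¹ over later k, both products of the
two Y's reduce to B A p^{D_i} p^{D_j}: ξ_{i,j} and its inverse meet and cancel after ξ_{i,j} has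
passed the joint shift and A B. -/
theorem yOp_commute_zero (hq0 : q ≠ 0) (hp0 : p ≠ 0) {i j : Fin N} (hi : (i : ℕ) = 0)
    (hij : (i : ℕ) + 1 = j) : Commute (yOp q p i) (yOp q p j) := by
  have hlt : i < j := by rw [Fin.lt_def]; omega
  rw [yOp_eq hq0, yOp_eq hq0, before_eq_append hij, before_eq_nil hi, after_eq_cons hij]
  simp only [List.map_nil, List.prod_nil, mul_one, List.nil_append, List.map_cons, List.prod_cons]
  have hiL : i ∉ after j := fun h => absurd (mem_after.1 h) hlt.not_gt
  have hjL : j ∉ after j := fun h => absurd (mem_after.1 h) (lt_irrefl _)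
  have y := xiOp_mul_list_prod (q := q) hq0 hlt.ne (after j)
    ((pairwise_after j).imp fun h => h.ne) hiL hjL
  have c1 : Commute (pShift p i) ((after j).map (xiInv q j)).prod := by
    refine Commute.list_prod_right _ _ fun x hx => ?_
    obtain ⟨a, ha, rfl⟩ := List.mem_map.1 hx
    exact pShift_commute_xiInv hp0 (mem_after.1 ha).ne hlt.ne (hlt.trans (mem_after.1 ha)).ne
  have c2 : Commute (pShift p j) ((after j).map (xiInv q i)).prod := by
    refine Commute.list_prod_right _ _ fun x hx => ?_
    obtain ⟨a, ha, rfl⟩ := List.mem_map.1 hx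
    exact pShift_commute_xiInv hp0 (hlt.trans (mem_after.1 ha)).ne hlt.ne' (mem_after.1 ha).ne
  have c3 := pShift_mul_commute_xiOp (q := q) hp0 hlt.ne
  have c4 := pShift_commute p i j
  have x1 := xiInv_mul_xiOp hq0 hlt.ne
  have x2 := xiOp_mul_xiInv hq0 hlt.ne
  set A := ((after j).map (xiInv q i)).prod
  set B := ((after j).map (xiInv q j)).prod
  set Z := xiOp q i j
  set W := xiInv q i j
  show W * A * pShift p i * (B * pShift p j * Z) = B * pShift p j * Z * (W * A * pShift p i)
  calc W * A * pShift p i * (B * pShift p j * Z)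
      = W * A * (pShift p i * B) * pShift p j * Z := by simp only [mul_assoc]
    _ = W * A * B * ((pShift p i * pShift p j) * Z) := by rw [c1.eq]; simp only [mul_assoc]
    _ = W * (A * B * Z) * (pShift p i * pShift p j) := by rw [c3.eq]; simp only [mul_assoc]
    _ = (W * Z) * B * A * (pShift p i * pShift p j) := by rw [← y]; simp only [mul_assoc]
    _ = B * (A * pShift p j) * pShift p i := by rw [x1, c4.eq]; simp only [mul_assoc, one_mul]
    _ = B * pShift p j * (Z * W) * A * pShift p i := by
      rw [← c2.eq, x2]; simp only [mul_assoc, one_mul]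
    _ = _ := by simp only [mul_assoc]

/-- The first two Y's are the only real case. The recursion first raises j and then i, and each new
g commutes with the other Y. -/
theorem yOp_commute_of_lt (hq0 : q ≠ 0) (hp0 : p ≠ 0) {i j : Fin N} (hij : i < j) :
    Commute (yOp q p i) (yOp q p j) := by
  obtain ⟨n, hn⟩ : ∃ n, (i : ℕ) = n := ⟨_, rfl⟩
  induction n generalizing i j with
  | zero =>
    obtain ⟨m, hm⟩ : ∃ m, (j : ℕ) = m + 1 := ⟨j - 1, by rw [Fin.lt_def] at hij; omega⟩
    induction m generalizing j with
    | zero => exact yOp_commute_zero hq0 hp0 hn (by omega)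
    | succ m ih =>
      obtain ⟨j', hj'⟩ : ∃ j' : Fin N, (j' : ℕ) + 1 = j := ⟨⟨j - 1, by omega⟩, by simp; omega⟩
      have h1 : i < j' := by rw [Fin.lt_def]; omega
      have c := ih h1 (by omega)
      have g := gOp_commute_yOp hq0 hp0 i hj' h1.ne' hij.ne'
      rw [yOp_succ hq0 p hj']
      exact (g.symm.mul_right c).mul_right g.symm
  | succ n ih =>
    obtain ⟨i', hi'⟩ : ∃ i' : Fin N, (i' : ℕ) + 1 = i := ⟨⟨i - 1, by omega⟩, by simp; omega⟩
    have h1 : i' < j := by rw [Fin.lt_def] at *; omega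
    have c := ih h1 (by omega)
    have g := gOp_commute_yOp hq0 hp0 j hi' h1.ne hij.ne
    rw [yOp_succ hq0 p hi']
    exact (g.mul_left c).mul_left g

theorem yOp_commute (hq0 : q ≠ 0) (hp0 : p ≠ 0) (i j : Fin N) :
    Commute (yOp q p i) (yOp q p j) := by
  rcases lt_trichotomy i j with h | rfl | h
  · exact yOp_commute_of_lt hq0 hp0 h
  · exact Commute.refl _
  · exact (yOp_commute_of_lt hq0 hp0 h).symm

theorem isUnit_pShift (hp0 : p ≠ 0) (i : Fin N) : IsUnit (pShift p i) := by
  have : ∀ {a b : ℂ}, a * b = 1 → pShift a i * pShift b i = 1 := fun h =>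
    laurent_ext fun l => by
      rw [Module.End.mul_apply, pShift_mono, map_smul, pShift_mono, smul_smul, ← mul_zpow,
        mul_comm, h, one_zpow, one_smul, Module.End.one_apply]
  exact ⟨⟨_, _, this (mul_inv_cancel₀ hp0), this (inv_mul_cancel₀ hp0)⟩, rfl⟩

theorem isUnit_yOp (hq0 : q ≠ 0) (hp0 : p ≠ 0) (i : Fin N) : IsUnit (yOp q p i) := by
  have hL : ∀ L : List (Module.End ℂ (Laurent N)), (∀ x ∈ L, IsUnit x) → IsUnit L.prod := by
    intro L
    induction L with
    | nil => simp
    | cons a L ih =>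
      intro h
      rw [List.prod_cons]
      exact (h a (by simp)).mul (ih fun x hx => h x (by simp [hx]))
  rw [yOp_eq hq0]
  refine ((hL _ fun x hx => ?_).mul (isUnit_pShift hp0 i)).mul (hL _ fun x hx => ?_)
  · obtain ⟨a, ha, rfl⟩ := List.mem_map.1 hx
    exact isUnit_xiInv hq0 (mem_after.1 ha).ne
  · obtain ⟨a, ha, rfl⟩ := List.mem_map.1 hx
    exact isUnit_xiOp hq0 (mem_before.1 ha).ne

end QWedge

end

noncomputable section

namespace QWedge

/-! ### The operators on monomials -/

variable {N : ℕ} {q p : ℂ}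

/-- The span of the monomials with exponents in `S`. -/
def monoSpan (S : Set (Fin N → ℤ)) : Submodule ℂ (Laurent N) := Submodule.span ℂ (mono '' S)

theorem mono_mem {S : Set (Fin N → ℤ)} {l : Fin N → ℤ} (h : l ∈ S) : mono l ∈ monoSpan S :=
  Submodule.subset_span ⟨l, h, rfl⟩

theorem monoSpan_mono {S T : Set (Fin N → ℤ)} (h : S ⊆ T) : monoSpan S ≤ monoSpan T :=
  Submodule.span_mono (Set.image_mono h)

theorem monoSpan_le {S : Set (Fin N → ℤ)} {U : Submodule ℂ (Laurent N)}
    (h : ∀ l ∈ S, mono l ∈ U) : monoSpan S ≤ U := by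
  rw [monoSpan, Submodule.span_le]
  rintro _ ⟨l, hl, rfl⟩
  exact h l hl

/-- The sequences that differ from `l` in the places `i, j` only, where they have the same sum as
`l` and entries strictly between those of `l`. -/
def Between (i j : Fin N) (l : Fin N → ℤ) : Set (Fin N → ℤ) :=
  {m | (∀ k, k ≠ i ∧ k ≠ j → m k = l k) ∧ m i + m j = l i + l j ∧
    min (l i) (l j) < m i ∧ m i < max (l i) (l j)}

/-- Moving two entries towards each other with fixed sum does not raise any convex test function. -/
theorem between_below {i j : Fin N} (hij : i ≠ j) {l m : Fin N → ℤ} (h : m ∈ Between i j l) :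
    Below l m := by
  obtain ⟨h1, h2, h3, h4⟩ := h
  have hsub : ∀ c, hinge c l - hinge c m = (max (l i - c) 0 - max (m i - c) 0)
      + (max (l j - c) 0 - max (m j - c) 0) := fun c => by
    rw [hinge, hinge, ← Finset.sum_sub_distrib]
    exact Fintype.sum_eq_add i j hij fun x hx => by rw [h1 x hx, sub_self]
  refine ⟨⟨?_, fun c => ?_⟩, fun h => ?_⟩
  · rw [← sub_eq_zero, ← Finset.sum_sub_distrib, Fintype.sum_eq_add i j hij fun x hx => by
      rw [h1 x hx, sub_self]]
    omega
  · have := hsub c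
    omega
  -- At this threshold the larger entry of l contributes 1, while neither of the two entries of m
  -- contributes.
  · have := h.2 (max (l i) (l j) - 1)
    have := hsub (max (l i) (l j) - 1)
    omega

/-- The sequence `l` with the entries in the places `i, j` replaced. -/
def setTwo (i j : Fin N) (l : Fin N → ℤ) (a b : ℤ) : Fin N → ℤ :=
  Function.update (Function.update l i a) j b

theorem setTwo_self (i j : Fin N) (l : Fin N → ℤ) : setTwo i j l (l i) (l j) = l := by
  simp [setTwo]

theorem setTwo_swap {i j : Fin N} (hij : i ≠ j) (l : Fin N → ℤ) :
    setTwo i j l (l j) (l i) = l ∘ Equiv.swap i j := by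
  funext x
  by_cases hx : x = j
  · subst hx; simp [setTwo]
  · by_cases hy : x = i
    · subst hy; simp [setTwo, hij]
    · simp [setTwo, hx, hy, Equiv.swap_apply_of_ne_of_ne]

theorem setTwo_mem_between {i j : Fin N} (hij : i ≠ j) {l : Fin N → ℤ} {a b : ℤ}
    (h : a + b = l i + l j) (h1 : min (l i) (l j) < a) (h2 : a < max (l i) (l j)) :
    setTwo i j l a b ∈ Between i j l := by
  have e1 : setTwo i j l a b i = a := by simp [setTwo, hij]
  have e2 : setTwo i j l a b j = b := by simp [setTwo]
  exact ⟨fun k hk => by simp [setTwo, hk.1, hk.2], by rw [e1, e2, h], by rwa [e1], by rwa [e1]⟩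

theorem zvar_left_mul_setTwo {i j : Fin N} (hij : i ≠ j) (l : Fin N → ℤ) (a b : ℤ) :
    zvar i * mono (setTwo i j l a b) = mono (setTwo i j l (a + 1) b) := by
  rw [zvar, mono_mul_mono]
  congr 1
  funext x
  by_cases hx : x = j
  · subst hx; simp [setTwo, hij.symm]
  · by_cases hy : x = i
    · subst hy; simp [setTwo, hij]; ring
    · simp [setTwo, hx, hy]

theorem zvar_right_mul_setTwo (i j : Fin N) (l : Fin N → ℤ) (a b : ℤ) :
    zvar j * mono (setTwo i j l a b) = mono (setTwo i j l a (b + 1)) := by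
  rw [zvar, mono_mul_mono]
  congr 1
  funext x
  by_cases hx : x = j
  · subst hx; simp [setTwo]; ring
  · simp [setTwo, hx]

theorem gOp_mono (i j : Fin N) (l : Fin N → ℤ) : gOp q i j (mono l)
    = (q⁻¹ • zvar i - q • zvar j) * divDiffMono i j l + q • mono l := by
  simp only [gOp, LinearMap.add_apply, Module.End.mul_apply, LinearMap.mulLeft_apply,
    LinearMap.smul_apply, Module.End.one_apply, divDiff, onMono_mono]

/-- The two linear terms shift the string of monomials by one step in opposite variables. Only the
far end of one string and the near end of the other leave the open interval; they are the two
corrections. -/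
theorem linear_mul_sum_setTwo {i j : Fin N} (hij : i ≠ j) (l : Fin N → ℤ) (a b : ℤ) (d : ℕ)
    (hab : a + b = l i + l j) (h1 : min (l i) (l j) ≤ a) (h2 : a + d + 1 ≤ max (l i) (l j)) :
    (q⁻¹ • zvar i - q • zvar j) * ∑ k ∈ Finset.range (d + 1),
        mono (setTwo i j l (a + k) (b - 1 - k))
      - q⁻¹ • mono (setTwo i j l (a + (d + 1)) (b - (d + 1))) + q • mono (setTwo i j l a b)
      ∈ monoSpan (Between i j l) := by
  have e1 : zvar i * ∑ k ∈ Finset.range (d + 1), mono (setTwo i j l (a + k) (b - 1 - k))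
      = ∑ k ∈ Finset.range (d + 1), mono (setTwo i j l (a + k + 1) (b - 1 - k)) := by
    rw [Finset.mul_sum]
    exact Finset.sum_congr rfl fun k _ => zvar_left_mul_setTwo hij l _ _
  have e2 : zvar j * ∑ k ∈ Finset.range (d + 1), mono (setTwo i j l (a + k) (b - 1 - k))
      = ∑ k ∈ Finset.range (d + 1), mono (setTwo i j l (a + k) (b - 1 - k + 1)) := by
    rw [Finset.mul_sum]
    exact Finset.sum_congr rfl fun k _ => zvar_right_mul_setTwo i j l _ _
  rw [sub_mul, smul_mul_assoc, smul_mul_assoc, e1, e2, Finset.sum_range_succ,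
    Finset.sum_range_succ']
  have e3 : setTwo i j l (a + d + 1) (b - 1 - d) = setTwo i j l (a + (d + 1)) (b - (d + 1)) := by
    congr 1 <;> ring
  have e4 : setTwo i j l (a + (0 : ℕ)) (b - 1 - (0 : ℕ) + 1) = setTwo i j l a b := by
    congr 1 <;> simp
  rw [e3, e4]
  have m1 : ∑ k ∈ Finset.range d, mono (setTwo i j l (a + k + 1) (b - 1 - k))
      ∈ monoSpan (Between i j l) := by
    refine Submodule.sum_mem _ fun k hk => mono_mem ?_
    have := Finset.mem_range.1 hk
    exact setTwo_mem_between hij (by omega) (by omega) (by omega)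
  have m2 : ∑ k ∈ Finset.range d, mono (setTwo i j l (a + (k + 1 : ℕ)) (b - 1 - (k + 1 : ℕ) + 1))
      ∈ monoSpan (Between i j l) := by
    refine Submodule.sum_mem _ fun k hk => mono_mem ?_
    have := Finset.mem_range.1 hk
    exact setTwo_mem_between hij (by omega) (by omega) (by omega)
  convert Submodule.sub_mem _ (Submodule.smul_mem _ q⁻¹ m1) (Submodule.smul_mem _ q m2) using 1
  rw [smul_add, smul_add]
  abel

theorem gOp_mono_of_eq {i j : Fin N} {l : Fin N → ℤ} (h : l i = l j) :
    gOp q i j (mono l) = q • mono l := by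
  rw [gOp_mono, divDiffMono, h]
  simp

/-- Only the end terms of the divided difference survive modulo intermediate exponents. With the
opposite case below, this is the two-dimensional Hecke action on z^l and its exchange. -/
theorem gOp_mono_of_lt {i j : Fin N} {l : Fin N → ℤ} (h : l i < l j) :
    gOp q i j (mono l) - q⁻¹ • mono (l ∘ Equiv.swap i j) ∈ monoSpan (Between i j l) := by
  have hij : i ≠ j := by rintro rfl; exact lt_irrefl _ h
  obtain ⟨d, hd⟩ : ∃ d : ℕ, l j - l i = d + 1 := ⟨(l j - l i - 1).toNat, by omega⟩
  have := linear_mul_sum_setTwo (q := q) hij l (l i) (l j) d rfl (min_le_left _ _) (by omega)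
  rw [show l i + ((d : ℤ) + 1) = l j by omega, show l j - ((d : ℤ) + 1) = l i by omega,
    setTwo_swap hij, setTwo_self] at this
  rw [gOp_mono, divDiffMono, show (l j - l i).toNat = d + 1 by omega,
    show (l i - l j).toNat = 0 by omega, Finset.sum_range_zero, sub_zero]
  convert this using 1
  simp only [setTwo]
  abel

theorem gOp_mono_of_gt {i j : Fin N} {l : Fin N → ℤ} (h : l j < l i) :
    gOp q i j (mono l) - (q - q⁻¹) • mono l - q • mono (l ∘ Equiv.swap i j)
      ∈ monoSpan (Between i j l) := by
  have hij : i ≠ j := by rintro rfl; exact lt_irrefl _ h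
  obtain ⟨d, hd⟩ : ∃ d : ℕ, l i - l j = d + 1 := ⟨(l i - l j - 1).toNat, by omega⟩
  have := linear_mul_sum_setTwo (q := q) hij l (l j) (l i) d (add_comm _ _) (min_le_right _ _)
    (by omega)
  rw [show l j + ((d : ℤ) + 1) = l i by omega, show l i - ((d : ℤ) + 1) = l j by omega,
    setTwo_swap hij, setTwo_self] at this
  rw [gOp_mono, divDiffMono, show (l i - l j).toNat = d + 1 by omega,
    show (l j - l i).toNat = 0 by omega, Finset.sum_range_zero, zero_sub]
  convert Submodule.neg_mem _ this using 1
  simp only [setTwo, mul_neg, sub_smul]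
  abel

theorem gOp_mono_mem_maj {i j : Fin N} (hij : i ≠ j) (l : Fin N → ℤ) :
    gOp q i j (mono l) ∈ monoSpan {m | Maj l m} := by
  have hb : monoSpan (Between i j l) ≤ monoSpan {m | Maj l m} :=
    monoSpan_mono fun m hm => (between_below hij hm).1
  have h1 : mono l ∈ monoSpan {m | Maj l m} := mono_mem (Maj.refl l)
  have h2 : mono (l ∘ Equiv.swap i j) ∈ monoSpan {m | Maj l m} := mono_mem (maj_comp_perm l _)
  rcases lt_trichotomy (l i) (l j) with h | h | h
  · have := Submodule.add_mem _ (hb (gOp_mono_of_lt (q := q) h)) (Submodule.smul_mem _ q⁻¹ h2)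
    rwa [sub_add_cancel] at this
  · rw [gOp_mono_of_eq h]
    exact Submodule.smul_mem _ _ h1
  · have := Submodule.add_mem _ (Submodule.add_mem _ (hb (gOp_mono_of_gt (q := q) h))
      (Submodule.smul_mem _ q h2)) (Submodule.smul_mem _ (q - q⁻¹) h1)
    rwa [sub_add_cancel, sub_add_cancel] at this

theorem gOp_mem_below {i j : Fin N} (hij : i ≠ j) {l : Fin N → ℤ} {f : Laurent N}
    (hf : f ∈ monoSpan {m | Below l m}) : gOp q i j f ∈ monoSpan {m | Below l m} := by
  have key : ∀ m ∈ {m | Below l m},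
      mono m ∈ (monoSpan {m | Below l m}).comap (gOp q i j) := fun m hm => by
    have hsub : {k | Maj m k} ⊆ {k | Below l k} := fun k hk => Below.trans_maj hm hk
    rw [Submodule.mem_comap]
    exact monoSpan_mono hsub (gOp_mono_mem_maj (q := q) hij m)
  exact monoSpan_le key hf

/-! ### Triangularity -/

/-- The span of the monomials below `z^l`. -/
def lower (l : Fin N → ℤ) : Submodule ℂ (Laurent N) := monoSpan {m | StrictlyAbove l m}

theorem lower_eq_below {l : Fin N → ℤ} (hl : Monotone l) : lower l = monoSpan {m | Below l m} := by
  have : {m | StrictlyAbove l m} = {m | Below l m} := Set.ext fun m =>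
    ⟨fun h => StrictlyAbove.below_of_monotone hl h, fun h => Below.strictlyAbove h⟩
  rw [lower, this]

/-- `A` is triangular with diagonal entries `c`. -/
def Triangular (A : Module.End ℂ (Laurent N)) (c : (Fin N → ℤ) → ℂ) : Prop :=
  ∀ l, A (mono l) - c l • mono l ∈ lower l

theorem Triangular.map_mono {A : Module.End ℂ (Laurent N)} {c : (Fin N → ℤ) → ℂ}
    (h : Triangular A c) {l m : Fin N → ℤ} (hlm : StrictlyAbove l m) : A (mono m) ∈ lower l := by
  have h1 : lower m ≤ lower l := monoSpan_mono fun k hk => hlm.trans hk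
  have := Submodule.add_mem _ (h1 (h m)) (Submodule.smul_mem _ (c m) (mono_mem hlm))
  rwa [sub_add_cancel] at this

theorem Triangular.map_lower {A : Module.End ℂ (Laurent N)} {c : (Fin N → ℤ) → ℂ}
    (h : Triangular A c) {l : Fin N → ℤ} {f : Laurent N} (hf : f ∈ lower l) : A f ∈ lower l := by
  suffices h : lower l ≤ (lower l).comap A from h hf
  exact monoSpan_le fun m hm => h.map_mono hm

theorem Triangular.mul {A B : Module.End ℂ (Laurent N)} {c d : (Fin N → ℤ) → ℂ}
    (hA : Triangular A c) (hB : Triangular B d) : Triangular (A * B) fun l => c l * d l := by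
  intro l
  have h1 := hA.map_lower (hB l)
  have h2 := Submodule.smul_mem _ (d l) (hA l)
  convert Submodule.add_mem _ h1 h2 using 1
  rw [Module.End.mul_apply, map_sub, map_smul, smul_sub, smul_smul, mul_comm]
  abel

theorem Triangular.list_prod {ι : Type*} (A : ι → Module.End ℂ (Laurent N))
    (c : ι → (Fin N → ℤ) → ℂ) (L : List ι) (h : ∀ a ∈ L, Triangular (A a) (c a)) :
    Triangular (L.map A).prod fun l => (L.map fun a => c a l).prod := by
  induction L with
  | nil => intro l; simp
  | cons a L ih =>
    simp only [List.map_cons, List.prod_cons]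
    exact (h a (by simp)).mul (ih fun b hb => h b (by simp [hb]))

theorem triangular_pShift (i : Fin N) : Triangular (pShift p i) fun l => p ^ l i := fun l => by
  rw [pShift_mono, sub_self]; exact Submodule.zero_mem _

theorem strictlyAbove_swap {i j : Fin N} (hij : i < j) {l : Fin N → ℤ} (h : l j < l i) :
    StrictlyAbove l (l ∘ Equiv.swap i j) := by
  refine Or.inr ⟨(plus_comp_perm l _).symm, j, ?_, fun k hk => ?_⟩
  · simpa using h
  · simp [Equiv.swap_apply_of_ne_of_ne (hij.trans hk).ne' hk.ne']

theorem between_le_lower {i j : Fin N} (hij : i ≠ j) (l : Fin N → ℤ) :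
    monoSpan (Between i j l) ≤ lower l :=
  monoSpan_mono fun _ hm => (between_below hij hm).strictlyAbove

theorem permK_between_le_lower {i j : Fin N} (hij : i ≠ j) {l : Fin N → ℤ} {f : Laurent N}
    (hf : f ∈ monoSpan (Between i j l)) : permK i j f ∈ lower l := by
  suffices h : monoSpan (Between i j l) ≤ (lower l).comap (permK i j) from h hf
  refine monoSpan_le fun m hm => ?_
  rw [Submodule.mem_comap, permK_mono]
  exact mono_mem ((between_below hij hm).trans_maj (maj_comp_perm m _)).strictlyAbove

theorem comp_swap_comp_swap {X : Type*} (i j : Fin N) (l : Fin N → X) :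
    (l ∘ Equiv.swap i j) ∘ Equiv.swap i j = l := by
  funext x; simp

theorem comp_swap_of_eq {X : Type*} {i j : Fin N} {l : Fin N → X} (h : l i = l j) :
    l ∘ Equiv.swap i j = l := by
  funext x
  rcases eq_or_ne x i with rfl | hi
  · simp [h]
  · rcases eq_or_ne x j with rfl | hj
    · simp [h]
    · simp [Equiv.swap_apply_of_ne_of_ne hi hj]

/-- The exchange K puts the leading term of g back on z^l, making it diagonal. The extra term κz^l
of g occurs only for l_i > l_j, and then its exchange is lower in the order. -/
theorem triangular_xiOp {i j : Fin N} (hij : i < j) :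
    Triangular (xiOp q i j) fun l => if l i < l j then q⁻¹ else q := by
  intro l
  dsimp only
  rw [xiOp, Module.End.mul_apply]
  rcases lt_trichotomy (l i) (l j) with h | h | h
  · have := permK_between_le_lower hij.ne (gOp_mono_of_lt (q := q) h)
    rw [map_sub, map_smul, permK_mono, comp_swap_comp_swap] at this
    rw [if_pos h]
    exact this
  · rw [if_neg h.not_lt, gOp_mono_of_eq h, map_smul, permK_mono, comp_swap_of_eq h, sub_self]
    exact Submodule.zero_mem _
  · have h1 := permK_between_le_lower hij.ne (gOp_mono_of_gt (q := q) h)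
    rw [map_sub, map_sub, map_smul, map_smul, permK_mono, permK_mono, comp_swap_comp_swap] at h1
    have h2 := Submodule.smul_mem _ (q - q⁻¹) (mono_mem (S := {m | StrictlyAbove l m})
      (strictlyAbove_swap hij h))
    rw [if_neg h.not_gt]
    convert Submodule.add_mem _ h1 h2 using 1
    abel

theorem triangular_xiInv {i j : Fin N} (hij : i < j) :
    Triangular (xiInv q i j) fun l => if l i < l j then q else q⁻¹ := by
  intro l
  dsimp only
  have hsw : ∀ m, m ∈ Between i j (l ∘ Equiv.swap i j) → m ∈ Between i j l := fun m hm => by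
    obtain ⟨h1, h2, h3, h4⟩ := hm
    simp only [Function.comp, Equiv.swap_apply_left, Equiv.swap_apply_right] at h2 h3 h4
    refine ⟨fun k hk => ?_, by omega, by omega, by omega⟩
    rw [h1 k hk, Function.comp, Equiv.swap_apply_of_ne_of_ne hk.1 hk.2]
  have hle := (monoSpan_mono hsw).trans (between_le_lower hij.ne l)
  rw [xiInv, Module.End.mul_apply, permK_mono, LinearMap.sub_apply, LinearMap.smul_apply,
    Module.End.one_apply]
  rcases lt_trichotomy (l i) (l j) with h | h | h
  · have h1 := hle (gOp_mono_of_gt (q := q) (i := i) (j := j) (l := l ∘ Equiv.swap i j)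
      (by simpa using h))
    rw [comp_swap_comp_swap] at h1
    rwa [if_pos h]
  · rw [comp_swap_of_eq h, if_neg h.not_lt, gOp_mono_of_eq h, ← sub_smul, ← sub_smul]
    simp
  · have h1 := hle (gOp_mono_of_lt (q := q) (i := i) (j := j) (l := l ∘ Equiv.swap i j)
      (by simpa using h))
    rw [comp_swap_comp_swap] at h1
    have h2 := Submodule.smul_mem _ (q - q⁻¹) (mono_mem (S := {m | StrictlyAbove l m})
      (strictlyAbove_swap hij h))
    rw [if_neg h.not_gt]
    convert Submodule.sub_mem _ h1 h2 using 1
    abel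

/-- The diagonal entry is the product over the factors: each other place gives q if its rank is
smaller than that of i and q⁻¹ otherwise. -/
theorem triangular_yOp (hq0 : q ≠ 0) (i : Fin N) :
    Triangular (yOp q p i) fun l => zeta q p l i := by
  rw [yOp_eq hq0]
  have h := ((Triangular.list_prod _ _ (after i) fun a ha =>
    triangular_xiInv (q := q) (mem_after.1 ha)).mul (triangular_pShift (p := p) i)).mul
    (Triangular.list_prod _ _ (before i) fun a ha => triangular_xiOp (q := q) (mem_before.1 ha))
  convert h using 1
  funext l
  set e : Fin N → ℤ := fun j => if rankPerm l j < rankPerm l i then 1 else -1 with he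
  have hprod : ∀ L : List (Fin N), (L.map fun a => q ^ e a).prod = q ^ (L.map e).sum := by
    intro L
    induction L with
    | nil => simp
    | cons a L ih => simp only [List.map_cons, List.prod_cons, List.sum_cons, ih, zpow_add₀ hq0]
  have e1 : ((after i).map fun a => if l i < l a then q else q⁻¹)
      = (after i).map fun a => q ^ e a := by
    refine List.map_congr_left fun a ha => ?_
    have := mem_after.1 ha
    simp only [he, rankPerm_lt_iff]
    by_cases h : l i < l a
    · simp [h]
    · simp [h, this.not_gt]
  have e2 : ((before i).map fun a => if l a < l i then q⁻¹ else q)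
      = (before i).map fun a => q ^ e a := by
    refine List.map_congr_left fun a ha => ?_
    have := mem_before.1 ha
    simp only [he, rankPerm_lt_iff]
    rcases lt_trichotomy (l a) (l i) with h | h | h
    · simp [h, h.ne, h.not_gt]
    · simp [h, this]
    · simp [h, h.not_gt]
  have hsum : ((after i).map e).sum + ((before i).map e).sum
      = 2 * (rankPerm l i : ℕ) + 1 - N := by
    rw [← List.sum_toFinset e ((pairwise_after i).imp fun h => h.ne),
      ← List.sum_toFinset e ((pairwise_before i).imp fun h => h.ne)]
    have hU : Finset.univ.erase i = (after i).toFinset ∪ (before i).toFinset := by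
      ext j
      simp only [Finset.mem_erase, Finset.mem_univ, and_true, Finset.mem_union, List.mem_toFinset,
        mem_after, mem_before]
      rw [or_comm]
      exact ne_iff_lt_or_gt
    have hD : Disjoint (after i).toFinset (before i).toFinset :=
      Finset.disjoint_left.2 fun j h1 h2 => by
        rw [List.mem_toFinset, mem_after] at h1
        rw [List.mem_toFinset, mem_before] at h2
        exact lt_asymm h1 h2
    rw [← Finset.sum_union hD, ← hU]
    have h1 := Finset.add_sum_erase Finset.univ e (Finset.mem_univ i)
    -- The sum is taken over all places first; the place i itself counts as -1 there and has to be
    -- removed.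
    have h2 : e i = -1 := by simp [he]
    have h3 : ∑ j, e j = 2 * (rankPerm l i : ℕ) - N := by
      have : ∀ j, e j = 2 * (if l i < l j ∨ (l j = l i ∧ j < i) then 1 else 0) - 1 := fun j => by
        simp only [he, rankPerm_lt_iff]
        split_ifs <;> norm_num
      rw [Finset.sum_congr rfl fun j _ => this j, Finset.sum_sub_distrib, ← Finset.mul_sum,
        Finset.sum_boole, rankPerm_eq_card]
      simp
    rw [h2, h3] at h1
    linarith
  rw [e1, e2, hprod, hprod, zeta, mul_comm (q ^ _) (p ^ _), mul_assoc, ← zpow_add₀ hq0, hsum]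
  congr 2
  ring

/-! ### Existence of the non-symmetric Macdonald polynomials -/

theorem finite_strictlyAbove (l : Fin N → ℤ) : {m | StrictlyAbove l m}.Finite :=
  (finite_maj l).subset fun _ h => StrictlyAbove.maj h

/-- A polynomial in the `Y_i` that kills the monomials in a lower set and is invertible on the
joint eigenvectors whose eigenvalues do not occur on this set. -/
theorem exists_annihilator (hq0 : q ≠ 0) (hp0 : p ≠ 0) (χ : Fin N → ℂ)
    (B : Finset (Fin N → ℤ)) (hB : ∀ m ∈ B, ∀ k, StrictlyAbove m k → k ∈ B)
    (hχ : ∀ m ∈ B, ∃ i, χ i ≠ zeta q p m i) :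
    ∃ (P : Module.End ℂ (Laurent N)) (c : ℂ), c ≠ 0 ∧ (∀ i, Commute P (yOp q p i)) ∧
      (∀ m ∈ B, P (mono m) = 0) ∧
      ∀ U : Submodule ℂ (Laurent N), (∀ i, ∀ u ∈ U, yOp q p i u ∈ U) →
        (∀ u ∈ U, P u ∈ U) ∧
          ∀ f, (∀ i, yOp q p i f - χ i • f ∈ U) → P f - c • f ∈ U := by
  obtain ⟨n, hn⟩ : ∃ n, B.card = n := ⟨_, rfl⟩
  induction n generalizing B with
  | zero =>
    rw [Finset.card_eq_zero] at hn
    subst hn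
    exact ⟨1, 1, one_ne_zero, fun i => Commute.one_left _, by simp, fun U _ => ⟨fun u hu => hu,
      fun f _ => by simp⟩⟩
  | succ n ih =>
    have hne : B.Nonempty := Finset.card_pos.1 (by omega)
    -- Nothing in B lies above m, so removing it leaves a downward closed set.
    obtain ⟨m, hmB, hmax⟩ : ∃ m ∈ B, ∀ k ∈ B, ¬ StrictlyAbove k m := by
      have : IsTrans B fun a b => StrictlyAbove a.1 b.1 := ⟨fun _ _ _ h h' => h.trans h'⟩
      have : Std.Irrefl fun a b : B => StrictlyAbove a.1 b.1 := ⟨fun a => StrictlyAbove.irrefl _⟩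
      obtain ⟨x, _, hx⟩ := (Finite.wellFounded_of_trans_of_irrefl
        fun a b : B => StrictlyAbove a.1 b.1).has_min Set.univ ⟨⟨_, hne.choose_spec⟩, trivial⟩
      exact ⟨x.1, x.2, fun k hk => hx ⟨k, hk⟩ trivial⟩
    obtain ⟨P, c, hc, hcomm, hkill, hU⟩ := ih (B.erase m)
      (fun a ha k hk => Finset.mem_erase.2 ⟨fun e => hmax a (Finset.mem_of_mem_erase ha) (e ▸ hk),
        hB a (Finset.mem_of_mem_erase ha) k hk⟩)
      (fun a ha => hχ a (Finset.mem_of_mem_erase ha)) (by rw [Finset.card_erase_of_mem hmB]; omega)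
    obtain ⟨i, hi⟩ := hχ m hmB
    set z := zeta q p m i with hz
    have hcz : ∀ j, Commute (P * (yOp q p i - z • 1)) (yOp q p j) := fun j =>
      (hcomm j).mul_left ((yOp_commute hq0 hp0 i j).sub_left ((Commute.one_left _).smul_left z))
    have hcomm' : P * (yOp q p i - z • 1) = (yOp q p i - z • 1) * P :=
      ((hcomm i).sub_right ((Commute.one_right P).smul_right z)).eq
    -- The new factor takes z^m into strictly lower terms, which the old P kills; on joint
    -- eigenvectors modulo U it acts by χ_i - ζ_i(m) ≠ 0.
    refine ⟨P * (yOp q p i - z • 1), (χ i - z) * c, mul_ne_zero (sub_ne_zero.2 hi) hc, hcz, ?_, ?_⟩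
    · intro k hk
      by_cases hkm : k = m
      · subst hkm
        have h1 : (yOp q p i - z • 1) (mono k) ∈ lower k := by
          have := triangular_yOp (p := p) hq0 i k
          simpa using this
        have h2 : lower k ≤ LinearMap.ker P := monoSpan_le fun a ha =>
          hkill a (Finset.mem_erase.2 ⟨fun e => StrictlyAbove.irrefl k (e ▸ ha), hB k hmB a ha⟩)
        rw [Module.End.mul_apply]
        exact h2 h1
      · rw [hcomm', Module.End.mul_apply, hkill k (Finset.mem_erase.2 ⟨hkm, hk⟩), map_zero]
    · intro U hUs
      have hUi : ∀ u ∈ U, (yOp q p i - z • 1) u ∈ U := fun u hu => by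
        simpa using Submodule.sub_mem _ (hUs i u hu) (Submodule.smul_mem _ z hu)
      refine ⟨fun u hu => (hU U hUs).1 _ (hUi u hu), fun f hf => ?_⟩
      have h1 := (hU U hUs).1 _ (hf i)
      have h2 := Submodule.smul_mem _ (χ i - z) ((hU U hUs).2 f hf)
      convert Submodule.add_mem _ h1 h2 using 1
      simp only [Module.End.mul_apply, LinearMap.sub_apply, LinearMap.smul_apply,
        Module.End.one_apply, map_sub, map_smul, smul_sub, sub_smul, smul_smul, sub_mul]
      abel

section Macdonald

variable (hq0 : q ≠ 0) (hq : ∀ a : ℕ, 0 < a → q ^ a = 1 → q = 1)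
  (hp0 : p ≠ 0) (hp : ∀ a b : ℕ, 0 < b → p ^ b ≠ q ^ (2 * a)) {m : Fin N → ℤ} (hm : Monotone m)

include hq0 hq hp0 hp hm

/-- A monotone m has nothing of its own orbit below it, and the spectrum determines the orbit. The
permutation π is allowed for the comparison with gΦ^m, whose eigenvalues are interchanged. -/
theorem exists_zeta_ne (π : Equiv.Perm (Fin N)) {k : Fin N → ℤ} (hk : StrictlyAbove m k) :
    ∃ i, zeta q p m (π i) ≠ zeta q p k i := by
  by_contra! h
  have := plus_eq_of_zeta_eq hq0 hq hp0 hp π fun i => (h i).symm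
  exact (StrictlyAbove.below_of_monotone hm hk).2 (plus_eq_iff_maj.1 this).1

theorem exists_annihilator_lower (π : Equiv.Perm (Fin N)) :
    ∃ (P : Module.End ℂ (Laurent N)) (c : ℂ), c ≠ 0 ∧ (∀ i, Commute P (yOp q p i)) ∧
      (∀ f ∈ lower m, P f = 0) ∧
      ∀ U : Submodule ℂ (Laurent N), (∀ i, ∀ u ∈ U, yOp q p i u ∈ U) →
          ∀ f, (∀ i, yOp q p i f - zeta q p m (π i) • f ∈ U) → P f - c • f ∈ U := by
  obtain ⟨P, c, hc, h1, h2, h3⟩ := exists_annihilator hq0 hp0 (fun i => zeta q p m (π i))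
    (finite_strictlyAbove m).toFinset
    (fun a ha k hk => by
      rw [Set.Finite.mem_toFinset] at *
      exact StrictlyAbove.trans ha hk)
    (fun a ha => by
      rw [Set.Finite.mem_toFinset] at ha
      exact exists_zeta_ne hq0 hq hp0 hp hm π ha)
  refine ⟨P, c, hc, h1, fun f hf => ?_, fun U hU => (h3 U hU).2⟩
  have : lower m ≤ LinearMap.ker P :=
    monoSpan_le fun a ha => h2 a ((Set.Finite.mem_toFinset _).2 ha)
  exact this hf

/-- The annihilator kills f, yet acts on it by c ≠ 0; this is its eigenvector property for the
submodule 0. -/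
theorem eq_zero_of_mem_lower (π : Equiv.Perm (Fin N)) {f : Laurent N} (hf : f ∈ lower m)
    (hY : ∀ i, yOp q p i f = zeta q p m (π i) • f) : f = 0 := by
  obtain ⟨P, c, hc, _, h2, h3⟩ := exists_annihilator_lower hq0 hq hp0 hp hm π
  have := h3 ⊥ (fun i u hu => by
    rw [Submodule.mem_bot] at *
    rw [hu, map_zero]) f (fun i => by rw [hY, sub_self]; exact Submodule.zero_mem _)
  rw [Submodule.mem_bot, h2 f hf, zero_sub, neg_eq_zero] at this
  exact (smul_eq_zero.1 this).resolve_left hc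

/-- Apply the annihilator to z^m. Modulo lower terms it is c, so division by c normalizes the
leading term; and since it commutes with Y_i and kills (Y_i - ζ_i)z^m, the result is an eigenvector.
-/
theorem exists_isMacdonald : ∃ f, IsMacdonald q p m f := by
  obtain ⟨P, c, hc, h1, h2, h3⟩ := exists_annihilator_lower hq0 hq hp0 hp hm 1
  have hT := fun i => triangular_yOp (p := p) hq0 i m
  have hs := h3 (lower m) (fun i u hu => (triangular_yOp hq0 i).map_lower hu) (mono m) hT
  refine ⟨c⁻¹ • P (mono m), fun i => ?_, ?_⟩
  · have e : yOp q p i (P (mono m)) = P (yOp q p i (mono m)) :=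
      (LinearMap.congr_fun (h1 i).eq _).symm
    have e' := h2 _ (hT i)
    rw [map_sub, map_smul, sub_eq_zero] at e'
    rw [map_smul, e, e', smul_comm]
  · have := Submodule.smul_mem _ c⁻¹ hs
    rwa [smul_sub, smul_smul, inv_mul_cancel₀ hc, one_smul] at this

theorem isMacdonald_macdonald : IsMacdonald q p m (macdonald q p m) := by
  have h := exists_isMacdonald hq0 hq hp0 hp hm
  rw [macdonald, dif_pos h]
  exact h.choose_spec

/-- `Φ^m` is symmetric in the `q`-deformed sense in neighbouring places with equal entries. -/
theorem IsMacdonald.gOp_eq {f : Laurent N} (hf : IsMacdonald q p m f) {i j : Fin N}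
    (hij : (i : ℕ) + 1 = j) (hmij : m i = m j) : gOp q i j f = q • f := by
  have hne : i ≠ j := fun h => by rw [h] at hij; omega
  rw [← sub_eq_zero]
  have hz : zeta q p m j = q ^ 2 * zeta q p m i := by
    rw [zeta, zeta, rankPerm_succ_of_eq hij hmij, hmij, mul_left_comm, ← zpow_natCast q 2,
      ← zpow_add₀ hq0]
    congr 2
    push_cast
    ring
  have hg := LinearMap.congr_fun (gOp_mul_self hq0 hne) f
  have hs : yOp q p j = gOp q i j * yOp q p i * gOp q i j := yOp_succ hq0 p hij
  have hgg := gOp_mul_self hq0 hne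
  -- The leading terms of gΦ and qΦ cancel, and the difference is a joint eigenvector for the
  -- spectrum with i and j interchanged; permuted uniqueness makes it vanish.
  refine eq_zero_of_mem_lower hq0 hq hp0 hp hm (Equiv.swap i j) ?_ fun k => ?_
  · have h1 : f - mono m ∈ monoSpan {k | Below m k} := by
      rw [← lower_eq_below hm]; exact hf.2
    have h2 := Submodule.sub_mem _ (gOp_mem_below (q := q) hne h1) (Submodule.smul_mem _ q h1)
    rw [map_sub, gOp_mono_of_eq hmij, smul_sub, sub_sub_sub_cancel_right] at h2
    rw [lower_eq_below hm]
    exact h2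
  · have hYi := hf.1 i
    have hYj := hf.1 j
    rw [map_sub, map_smul, smul_sub]
    by_cases hki : k = i
    · subst hki
      -- This is Y_i g = g Y_j - κ Y_j, from Y_j = g Y_i g; the ratio ζ_j = q² ζ_i closes the
      -- computation.
      have e : yOp q p k * gOp q k j = gOp q k j * yOp q p j - (q - q⁻¹) • yOp q p j := by
        rw [hs, ← mul_assoc, ← mul_assoc, hgg, add_mul, add_mul, one_mul, smul_mul_assoc,
          smul_mul_assoc, add_sub_cancel_right]
      have e' : yOp q p k (gOp q k j f)
          = gOp q k j (yOp q p j f) - (q - q⁻¹) • yOp q p j f := LinearMap.congr_fun e f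
      rw [Equiv.swap_apply_left, e', hYi, hYj, hz, map_smul, smul_smul, smul_smul, smul_smul,
        sub_sub, ← add_smul]
      congr 2
      field_simp
      ring
    · by_cases hkj : k = j
      · subst hkj
        have e : yOp q p k * gOp q i k
            = gOp q i k * yOp q p i + (q - q⁻¹) • yOp q p k := by
          rw [hs, mul_assoc _ (gOp q i k) (gOp q i k), hgg, mul_add, mul_one, mul_smul_comm]
        have e' : yOp q p k (gOp q i k f)
            = gOp q i k (yOp q p i f) + (q - q⁻¹) • yOp q p k f := LinearMap.congr_fun e f
        rw [Equiv.swap_apply_right, e', hYi, hYj, hz, map_smul, smul_smul, smul_smul, smul_smul,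
          add_sub_assoc, ← sub_smul, sub_eq_add_neg _ ((zeta q p m i * q) • f), ← neg_smul]
        congr 2
        field_simp
        ring
      · have c := gOp_commute_yOp hq0 hp0 k hij (Ne.symm hki) (Ne.symm hkj)
        have e' : gOp q i j (yOp q p k f) = yOp q p k (gOp q i j f) := LinearMap.congr_fun c.eq f
        rw [Equiv.swap_apply_of_ne_of_ne hki hkj, ← e', hf.1 k, map_smul, smul_comm q]

end Macdonald

end QWedge

end

noncomputable section

namespace QWedge

/-! ### The operators on the tensor power of `ℂⁿ` -/

variable {n N : ℕ} {q : ℂ}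

theorem spin_ext {M : Type*} [AddCommMonoid M] [Module ℂ M] {A B : Spin n N →ₗ[ℂ] M}
    (h : ∀ e, A (vec e) = B (vec e)) : A = B :=
  Finsupp.lhom_ext' fun e => LinearMap.ext_ring (h e)

theorem onVec_vec (F : (Fin N → Fin n) → Spin n N) (e : Fin N → Fin n) : onVec F (vec e) = F e := by
  simp [onVec, vec]

theorem matUnit_vec (i : Fin N) (a b : Fin n) (e : Fin N → Fin n) :
    matUnit i a b (vec e) = if e i = b then vec (Function.update e i a) else 0 := onVec_vec _ _

theorem matUnit_commute {i j : Fin N} (hij : i ≠ j) (a b c d : Fin n) :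
    Commute (matUnit i a b) (matUnit j c d) := spin_ext fun e => by
  simp only [Module.End.mul_apply, matUnit_vec]
  by_cases h1 : e i = b <;> by_cases h2 : e j = d <;>
    simp [h1, h2, matUnit_vec, hij, hij.symm, Function.update_comm hij]

theorem commute_sOp {A : Module.End ℂ (Spin n N)} {i j : Fin N}
    (hi : ∀ a b, Commute A (matUnit i a b)) (hj : ∀ a b, Commute A (matUnit j a b)) :
    Commute A (sOp q i j) := by
  have h1 : Commute A (∑ a : Fin n, matUnit i a a * matUnit j a a) :=
    Commute.sum_right _ _ _ fun a _ => (hi _ _).mul_right (hj _ _)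
  have h2 : Commute A (∑ a : Fin n, ∑ b : Fin n,
      (if a < b then matUnit i a a * matUnit j b b else 0)) := by
    refine Commute.sum_right _ _ _ fun a _ => Commute.sum_right _ _ _ fun b _ => ?_
    split_ifs
    · exact (hi _ _).mul_right (hj _ _)
    · exact Commute.zero_right _
  have h3 : Commute A (∑ a : Fin n, ∑ b : Fin n,
      (if a ≠ b then matUnit i a b * matUnit j b a else 0)) := by
    refine Commute.sum_right _ _ _ fun a _ => Commute.sum_right _ _ _ fun b _ => ?_
    split_ifs
    · exact (hi _ _).mul_right (hj _ _)
    · exact Commute.zero_right _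
  have h4 := h1.smul_right (-q⁻¹)
  have e : (-q⁻¹) • ∑ a : Fin n, (matUnit i a a * matUnit j a a : Module.End ℂ (Spin n N))
      = -(q⁻¹ • ∑ a : Fin n, matUnit i a a * matUnit j a a) := LinearMap.ext fun v => by
    rw [LinearMap.smul_apply, LinearMap.neg_apply, LinearMap.smul_apply, neg_smul]
  rw [e] at h4
  refine LinearMap.ext fun v => ?_
  have e1 := LinearMap.congr_fun (h4.add_right (h2.smul_right (q - q⁻¹))).eq v
  have e2 := LinearMap.congr_fun h3.eq v
  rw [Module.End.mul_apply, Module.End.mul_apply] at e1 e2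
  rw [sOp, Module.End.mul_apply, Module.End.mul_apply, LinearMap.sub_apply, LinearMap.sub_apply,
    map_sub, e1, e2]

theorem matUnit_commute_sOp {i j k : Fin N} (hki : k ≠ i) (hkj : k ≠ j) (a b : Fin n) :
    Commute (matUnit k a b) (sOp q i j) :=
  commute_sOp (fun _ _ => matUnit_commute hki _ _ _ _) fun _ _ => matUnit_commute hkj _ _ _ _

theorem sOp_commute {i j k l : Fin N} (hik : i ≠ k) (hil : i ≠ l) (hjk : j ≠ k) (hjl : j ≠ l) :
    Commute (sOp q i j : Module.End ℂ (Spin n N)) (sOp q k l) :=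
  commute_sOp (fun _ _ => (matUnit_commute_sOp hik.symm hjk.symm _ _).symm)
    fun _ _ => (matUnit_commute_sOp hil.symm hjl.symm _ _).symm

theorem update_update_swap {X : Type*} {i j : Fin N} (hij : i ≠ j) (e : Fin N → X) :
    Function.update (Function.update e j (e i)) i (e j) = e ∘ Equiv.swap i j := by
  funext x
  by_cases hx : x = i
  · subst hx; simp
  · by_cases hy : x = j
    · subst hy; simp [hij.symm]
    · simp [hx, hy, Equiv.swap_apply_of_ne_of_ne]

theorem sOp_vec {i j : Fin N} (hij : i ≠ j) (e : Fin N → Fin n) : sOp q i j (vec e)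
    = if e i = e j then -(q⁻¹ • vec e) else
      if e i < e j then (q - q⁻¹) • vec e - vec (e ∘ Equiv.swap i j)
      else -vec (e ∘ Equiv.swap i j) := by
  have h1 : ∀ a b : Fin n, (matUnit i a a * matUnit j b b) (vec e)
      = if a = e i then (if b = e j then vec e else 0) else 0 := fun a b => by
    rw [Module.End.mul_apply, matUnit_vec]
    by_cases hb : b = e j
    · subst hb
      rw [if_pos rfl, Function.update_eq_self, matUnit_vec]
      by_cases ha : a = e i
      · subst ha; simp
      · simp [ha, Ne.symm ha]
    · simp [hb, Ne.symm hb]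
  have h2 : ∀ a b : Fin n, (matUnit i a b * matUnit j b a) (vec e)
      = if a = e j then (if b = e i then vec (e ∘ Equiv.swap i j) else 0) else 0 := fun a b => by
    rw [Module.End.mul_apply, matUnit_vec]
    by_cases ha : a = e j
    · subst ha
      rw [if_pos rfl, matUnit_vec, Function.update_of_ne hij]
      by_cases hb : b = e i
      · subst hb
        simp [update_update_swap hij]
      · simp [hb, Ne.symm hb]
    · simp [ha, Ne.symm ha]
  have h3 : ∀ (P : Prop) [Decidable P] (A : Module.End ℂ (Spin n N)) (v : Spin n N),
      (if P then A else 0) v = if P then A v else 0 := fun P _ A v => by split_ifs <;> rfl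
  simp only [sOp, LinearMap.sub_apply, LinearMap.add_apply, LinearMap.neg_apply,
    LinearMap.smul_apply, LinearMap.sum_apply, h3, h1, h2]
  have s1 : ∑ a : Fin n, (if a = e i then (if a = e j then vec e else 0) else (0 : Spin n N))
      = if e i = e j then vec e else 0 := by simp
  have s2 : ∑ a : Fin n, ∑ b : Fin n, (if a < b then (if a = e i then
      (if b = e j then vec e else 0) else 0) else (0 : Spin n N))
      = if e i < e j then vec e else 0 := by
    rw [Finset.sum_eq_single (e i) (fun a _ ha => by simp [ha]) (by simp),
      Finset.sum_eq_single (e j) (fun b _ hb => by simp [hb]) (by simp)]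
    simp
  have s3 : ∑ a : Fin n, ∑ b : Fin n, (if a ≠ b then (if a = e j then
      (if b = e i then vec (e ∘ Equiv.swap i j) else 0) else 0) else (0 : Spin n N))
      = if e i ≠ e j then vec (e ∘ Equiv.swap i j) else 0 := by
    rw [Finset.sum_eq_single (e j) (fun a _ ha => by simp [ha]) (by simp),
      Finset.sum_eq_single (e i) (fun b _ hb => by simp [hb]) (by simp)]
    simp [eq_comm]
  rw [s1, s2, s3]
  rcases lt_trichotomy (e i) (e j) with h | h | h
  · simp [h, h.ne]
  · simp [h]
  · simp [h.ne', h.not_gt]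

/-- `v_e` with the entries of `e` in the places `i, j` replaced. -/
def vecTwo (i j : Fin N) (e : Fin N → Fin n) (x y : Fin n) : Spin n N :=
  vec (Function.update (Function.update e i x) j y)

theorem vecTwo_self (i j : Fin N) (e : Fin N → Fin n) : vecTwo i j e (e i) (e j) = vec e := by
  simp [vecTwo]

theorem update_update_comp_swap {X : Type*} {i j : Fin N} (hij : i ≠ j) (e : Fin N → X) (x y : X) :
    Function.update (Function.update e i x) j y ∘ Equiv.swap i j
      = Function.update (Function.update e i y) j x := by
  funext k
  by_cases hx : k = i
  · subst hx; simp [hij]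
  · by_cases hy : k = j
    · subst hy; simp [hij]
    · simp [hx, hy, Equiv.swap_apply_of_ne_of_ne]

theorem sOp_vecTwo {i j : Fin N} (hij : i ≠ j) (e : Fin N → Fin n) (x y : Fin n) :
    sOp q i j (vecTwo i j e x y) = if x = y then -(q⁻¹ • vecTwo i j e x y) else
      if x < y then (q - q⁻¹) • vecTwo i j e x y - vecTwo i j e y x
      else -vecTwo i j e y x := by
  rw [vecTwo, sOp_vec hij, update_update_comp_swap hij]
  simp [vecTwo, hij]

theorem spin_ext_two (i j : Fin N) {A B : Module.End ℂ (Spin n N)}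
    (h : ∀ e x y, A (vecTwo i j e x y) = B (vecTwo i j e x y)) : A = B :=
  spin_ext fun e => by rw [← vecTwo_self i j]; exact h _ _ _

set_option linter.unusedSimpArgs false in
-- On a pair of distinct labels S is a 2 × 2 matrix of trace κ and determinant -1, and on equal
-- labels it is the root -q⁻¹ of the same characteristic polynomial.
theorem sOp_mul_self (hq0 : q ≠ 0) {i j : Fin N} (hij : i ≠ j) :
    (sOp q i j * sOp q i j : Module.End ℂ (Spin n N)) = 1 + (q - q⁻¹) • sOp q i j := by
  refine spin_ext_two i j fun e x y => ?_
  simp only [Module.End.mul_apply, LinearMap.add_apply, LinearMap.smul_apply, Module.End.one_apply,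
    sOp_vecTwo hij]
  rcases lt_trichotomy x y with h | h | h
  · simp only [h, h.ne, h.ne', h.not_gt, if_true, if_false, map_sub, map_smul, map_neg,
      sOp_vecTwo hij]
    module
  · subst h
    simp only [if_true, map_smul, map_neg, sOp_vecTwo hij]
    match_scalars
    field_simp
    ring
  · simp only [h, h.ne, h.ne', h.not_gt, if_true, if_false, map_sub, map_smul, map_neg,
      sOp_vecTwo hij]
    module

theorem ringInverse_of_hecke {R : Type*} [Ring R] [Algebra ℂ R] {κ : ℂ} {x : R}
    (h : x * x = 1 + κ • x) : Ring.inverse x = x - κ • 1 := by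
  refine Ring.inverse_unit ⟨x, x - κ • 1, ?_, ?_⟩
  · rw [mul_sub, h, mul_smul_comm, mul_one, add_sub_cancel_right]
  · rw [sub_mul, h, smul_mul_assoc, one_mul, add_sub_cancel_right]

theorem inverse_sOp (hq0 : q ≠ 0) {i j : Fin N} (hij : i ≠ j) :
    Ring.inverse (sOp q i j : Module.End ℂ (Spin n N)) = sOp q i j - (q - q⁻¹) • 1 :=
  ringInverse_of_hecke (R := Module.End ℂ (Spin n N)) (κ := q - q⁻¹) (x := sOp q i j)
    (sOp_mul_self hq0 hij)

/-- `v_e` with the entries of `e` in the places `i, j, k` replaced. -/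
def vecThree (i j k : Fin N) (e : Fin N → Fin n) (x y z : Fin n) : Spin n N :=
  vec (Function.update (Function.update (Function.update e i x) j y) k z)

theorem sOp_vecThree_left {i j k : Fin N} (hij : i ≠ j) (hik : i ≠ k) (hjk : j ≠ k)
    (e : Fin N → Fin n) (x y z : Fin n) : sOp q i j (vecThree i j k e x y z)
      = if x = y then -(q⁻¹ • vecThree i j k e x y z) else
      if x < y then (q - q⁻¹) • vecThree i j k e x y z - vecThree i j k e y x z
      else -vecThree i j k e y x z := by
  have h : ∀ x y, vecThree i j k e x y z = vecTwo i j (Function.update e k z) x y := fun x y => by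
    rw [vecThree, vecTwo, Function.update_comm hjk, Function.update_comm hik]
  rw [h, h, sOp_vecTwo hij]

theorem sOp_vecThree_right {i j k : Fin N} (hjk : j ≠ k)
    (e : Fin N → Fin n) (x y z : Fin n) : sOp q j k (vecThree i j k e x y z)
      = if y = z then -(q⁻¹ • vecThree i j k e x y z) else
      if y < z then (q - q⁻¹) • vecThree i j k e x y z - vecThree i j k e x z y
      else -vecThree i j k e x z y :=
  sOp_vecTwo hjk (Function.update e i x) y z

set_option linter.unusedSimpArgs false in
-- S sees only the relative order of two labels, so it suffices to run through the possible orders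
-- of three labels.
theorem sOp_braid (hq0 : q ≠ 0) {i j k : Fin N} (hij : i ≠ j) (hik : i ≠ k) (hjk : j ≠ k) :
    (sOp q i j * sOp q j k * sOp q i j : Module.End ℂ (Spin n N))
      = sOp q j k * sOp q i j * sOp q j k := by
  refine spin_ext fun e => ?_
  have he : vec e = vecThree i j k e (e i) (e j) (e k) := by simp [vecThree]
  rw [he]
  generalize e i = x
  generalize e j = y
  generalize e k = z
  have hl := sOp_vecThree_left (q := q) hij hik hjk e
  have hr := sOp_vecThree_right (q := q) (i := i) hjk e
  simp only [Module.End.mul_apply]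
  rcases lt_trichotomy x y with h | h | h <;> rcases lt_trichotomy y z with h' | h' | h' <;>
    rcases lt_trichotomy x z with h'' | h'' | h'' <;>
    first
    | (exfalso; omega)
    | (try subst h
       try subst h'
       try subst h''
       simp only [hl, hr, *, lt_irrefl, LT.lt.ne, LT.lt.ne', LT.lt.not_gt, if_true, if_false,
         map_sub, map_smul, map_neg]
       all_goals (match_scalars <;> field_simp <;> ring))

/-! #### The action of the generators -/

theorem kLoc_prod_vec (hq0 : q ≠ 0) (a : Fin n) (t : ℤ) (L : List (Fin N)) (e : Fin N → Fin n) :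
    (L.map (kLoc q a t)).prod (vec e) = q ^ (t * (L.map fun k => wt a (e k)).sum) • vec e := by
  induction L with
  | nil => simp
  | cons k L ih =>
    rw [List.map_cons, List.prod_cons, Module.End.mul_apply, ih, map_smul, kLoc, onVec_vec,
      smul_smul, ← zpow_add₀ hq0, List.map_cons, List.sum_cons]
    congr 2
    ring

/-- S at most exchanges two labels, and the total weight over L is insensitive to this when L
contains both places or neither. -/
theorem kLoc_prod_commute_sOp (hq0 : q ≠ 0) (a : Fin n) (t : ℤ) {L : List (Fin N)} (hL : L.Nodup)
    {i j : Fin N} (hij : i ≠ j) (hiff : i ∈ L ↔ j ∈ L) :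
    Commute (L.map (kLoc q a t)).prod (sOp q i j) := by
  have hsum : ∀ e : Fin N → Fin n, (L.map fun k => wt a ((e ∘ Equiv.swap i j) k)).sum
      = (L.map fun k => wt a (e k)).sum := fun e => by
    rw [← List.sum_toFinset _ hL, ← List.sum_toFinset _ hL]
    refine Finset.sum_equiv (Equiv.swap i j) (fun k => ?_) fun _ _ => rfl
    simp only [List.mem_toFinset]
    by_cases hi : k = i
    · subst hi; rw [Equiv.swap_apply_left]; exact hiff
    · by_cases hj : k = j
      · subst hj; rw [Equiv.swap_apply_right]; exact hiff.symm
      · rw [Equiv.swap_apply_of_ne_of_ne hi hj]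
  refine spin_ext fun e => ?_
  rw [Module.End.mul_apply, Module.End.mul_apply, kLoc_prod_vec hq0, map_smul, sOp_vec hij]
  split_ifs <;>
    simp only [map_neg, map_sub, map_smul, kLoc_prod_vec hq0, hsum, smul_neg, smul_sub, smul_smul,
      mul_comm]

/-- The `j`-th summand of `E_a` without its factor `y_j`. -/
def raise (q : ℂ) (a : Fin n) (j : Fin N) : Module.End ℂ (Spin n N) :=
  matUnit j (prevIdx a) a * ((after j).map (kLoc q a 1)).prod

/-- The `j`-th summand of `F_a` without its factor `y_j`. -/
def drop (q : ℂ) (a : Fin n) (j : Fin N) : Module.End ℂ (Spin n N) :=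
  ((before j).map (kLoc q a (-1))).prod * matUnit j a (prevIdx a)

theorem mem_after_iff_of_succ {i j k : Fin N} (hij : (i : ℕ) + 1 = j) (hki : k ≠ i) (hkj : k ≠ j) :
    i ∈ after k ↔ j ∈ after k := by
  rw [mem_after, mem_after, Fin.lt_def, Fin.lt_def]
  have := Fin.val_ne_of_ne hki
  have := Fin.val_ne_of_ne hkj
  omega

theorem mem_before_iff_of_succ {i j k : Fin N} (hij : (i : ℕ) + 1 = j) (hki : k ≠ i)
    (hkj : k ≠ j) : i ∈ before k ↔ j ∈ before k := by
  rw [mem_before, mem_before, Fin.lt_def, Fin.lt_def]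
  have := Fin.val_ne_of_ne hki
  have := Fin.val_ne_of_ne hkj
  omega

theorem raise_commute_sOp (hq0 : q ≠ 0) (a : Fin n) {i j k : Fin N} (hij : (i : ℕ) + 1 = j)
    (hki : k ≠ i) (hkj : k ≠ j) : Commute (raise q a k) (sOp q i j) := by
  have hne : i ≠ j := fun h => by rw [h] at hij; omega
  exact (matUnit_commute_sOp hki hkj _ _).mul_left (kLoc_prod_commute_sOp hq0 a 1
    ((pairwise_after k).imp fun h => h.ne) hne (mem_after_iff_of_succ hij hki hkj))

theorem drop_commute_sOp (hq0 : q ≠ 0) (a : Fin n) {i j k : Fin N} (hij : (i : ℕ) + 1 = j)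
    (hki : k ≠ i) (hkj : k ≠ j) : Commute (drop q a k) (sOp q i j) := by
  have hne : i ≠ j := fun h => by rw [h] at hij; omega
  exact (kLoc_prod_commute_sOp hq0 a (-1) ((pairwise_before k).imp fun h => h.ne) hne
    (mem_before_iff_of_succ hij hki hkj)).mul_left (matUnit_commute_sOp hki hkj _ _)

section TwoPlaces

variable {i j : Fin N} (hij : (i : ℕ) + 1 = j) (a : Fin n) (e : Fin N → Fin n) (x y : Fin n)

include hij

theorem ne_of_succ : i ≠ j := fun h => by rw [h] at hij; omega

theorem raise_vecTwo_left (hq0 : q ≠ 0) : raise q a i (vecTwo i j e x y) = if x = a then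
    q ^ wt a y • q ^ ((after j).map fun k => wt a (e k)).sum • vecTwo i j e (prevIdx a) y
      else 0 := by
  have hne := ne_of_succ hij
  have hs : ((after j).map fun k => wt a (Function.update (Function.update e i x) j y k))
      = (after j).map fun k => wt a (e k) := List.map_congr_left fun k hk => by
    have := mem_after.1 hk
    have h1 : k ≠ i := fun h => by rw [h, Fin.lt_def] at this; omega
    rw [Function.update_of_ne this.ne', Function.update_of_ne h1]
  rw [raise, vecTwo, Module.End.mul_apply, kLoc_prod_vec hq0, map_smul, matUnit_vec,
    after_eq_cons hij, List.map_cons, hs, List.sum_cons, one_mul, zpow_add₀ hq0, mul_smul]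
  rw [Function.update_of_ne hne, Function.update_self, Function.update_self, vecTwo,
    Function.update_comm hne.symm, Function.update_idem]
  split_ifs <;> simp

theorem raise_vecTwo_right (hq0 : q ≠ 0) : raise q a j (vecTwo i j e x y) = if y = a then
    q ^ ((after j).map fun k => wt a (e k)).sum • vecTwo i j e x (prevIdx a) else 0 := by
  have hs : ((after j).map fun k => wt a (Function.update (Function.update e i x) j y k))
      = (after j).map fun k => wt a (e k) := List.map_congr_left fun k hk => by
    have := mem_after.1 hk
    have h1 : k ≠ i := fun h => by rw [h, Fin.lt_def] at this; omega
    rw [Function.update_of_ne this.ne', Function.update_of_ne h1]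
  rw [raise, vecTwo, Module.End.mul_apply, kLoc_prod_vec hq0, map_smul, matUnit_vec, hs, one_mul,
    Function.update_self, vecTwo, Function.update_idem]
  split_ifs <;> simp

theorem drop_vecTwo_left (hq0 : q ≠ 0) : drop q a i (vecTwo i j e x y) = if x = prevIdx a then
    q ^ (-((before i).map fun k => wt a (e k)).sum) • vecTwo i j e a y else 0 := by
  have hne := ne_of_succ hij
  have hs : ((before i).map fun k => wt a (Function.update (Function.update e i a) j y k))
      = (before i).map fun k => wt a (e k) := List.map_congr_left fun k hk => by
    have := mem_before.1 hk
    have h1 : k ≠ j := fun h => by rw [h, Fin.lt_def] at this; omega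
    rw [Function.update_of_ne h1, Function.update_of_ne this.ne]
  rw [drop, vecTwo, Module.End.mul_apply, matUnit_vec, Function.update_of_ne hne,
    Function.update_self, Function.update_comm hne.symm, Function.update_idem]
  split_ifs
  · rw [kLoc_prod_vec hq0, vecTwo, hs, neg_one_mul]
  · rw [map_zero]

theorem drop_vecTwo_right (hq0 : q ≠ 0) : drop q a j (vecTwo i j e x y) = if y = prevIdx a then
    q ^ (-wt a x) • q ^ (-((before i).map fun k => wt a (e k)).sum) • vecTwo i j e x a
      else 0 := by
  have hne := ne_of_succ hij
  have hs : ((before i).map fun k => wt a (Function.update (Function.update e i x) j a k))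
      = (before i).map fun k => wt a (e k) := List.map_congr_left fun k hk => by
    have := mem_before.1 hk
    have h1 : k ≠ j := fun h => by rw [h, Fin.lt_def] at this; omega
    rw [Function.update_of_ne h1, Function.update_of_ne this.ne]
  rw [drop, vecTwo, Module.End.mul_apply, matUnit_vec, Function.update_self,
    Function.update_idem]
  split_ifs
  · rw [kLoc_prod_vec hq0, vecTwo, before_eq_append hij, List.map_append, List.sum_append, hs,
      smul_smul, ← zpow_add₀ hq0]
    congr 2
    simp only [List.map_cons, List.map_nil, List.sum_cons, List.sum_nil, add_zero]
    rw [Function.update_of_ne hne, Function.update_self]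
    ring
  · rw [map_zero]

end TwoPlaces

theorem prevIdx_zero {a : Fin n} (ha : (a : ℕ) = 0) : (prevIdx a : ℕ) = n - 1 := by
  have := a.isLt
  simp only [prevIdx, ha]
  rw [Nat.mod_eq_of_lt (by omega)]
  omega

theorem prevIdx_of_pos {a : Fin n} (ha : (a : ℕ) ≠ 0) : (prevIdx a : ℕ) + 1 = a := by
  have := a.isLt
  simp only [prevIdx]
  rw [show (a : ℕ) + n - 1 = (a - 1) + n by omega, Nat.add_mod_right, Nat.mod_eq_of_lt (by omega)]
  omega

/-- For a = 0 the operator replaces the least label by the largest, so its comparison with any other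
label is reversed. This reversal is what the relation y_i⁻¹ = g y_{i+1}⁻¹ g compensates. -/
theorem sOp_mul_raise (hn : 2 ≤ n) (hq0 : q ≠ 0) {a : Fin n} (ha : (a : ℕ) = 0) {i j : Fin N}
    (hij : (i : ℕ) + 1 = j) : sOp q i j * raise q a i = raise q a j * sOp q i j := by
  have hne := ne_of_succ hij
  have hp := prevIdx_zero ha
  have hpa : prevIdx a ≠ a := fun h => by rw [h] at hp; omega
  have hpa' := hpa.symm
  refine spin_ext_two i j fun e x y => ?_
  have hl := fun x y => raise_vecTwo_left hij a e x y hq0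
  have hr := fun x y => raise_vecTwo_right hij a e x y hq0
  have hS := sOp_vecTwo (q := q) hne e
  generalize q ^ ((after j).map fun k => wt a (e k)).sum = Z at hl hr
  rw [Module.End.mul_apply, Module.End.mul_apply, hl, hS]
  have hlow : ∀ z : Fin n, ¬ z < a := fun z => by rw [Fin.lt_def]; omega
  have hhigh : ∀ z : Fin n, ¬ prevIdx a < z := fun z => by
    rw [Fin.lt_def]; have := z.isLt; omega
  have hlow' : ∀ z : Fin n, z ≠ a → a < z := fun z hz => by
    have := Fin.val_ne_of_ne hz
    rw [Fin.lt_def]; omega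
  by_cases hx : x = a
  · subst hx
    by_cases hy : y = x
    · subst hy
      simp [hr, hS, hpa, hhigh, wt, hpa']
    · by_cases hy' : y = prevIdx x
      · subst hy'
        simp [hr, hS, hpa, hpa', hlow' _ hpa, wt]
        match_scalars; field_simp
      · simp [hr, hS, Ne.symm hy, hy, Ne.symm hy', hlow' _ hy, hhigh, wt, hy']
  · by_cases hy : y = a
    · subst hy
      simp [hr, hx, hlow]
    · rw [if_neg hx]
      split_ifs <;> simp [hr, hx, hy]

/-- The same reversal of order, now from the largest label to the least; it matches y_{i+1} = g y_i
g. -/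
theorem sOp_mul_drop (hn : 2 ≤ n) (hq0 : q ≠ 0) {a : Fin n} (ha : (a : ℕ) = 0) {i j : Fin N}
    (hij : (i : ℕ) + 1 = j) : sOp q i j * drop q a j = drop q a i * sOp q i j := by
  have hne := ne_of_succ hij
  have hp := prevIdx_zero ha
  have hpa : prevIdx a ≠ a := fun h => by rw [h] at hp; omega
  have hpa' := hpa.symm
  refine spin_ext_two i j fun e x y => ?_
  have hl := fun x y => drop_vecTwo_right hij a e x y hq0
  have hr := fun x y => drop_vecTwo_left hij a e x y hq0
  have hS := sOp_vecTwo (q := q) hne e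
  generalize q ^ (-((before i).map fun k => wt a (e k)).sum) = Z at hl hr
  rw [Module.End.mul_apply, Module.End.mul_apply, hl, hS]
  have hlow : ∀ z : Fin n, ¬ z < a := fun z => by rw [Fin.lt_def]; omega
  have hhigh : ∀ z : Fin n, ¬ prevIdx a < z := fun z => by
    rw [Fin.lt_def]; have := z.isLt; omega
  have hhigh' : ∀ z : Fin n, z ≠ prevIdx a → z < prevIdx a := fun z hz => by
    have := Fin.val_ne_of_ne hz
    have := z.isLt
    rw [Fin.lt_def]; omega
  by_cases hy : y = prevIdx a
  · subst hy
    by_cases hx : x = prevIdx a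
    · subst hx
      simp [hr, hS, hpa, hlow, wt]
    · by_cases hx' : x = a
      · subst hx'
        simp [hr, hS, hpa', hhigh' _ hpa', wt]
        match_scalars; field_simp
      · simp [hr, hS, hx, hx', hhigh' _ hx, hlow, wt]
  · by_cases hx : x = prevIdx a
    · subst hx
      simp [hr, hy, Ne.symm hy, hhigh]
    · rw [if_neg hy]
      split_ifs <;> simp [hr, hx, hy]

set_option linter.unusedSimpArgs false in
-- For a ≠ 0 the two labels are adjacent, so any third label compares alike with both (`h1`, `h2`).
-- The remaining cases are the two-fold coproduct of U_q(sl₂).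
theorem raise_add_commute_sOp (hq0 : q ≠ 0) {a : Fin n} (ha : (a : ℕ) ≠ 0) {i j : Fin N}
    (hij : (i : ℕ) + 1 = j) : Commute (raise q a i + raise q a j) (sOp q i j) := by
  have hne := ne_of_succ hij
  have hp := prevIdx_of_pos ha
  have hpa : prevIdx a ≠ a := fun h => by rw [h] at hp; omega
  have hpa' := hpa.symm
  have hlt : prevIdx a < a := by rw [Fin.lt_def]; omega
  refine spin_ext_two i j fun e x y => ?_
  have hl := fun x y => raise_vecTwo_left hij a e x y hq0
  have hr := fun x y => raise_vecTwo_right hij a e x y hq0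
  have hS := sOp_vecTwo (q := q) hne e
  generalize q ^ ((after j).map fun k => wt a (e k)).sum = Z at hl hr
  rw [Module.End.mul_apply, Module.End.mul_apply, LinearMap.add_apply, LinearMap.add_apply, hl, hr,
    hS]
  have h1 : ∀ z : Fin n, z ≠ a → z ≠ prevIdx a → (z < a ↔ z < prevIdx a) := fun z hz hz' => by
    have := Fin.val_ne_of_ne hz
    have := Fin.val_ne_of_ne hz'
    rw [Fin.lt_def, Fin.lt_def]; omega
  have h2 : ∀ z : Fin n, z ≠ a → z ≠ prevIdx a → (a < z ↔ prevIdx a < z) := fun z hz hz' => by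
    have := Fin.val_ne_of_ne hz
    have := Fin.val_ne_of_ne hz'
    rw [Fin.lt_def, Fin.lt_def]; omega
  by_cases hx : x = a
  · subst hx
    by_cases hy : y = x
    · subst hy
      simp [hl, hr, hS, hpa, hpa', hlt, hlt.not_gt, wt]
      match_scalars <;> field_simp <;> ring
    · by_cases hy' : y = prevIdx x
      · subst hy'
        simp [hl, hr, hS, hpa, hpa', hlt.not_gt, wt]
        match_scalars <;> field_simp
      · by_cases hxy : x < y
        · have := (h2 y hy hy').1 hxy
          simp [hl, hr, hS, hy, hy', Ne.symm hy, Ne.symm hy', hxy, this, wt]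
          match_scalars <;> ring
        · have : ¬ prevIdx x < y := fun h => hxy ((h2 y hy hy').2 h)
          simp [hl, hr, hS, hy, hy', Ne.symm hy, Ne.symm hy', hxy, this, wt]
  · by_cases hy : y = a
    · subst hy
      by_cases hx' : x = prevIdx y
      · subst hx'
        simp [hl, hr, hS, hpa, hpa', hlt, wt]
        match_scalars <;> field_simp <;> ring
      · by_cases hxy : x < y
        · have := (h1 x hx hx').1 hxy
          simp [hl, hr, hS, hx, hx', hxy, this, wt]
          match_scalars <;> ring
        · have : ¬ x < prevIdx y := fun h => hxy ((h1 x hx hx').2 h)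
          simp [hl, hr, hS, hx, hx', hxy, this, wt]
    · rw [if_neg hx, if_neg hy]
      split_ifs <;> simp [hl, hr, hx, hy]

set_option linter.unusedSimpArgs false in
theorem drop_add_commute_sOp (hq0 : q ≠ 0) {a : Fin n} (ha : (a : ℕ) ≠ 0) {i j : Fin N}
    (hij : (i : ℕ) + 1 = j) : Commute (drop q a i + drop q a j) (sOp q i j) := by
  have hne := ne_of_succ hij
  have hp := prevIdx_of_pos ha
  have hpa : prevIdx a ≠ a := fun h => by rw [h] at hp; omega
  have hpa' := hpa.symm
  have hlt : prevIdx a < a := by rw [Fin.lt_def]; omega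
  refine spin_ext_two i j fun e x y => ?_
  have hl := fun x y => drop_vecTwo_left hij a e x y hq0
  have hr := fun x y => drop_vecTwo_right hij a e x y hq0
  have hS := sOp_vecTwo (q := q) hne e
  generalize q ^ (-((before i).map fun k => wt a (e k)).sum) = Z at hl hr
  rw [Module.End.mul_apply, Module.End.mul_apply, LinearMap.add_apply, LinearMap.add_apply, hl, hr,
    hS]
  have h1 : ∀ z : Fin n, z ≠ a → z ≠ prevIdx a → (z < a ↔ z < prevIdx a) := fun z hz hz' => by
    have := Fin.val_ne_of_ne hz
    have := Fin.val_ne_of_ne hz'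
    rw [Fin.lt_def, Fin.lt_def]; omega
  have h2 : ∀ z : Fin n, z ≠ a → z ≠ prevIdx a → (a < z ↔ prevIdx a < z) := fun z hz hz' => by
    have := Fin.val_ne_of_ne hz
    have := Fin.val_ne_of_ne hz'
    rw [Fin.lt_def, Fin.lt_def]; omega
  by_cases hx : x = prevIdx a
  · subst hx
    by_cases hy : y = prevIdx a
    · subst hy
      simp [hl, hr, hS, hpa, hpa', hlt, hlt.not_gt, wt]
      match_scalars <;> field_simp <;> ring
    · by_cases hy' : y = a
      · subst hy'
        simp [hl, hr, hS, hpa, hpa', hlt, wt]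
        match_scalars <;> field_simp <;> ring
      · by_cases hxy : prevIdx a < y
        · have := (h2 y hy' hy).2 hxy
          simp [hl, hr, hS, hy, hy', Ne.symm hy, Ne.symm hy', hxy, this, wt, hpa, hpa']
          match_scalars <;> ring
        · have : ¬ a < y := fun h => hxy ((h2 y hy' hy).1 h)
          simp [hl, hr, hS, hy, hy', Ne.symm hy, Ne.symm hy', hxy, this, wt, hpa, hpa']
  · by_cases hy : y = prevIdx a
    · subst hy
      by_cases hx' : x = a
      · subst hx'
        simp [hl, hr, hS, hpa, hpa', hlt.not_gt, wt]
        match_scalars <;> field_simp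
      · by_cases hxy : x < prevIdx a
        · have := (h1 x hx' hx).2 hxy
          simp [hl, hr, hS, hx, hx', hxy, this, wt]
          match_scalars <;> ring
        · have : ¬ x < a := fun h => hxy ((h1 x hx' hx).1 h)
          simp [hl, hr, hS, hx, hx', hxy, this, wt]
    · rw [if_neg hx, if_neg hy]
      split_ifs <;> simp [hl, hr, hx, hy]

end QWedge

end

noncomputable section

namespace QWedge

/-! ### The `q`-wedge product as a balanced tensor product -/

variable {n N : ℕ} {q p : ℂ}

/-- The expression is (q + q⁻¹)², and its vanishing would make q a primitive fourth root of unity.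
It is the discriminant of x² - κx - 1. -/
theorem sq_add_four_ne_zero (hq0 : q ≠ 0) (hq : ∀ a : ℕ, 0 < a → q ^ a = 1 → q = 1) :
    (q - q⁻¹) ^ 2 + 4 ≠ 0 := by
  intro h
  have h1 : (q - q⁻¹) ^ 2 + 4 = (q + q⁻¹) ^ 2 := by field_simp; ring
  rw [h1, sq_eq_zero_iff] at h
  have h2 : q ^ 2 = -1 := by
    have := congrArg (fun x => q * x) h
    simp only [mul_add, mul_inv_cancel₀ hq0, mul_zero] at this
    linear_combination this
  have h3 := hq 4 (by norm_num) (by rw [show 4 = 2 * 2 by norm_num, pow_mul, h2]; norm_num)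
  rw [h3] at h2
  norm_num at h2

/-- `g_{i,j}` acting on `⊗^N V(z)`. -/
def gTens (q : ℂ) (n : ℕ) {N : ℕ} (i j : Fin N) : Module.End ℂ (Tens n N) :=
  TensorProduct.map (gOp q i j) LinearMap.id

/-- `S_{i,j}` acting on `⊗^N V(z)`. -/
def sTens (q : ℂ) {n N : ℕ} (i j : Fin N) : Module.End ℂ (Tens n N) :=
  TensorProduct.map LinearMap.id (sOp q i j)

theorem gTens_sTens (i j k l : Fin N) (x : Tens n N) :
    gTens q n i j (sTens q k l x) = sTens q k l (gTens q n i j x) := by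
  have : gTens q n i j ∘ₗ sTens q k l = sTens q k l ∘ₗ gTens q n i j := by
    rw [gTens, sTens, ← TensorProduct.map_comp, ← TensorProduct.map_comp]
    rfl
  exact LinearMap.congr_fun this x

theorem gTens_gTens (hq0 : q ≠ 0) {i j : Fin N} (hij : i ≠ j) (x : Tens n N) :
    gTens q n i j (gTens q n i j x) = x + (q - q⁻¹) • gTens q n i j x := by
  induction x using TensorProduct.induction_on with
  | zero => simp
  | tmul f v =>
    have := LinearMap.congr_fun (gOp_mul_self hq0 hij) f
    simp only [Module.End.mul_apply, LinearMap.add_apply, LinearMap.smul_apply,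
      Module.End.one_apply] at this
    simp only [gTens, TensorProduct.map_tmul, this, TensorProduct.add_tmul,
      TensorProduct.smul_tmul', LinearMap.id_coe, id_eq]
  | add x y hx hy => simp only [map_add, hx, hy, smul_add]; abel

theorem sTens_sTens (hq0 : q ≠ 0) {i j : Fin N} (hij : i ≠ j) (x : Tens n N) :
    sTens q i j (sTens q i j x) = x + (q - q⁻¹) • sTens q i j x := by
  induction x using TensorProduct.induction_on with
  | zero => simp
  | tmul f v =>
    have := LinearMap.congr_fun (sOp_mul_self (n := n) hq0 hij) v
    simp only [Module.End.mul_apply, LinearMap.add_apply, LinearMap.smul_apply,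
      Module.End.one_apply] at this
    simp only [sTens, TensorProduct.map_tmul, this, TensorProduct.tmul_add,
      TensorProduct.tmul_smul, LinearMap.id_coe, id_eq]
  | add x y hx hy => simp only [map_add, hx, hy, smul_add]; abel

theorem mem_ker_iff (hq0 : q ≠ 0) {i j : Fin N} (hij : i ≠ j) (x : Tens n N) :
    x ∈ LinearMap.ker (TensorProduct.map (gOp q i j) LinearMap.id
        + TensorProduct.map LinearMap.id (Ring.inverse (sOp q i j)) : Module.End ℂ (Tens n N))
      ↔ gTens q n i j x + sTens q i j x = (q - q⁻¹) • x := by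
  have : TensorProduct.map LinearMap.id (Ring.inverse (sOp q i j)) x
      = sTens q i j x - (q - q⁻¹) • x := by
    rw [inverse_sOp hq0 hij]
    induction x using TensorProduct.induction_on with
    | zero => simp
    | tmul f v =>
      simp only [sTens, TensorProduct.map_tmul, LinearMap.sub_apply, LinearMap.smul_apply,
        Module.End.one_apply, TensorProduct.tmul_sub, TensorProduct.tmul_smul, LinearMap.id_coe,
        id_eq]
    | add x y hx hy => simp only [map_add, hx, hy, smul_add]; abel
  rw [LinearMap.mem_ker, LinearMap.add_apply, this, ← add_sub_assoc, sub_eq_zero]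
  rfl

/-- In the `q`-wedge product the two Hecke actions agree. -/
theorem Lam_gOp (hq0 : q ≠ 0) {i j : Fin N} (hij : (i : ℕ) + 1 = j) (f : Laurent N)
    (v : Spin n N) : Lam q n N (gOp q i j f ⊗ₜ v) = Lam q n N (f ⊗ₜ sOp q i j v) := by
  have hne := ne_of_succ hij
  rw [← sub_eq_zero, ← map_sub, Lam, Submodule.mkQ_apply, Submodule.Quotient.mk_eq_zero]
  refine Submodule.mem_iSup_of_mem i (Submodule.mem_iSup_of_mem j
    (Submodule.mem_iSup_of_mem hij ?_))
  rw [mem_ker_iff hq0 hne]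
  have h1 : gOp q i j f ⊗ₜ[ℂ] v = gTens q n i j (f ⊗ₜ v) := rfl
  have h2 : f ⊗ₜ[ℂ] sOp q i j v = sTens q i j (f ⊗ₜ v) := rfl
  rw [h1, h2]
  -- Since g and S commute and satisfy the same quadratic relation, (g + S - κ)(g - S) = g² - S² -
  -- κ(g - S) = 0.
  simp only [map_sub, gTens_gTens hq0 hne, sTens_sTens hq0 hne, gTens_sTens, smul_sub]
  abel

/-- The relations g ⊗ 1 = 1 ⊗ S generate all of Ω, since on the kernel of g + S - κ the operator g -
S can be inverted. -/
theorem omega_le (hq0 : q ≠ 0) (hq : ∀ a : ℕ, 0 < a → q ^ a = 1 → q = 1)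
    {W : Submodule ℂ (Tens n N)} (h : ∀ i j : Fin N, (i : ℕ) + 1 = j → ∀ (f : Laurent N)
      (v : Spin n N), gOp q i j f ⊗ₜ[ℂ] v - f ⊗ₜ[ℂ] sOp q i j v ∈ W) : Omega q n N ≤ W := by
  refine iSup_le fun i => iSup_le fun j => iSup_le fun hij x hx => ?_
  have hne := ne_of_succ hij
  rw [mem_ker_iff hq0 hne] at hx
  have key : ∀ y : Tens n N, gTens q n i j y - sTens q i j y ∈ W := fun y => by
    induction y using TensorProduct.induction_on with
    | zero => simp
    | tmul f v => exact h i j hij f v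
    | add x y hx hy =>
      rw [map_add, map_add, add_sub_add_comm]
      exact Submodule.add_mem _ hx hy
  have hc := sq_add_four_ne_zero hq0 hq
  have hx' : gTens q n i j x = (q - q⁻¹) • x - sTens q i j x := eq_sub_of_add_eq hx
  -- On the kernel g = κ - S, hence (g - S)(κ - 2S)x = (κ - 2S)²x = (κ² + 4)x.
  have := Submodule.smul_mem _ ((q - q⁻¹) ^ 2 + 4)⁻¹
    (key ((q - q⁻¹) • x - (2 : ℂ) • sTens q i j x))
  convert this using 1
  rw [eq_inv_smul_iff₀ hc]
  simp only [map_sub, map_smul, gTens_sTens, hx', sTens_sTens hq0 hne]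
  module

/-! ### Descent of the generators to the wedge product. -/

theorem descends_of_forall (hq0 : q ≠ 0) (hq : ∀ a : ℕ, 0 < a → q ^ a = 1 → q = 1)
    {T : Module.End ℂ (Tens n N)} (h : ∀ i j : Fin N, (i : ℕ) + 1 = j → ∀ (f : Laurent N)
      (v : Spin n N), Lam q n N (T (gOp q i j f ⊗ₜ[ℂ] v)) = Lam q n N (T (f ⊗ₜ[ℂ] sOp q i j v))) :
    Descends (q := q) T := by
  refine omega_le hq0 hq fun i j hij f v => ?_
  rw [Submodule.mem_comap, map_sub, ← Submodule.Quotient.mk_eq_zero, ← Submodule.mkQ_apply,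
    map_sub]
  exact sub_eq_zero.2 (h i j hij f v)

/-- A summand at a place other than i, j commutes with both Hecke generators and respects the
balancing by itself, so only the two summands at i and j have to be compared. -/
theorem descends_sum (hq0 : q ≠ 0) (hq : ∀ a : ℕ, 0 < a → q ^ a = 1 → q = 1)
    (Z : Fin N → Module.End ℂ (Laurent N)) (X : Fin N → Module.End ℂ (Spin n N))
    (hZ : ∀ i j k : Fin N, (i : ℕ) + 1 = j → k ≠ i → k ≠ j → Commute (Z k) (gOp q i j))
    (hX : ∀ i j k : Fin N, (i : ℕ) + 1 = j → k ≠ i → k ≠ j → Commute (X k) (sOp q i j))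
    (h : ∀ i j : Fin N, (i : ℕ) + 1 = j → ∀ (f : Laurent N) (v : Spin n N),
      Lam q n N (Z i (gOp q i j f) ⊗ₜ[ℂ] X i v) + Lam q n N (Z j (gOp q i j f) ⊗ₜ[ℂ] X j v)
        = Lam q n N (Z i f ⊗ₜ[ℂ] X i (sOp q i j v))
          + Lam q n N (Z j f ⊗ₜ[ℂ] X j (sOp q i j v))) :
    Descends (q := q) (∑ k, TensorProduct.map (Z k) (X k)) := by
  refine descends_of_forall hq0 hq fun i j hij f v => ?_
  have hne := ne_of_succ hij
  simp only [LinearMap.sum_apply, TensorProduct.map_tmul, map_sum]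
  rw [← sub_eq_zero, ← Finset.sum_sub_distrib, Fintype.sum_eq_add i j hne fun k hk => ?_]
  · have := h i j hij f v
    rw [← sub_eq_zero] at this
    rw [← this]
    abel
  · have h1 : Z k (gOp q i j f) = gOp q i j (Z k f) :=
      LinearMap.congr_fun (hZ i j k hij hk.1 hk.2).eq f
    have h2 : X k (sOp q i j v) = sOp q i j (X k v) :=
      LinearMap.congr_fun (hX i j k hij hk.1 hk.2).eq v
    rw [h1, h2, Lam_gOp hq0 hij, sub_self]

/-- The left factor g of Z' is carried to the spins, where S X' = X S. Both sides then consist of Zf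
⊗ XSv, Zgf ⊗ Xv and κ Zgf ⊗ XSv. -/
theorem Lam_affine_pair (hq0 : q ≠ 0) {i j : Fin N} (hij : (i : ℕ) + 1 = j)
    {Z Z' : Module.End ℂ (Laurent N)} {X X' : Module.End ℂ (Spin n N)}
    (hZ : Z' = gOp q i j * Z * gOp q i j) (hX : sOp q i j * X' = X * sOp q i j) (f : Laurent N)
    (v : Spin n N) :
    Lam q n N (Z' (gOp q i j f) ⊗ₜ[ℂ] X' v) + Lam q n N (Z (gOp q i j f) ⊗ₜ[ℂ] X v)
      = Lam q n N (Z' f ⊗ₜ[ℂ] X' (sOp q i j v)) + Lam q n N (Z f ⊗ₜ[ℂ] X (sOp q i j v)) := by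
  have hne := ne_of_succ hij
  have hg : gOp q i j (gOp q i j f) = f + (q - q⁻¹) • gOp q i j f :=
    LinearMap.congr_fun (gOp_mul_self hq0 hne) f
  have hX' : ∀ v, sOp q i j (X' v) = X (sOp q i j v) := fun v => LinearMap.congr_fun hX v
  have hs : sOp q i j (sOp q i j v) = v + (q - q⁻¹) • sOp q i j v :=
    LinearMap.congr_fun (sOp_mul_self (n := n) hq0 hne) v
  rw [hZ]
  simp only [Module.End.mul_apply, hg, Lam_gOp hq0 hij, hX', hs, map_add, map_smul,
    TensorProduct.tmul_add, TensorProduct.add_tmul, TensorProduct.tmul_smul,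
    ← TensorProduct.smul_tmul']
  abel

theorem isUnit_yHecke (hq0 : q ≠ 0) (hp0 : p ≠ 0) (i : Fin N) : IsUnit (yHecke q p i) := by
  have h : (Units.mk0 (q ^ (1 - (N : ℤ))) (zpow_ne_zero _ hq0)) • yOp q p i = yHecke q p i := rfl
  rw [← h]
  exact (isUnit_yOp hq0 hp0 i).smul _

theorem yHecke_succ (hq0 : q ≠ 0) (p : ℂ) {i j : Fin N} (hij : (i : ℕ) + 1 = j) :
    yHecke q p j = gOp q i j * yHecke q p i * gOp q i j := by
  rw [yHecke, yHecke, yOp_succ hq0 p hij, mul_smul_comm, smul_mul_assoc]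

theorem gOp_commute_yHecke (hq0 : q ≠ 0) (hp0 : p ≠ 0) {i j k : Fin N} (hij : (i : ℕ) + 1 = j)
    (hki : k ≠ i) (hkj : k ≠ j) : Commute (yHecke q p k) (gOp q i j) :=
  (gOp_commute_yOp hq0 hp0 k hij hki.symm hkj.symm).symm.smul_left _

theorem inverse_yHecke_succ (hq0 : q ≠ 0) (hp0 : p ≠ 0) {i j : Fin N} (hij : (i : ℕ) + 1 = j) :
    Ring.inverse (yHecke q p i) = gOp q i j * Ring.inverse (yHecke q p j) * gOp q i j := by
  obtain ⟨u, hu⟩ := isUnit_yHecke (p := p) hq0 hp0 i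
  obtain ⟨g, hg⟩ := isUnit_gOp (q := q) hq0 (ne_of_succ hij)
  have h := yHecke_succ hq0 p hij
  rw [← hu, ← hg] at h
  have h' : yHecke q p j = ((g * u * g : (Module.End ℂ (Laurent N))ˣ) : Module.End ℂ (Laurent N)) :=
    by rw [h]; simp
  rw [h', ← hu, ← hg, Ring.inverse_unit, Ring.inverse_unit, ← Units.val_mul, ← Units.val_mul]
  congr 1
  group

theorem commute_ringInverse {R : Type*} [MonoidWithZero R] {x y : R} (hx : IsUnit x)
    (h : Commute x y) : Commute (Ring.inverse x) y := by
  obtain ⟨u, rfl⟩ := hx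
  rw [Ring.inverse_unit]
  exact Commute.units_inv_left h

theorem descends_tensAct (hn : 2 ≤ n) (hq0 : q ≠ 0)
    (hq : ∀ a : ℕ, 0 < a → q ^ a = 1 → q = 1) (hp0 : p ≠ 0) (x : Gen n) :
    Descends (q := q) (tensAct q p n N x) := by
  have hK : ∀ (a : Fin n) (t : ℤ), Descends (q := q) (TensorProduct.map 1
      ((List.finRange N).map (kLoc q a t)).prod : Module.End ℂ (Tens n N)) := fun a t => by
    refine descends_of_forall hq0 hq fun i j hij f v => ?_
    have hc := kLoc_prod_commute_sOp hq0 a t (List.nodup_finRange N) (ne_of_succ hij) (by simp)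
    have hc' := LinearMap.congr_fun hc.eq v
    rw [Module.End.mul_apply, Module.End.mul_apply] at hc'
    rw [TensorProduct.map_tmul, TensorProduct.map_tmul, hc', Module.End.one_apply,
      Module.End.one_apply, Lam_gOp hq0 hij]
  have hone : ∀ {X : Fin N → Module.End ℂ (Spin n N)},
      (∀ i j k : Fin N, (i : ℕ) + 1 = j → k ≠ i → k ≠ j → Commute (X k) (sOp q i j)) →
      (∀ i j : Fin N, (i : ℕ) + 1 = j → Commute (X i + X j) (sOp q i j)) →
      Descends (q := q) (∑ k, TensorProduct.map 1 (X k) : Module.End ℂ (Tens n N)) :=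
    fun {X} h1 h2 => by
      refine descends_sum hq0 hq (fun _ => 1) X (fun _ _ _ _ _ _ => Commute.one_left _) h1
        fun i j hij f v => ?_
      have hc : X i (sOp q i j v) + X j (sOp q i j v) = sOp q i j (X i v + X j v) :=
        LinearMap.congr_fun (h2 i j hij).eq v
      simp only [Module.End.one_apply]
      rw [← map_add, ← map_add, ← TensorProduct.tmul_add, ← TensorProduct.tmul_add, hc,
        Lam_gOp hq0 hij]
  cases x with
  | E a =>
    by_cases ha : (a : ℕ) = 0
    · simp only [tensAct, if_pos ha]
      refine descends_sum hq0 hq (fun k => Ring.inverse (yHecke q p k)) (raise q a)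
        (fun i j k hij hki hkj => commute_ringInverse (isUnit_yHecke hq0 hp0 k)
          (gOp_commute_yHecke hq0 hp0 hij hki hkj))
        (fun i j k hij hki hkj => raise_commute_sOp hq0 a hij hki hkj) fun i j hij f v => ?_
      exact Lam_affine_pair hq0 hij (inverse_yHecke_succ hq0 hp0 hij)
        (sOp_mul_raise hn hq0 ha hij) f v
    · simp only [tensAct, if_neg ha]
      exact hone (X := raise q a) (fun i j k hij hki hkj => raise_commute_sOp hq0 a hij hki hkj)
        fun i j hij => raise_add_commute_sOp hq0 ha hij
  | F a =>
    by_cases ha : (a : ℕ) = 0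
    · simp only [tensAct, if_pos ha]
      refine descends_sum hq0 hq (fun k => yHecke q p k) (drop q a)
        (fun i j k hij hki hkj => gOp_commute_yHecke hq0 hp0 hij hki hkj)
        (fun i j k hij hki hkj => drop_commute_sOp hq0 a hij hki hkj) fun i j hij f v => ?_
      rw [add_comm, Lam_affine_pair hq0 hij (yHecke_succ hq0 p hij)
        (sOp_mul_drop hn hq0 ha hij) f v, add_comm]
    · simp only [tensAct, if_neg ha]
      exact hone (X := drop q a) (fun i j k hij hki hkj => drop_commute_sOp hq0 a hij hki hkj)
        fun i j hij => drop_add_commute_sOp hq0 ha hij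
  | K a => exact hK a 1
  | Kinv a => exact hK a (-1)

end QWedge

end

noncomputable section

namespace QWedge

/-! ### Straightening -/

variable {n N : ℕ} {q p : ℂ}

theorem monotone_of_succ_le {X : Type*} [Preorder X] {m : Fin N → X}
    (h : ∀ i j : Fin N, (i : ℕ) + 1 = j → m i ≤ m j) : Monotone m := by
  have key : ∀ (d : ℕ) (i j : Fin N), (i : ℕ) + d = j → m i ≤ m j := fun d => by
    induction d with
    | zero => exact fun i j hij => (congrArg m (Fin.ext hij)).le
    | succ d ih =>
      intro i j hij
      exact (ih i ⟨i + d, by omega⟩ rfl).trans (h _ _ (by simp only; omega))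
  exact fun i j hij => key (j - i) i j (by have : (i : ℕ) ≤ j := hij; omega)

theorem seqE_lt {m : Fin N → ℤ} (hm : Monotone m) {e : Fin N → Fin n} (he : e ∈ seqE n m)
    {i j : Fin N} (hij : i < j) (h : m i = m j) : e j < e i := by
  have key : ∀ (d : ℕ) (i j : Fin N), (i : ℕ) + (d + 1) = j → m i = m j → e j < e i := fun d => by
    induction d with
    | zero => exact fun i j hij h => he i j hij h
    | succ d ih =>
      intro i j hij h
      have h1 : m i ≤ m ⟨i + (d + 1), by omega⟩ := hm (Fin.le_def.2 (by simp only; omega))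
      have h2 : m ⟨i + (d + 1), by omega⟩ ≤ m j := hm (Fin.le_def.2 (by simp only; omega))
      exact (he ⟨i + (d + 1), by omega⟩ j (by simp only; omega) (by omega)).trans
        (ih i _ rfl (by omega))
  have : (i : ℕ) < j := hij
  exact key (j - i - 1) i j (by omega) h

/-- On each level set of m the labels are strictly decreasing, hence distinct, and there are n
labels. -/
theorem mem_seqM_of_seqE {m : Fin N → ℤ} (hm : Monotone m) {e : Fin N → Fin n}
    (he : e ∈ seqE n m) : m ∈ seqM n N := by
  refine ⟨hm, fun c => ?_⟩
  have : Set.InjOn e (Finset.univ.filter fun i => m i = c : Finset (Fin N)) := by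
    intro i hi j hj hij
    simp only [Finset.coe_filter, Finset.mem_univ, true_and, Set.mem_ofPred_eq] at hi hj
    rcases lt_trichotomy i j with h | h | h
    · exact absurd hij (seqE_lt hm he h (hi.trans hj.symm)).ne'
    · exact h
    · exact absurd hij (seqE_lt hm he h (hj.trans hi.symm)).ne
  simpa using Finset.card_le_card_of_injOn e (fun _ _ => Finset.mem_univ _) this

theorem sum_mul_comp_swap {i j : Fin N} (hij : i ≠ j) (a b : Fin N → ℤ) :
    ∑ k, a k * b k - ∑ k, a k * b (Equiv.swap i j k) = (a i - a j) * (b i - b j) := by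
  rw [← Finset.sum_sub_distrib, Fintype.sum_eq_add i j hij fun k hk => by
    rw [Equiv.swap_apply_of_ne_of_ne hk.1 hk.2, sub_self], Equiv.swap_apply_left,
    Equiv.swap_apply_right]
  ring

theorem add_inv_ne_zero (hq0 : q ≠ 0) (hq : ∀ a : ℕ, 0 < a → q ^ a = 1 → q = 1) :
    q + q⁻¹ ≠ 0 := by
  have h := sq_add_four_ne_zero hq0 hq
  have h1 : (q - q⁻¹) ^ 2 + 4 = (q + q⁻¹) ^ 2 := by field_simp; ring
  rw [h1] at h
  exact fun h0 => h (by rw [h0]; ring)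

/-- The components with a `q`-symmetric polynomial factor are spanned by those with a decreasing
spin part. -/
theorem Lam_tmul_mem_span (hq0 : q ≠ 0) (hq : ∀ a : ℕ, 0 < a → q ^ a = 1 → q = 1)
    {m : Fin N → ℤ} {f : Laurent N}
    (hf : ∀ i j : Fin N, (i : ℕ) + 1 = j → m i = m j → gOp q i j f = q • f) (v : Spin n N) :
    Lam q n N (f ⊗ₜ v) ∈ Submodule.span ℂ ((fun e => Lam q n N (f ⊗ₜ vec e)) '' seqE n m) := by
  set U := Submodule.span ℂ ((fun e => Lam q n N (f ⊗ₜ vec e)) '' seqE n m)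
  -- The measure ∑ k e_k drops when an ascent of labels at equal exponents is exchanged.
  have key : ∀ (t : ℕ) (e : Fin N → Fin n), (∑ k : Fin N, (k : ℤ) * (e k : ℤ)).toNat = t →
      Lam q n N (f ⊗ₜ vec e) ∈ U := fun t => by
    induction t using Nat.strong_induction_on with
    | _ t ih =>
    intro e ht
    by_cases he : e ∈ seqE n m
    · exact Submodule.subset_span ⟨e, he, rfl⟩
    · simp only [seqE, Set.mem_ofPred_eq, not_forall, not_lt] at he
      obtain ⟨i, j, hij, hm, hle⟩ := he
      have hne := ne_of_succ hij
      have h1 := Lam_gOp hq0 hij f (vec e)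
      rw [hf i j hij hm, ← TensorProduct.smul_tmul', map_smul, sOp_vec hne] at h1
      rcases hle.eq_or_lt with h | h
      -- For equal labels S is -q⁻¹ while g is q, so the vector is annihilated by q + q⁻¹ ≠ 0.
      · rw [if_pos h, TensorProduct.tmul_neg, TensorProduct.tmul_smul, map_neg, map_smul,
          ← add_eq_zero_iff_eq_neg, ← add_smul] at h1
        rw [(smul_eq_zero.1 h1).resolve_left (add_inv_ne_zero hq0 hq)]
        exact U.zero_mem
      · rw [if_neg h.ne, if_pos h, TensorProduct.tmul_sub, TensorProduct.tmul_smul, map_sub,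
          map_smul, sub_smul, sub_sub, ← sub_eq_zero, sub_sub_cancel] at h1
        have h2 := sum_mul_comp_swap hne (fun k => (k : ℤ)) (fun k => ((e k : ℕ) : ℤ))
        have h3 : (0 : ℤ) < ((i : ℤ) - j) * ((e i : ℤ) - e j) :=
          mul_pos_of_neg_of_neg (by omega) (by have : (e i : ℕ) < e j := h; omega)
        have h4 : (0 : ℤ) ≤ ∑ k : Fin N, (k : ℤ) * ((e (Equiv.swap i j k) : ℕ) : ℤ) :=
          Finset.sum_nonneg fun _ _ => by positivity
        have h5 := ih _ (by
          rw [← ht]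
          simp only [Function.comp]
          omega) (e ∘ Equiv.swap i j) rfl
        have h6 : Lam q n N (f ⊗ₜ vec e) = -(q • Lam q n N (f ⊗ₜ vec (e ∘ Equiv.swap i j))) := by
          rw [← add_eq_zero_iff_eq_neg]
          have := congrArg (fun y => q • y) h1
          simpa [smul_smul, mul_inv_cancel₀ hq0] using this
        rw [h6]
        exact U.neg_mem (U.smul_mem _ h5)
  induction v using Finsupp.induction_linear with
  | zero => simp
  | add v w hv hw => rw [TensorProduct.tmul_add, map_add]; exact U.add_mem hv hw
  | single e c =>
    have : (Finsupp.single e c : Spin n N) = c • vec e := by simp [vec]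
    rw [this, TensorProduct.tmul_smul, map_smul]
    exact U.smul_mem _ (key _ e rfl)

/-- The span of the normally ordered wedges below `z^l`. -/
def normalSpan (q : ℂ) (n : ℕ) {N : ℕ} (l : Fin N → ℤ) : Submodule ℂ (Wedge q n N) :=
  Submodule.span ℂ ((fun x => wedgeVec q x.1 x.2) '' pairs n {m | m ∈ seqM n N ∧ Maj l m})

theorem normalSpan_mono {l m : Fin N → ℤ} (h : Maj l m) : normalSpan q n m ≤ normalSpan q n l :=
  Submodule.span_mono (Set.image_mono fun _ hx => ⟨⟨hx.1.1, h.trans hx.1.2⟩, hx.2⟩)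

/-- Every wedge is a combination of normally ordered wedges below it. -/
theorem Lam_mono_mem_normalSpan (hq0 : q ≠ 0) (hq : ∀ a : ℕ, 0 < a → q ^ a = 1 → q = 1)
    (l : Fin N → ℤ) (v : Spin n N) : Lam q n N (mono l ⊗ₜ v) ∈ normalSpan q n l := by
  -- Two nested inductions: the outer one on majorization, the inner one within an orbit on the
  -- squared distance from (0, 1, 2, …), which falls when an adjacent descent is exchanged.
  have inner : ∀ (t : ℕ) (l : Fin N → ℤ), (∑ k : Fin N, (l k - (k : ℤ)) ^ 2).toNat = t →
      (∀ m, Below l m → ∀ v : Spin n N, Lam q n N (mono m ⊗ₜ v) ∈ normalSpan q n m) →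
      ∀ v : Spin n N, Lam q n N (mono l ⊗ₜ v) ∈ normalSpan q n l := fun t => by
    induction t using Nat.strong_induction_on with
    | _ t ih =>
    intro l ht hbelow v
    by_cases hl : Monotone l
    · have := Lam_tmul_mem_span hq0 hq (f := mono l) (m := l)
        (fun i j _ h => gOp_mono_of_eq h) v
      refine Submodule.span_mono ?_ this
      rintro _ ⟨e, he, rfl⟩
      exact ⟨(l, e), ⟨⟨mem_seqM_of_seqE hl he, Maj.refl l⟩, he⟩, rfl⟩
    · obtain ⟨i, j, hij, hlt⟩ : ∃ i j : Fin N, (i : ℕ) + 1 = j ∧ l j < l i := by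
        by_contra! h
        exact hl (monotone_of_succ_le h)
      have hne := ne_of_succ hij
      set k := l ∘ Equiv.swap i j with hk
      have hki : k i = l j := by simp [hk]
      have hkj : k j = l i := by simp [hk]
      have hks : k ∘ Equiv.swap i j = l := comp_swap_comp_swap i j l
      have hlk : Maj l k := maj_comp_perm l _
      -- Applied to the exchanged exponent k, g produces q⁻¹z^l and strictly lower terms. Carrying g
      -- over to S thus expresses the wedge of z^l by that of z^k and lower ones.
      have hg := gOp_mono_of_lt (q := q) (i := i) (j := j) (l := k) (by omega)
      rw [hks] at hg
      have hsum : ∑ a : Fin N, (l a - (a : ℤ)) ^ 2 - ∑ a : Fin N, (k a - (a : ℤ)) ^ 2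
          = 2 * ((j : ℤ) - i) * (l i - l j) := by
        rw [← Finset.sum_sub_distrib, Fintype.sum_eq_add i j hne fun a ha => by
          rw [hk, Function.comp, Equiv.swap_apply_of_ne_of_ne ha.1 ha.2, sub_self], hki, hkj]
        ring
      have hpos : 0 < 2 * ((j : ℤ) - i) * (l i - l j) :=
        mul_pos (by omega) (by omega)
      have hnn : 0 ≤ ∑ a : Fin N, (k a - (a : ℤ)) ^ 2 := Finset.sum_nonneg fun _ _ => sq_nonneg _
      have hkmem : ∀ v : Spin n N, Lam q n N (mono k ⊗ₜ v) ∈ normalSpan q n k :=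
        ih _ (by omega) k rfl fun m hm => hbelow m (hlk.trans_below hm)
      have hint : ∀ y ∈ monoSpan (Between i j k), Lam q n N (y ⊗ₜ v) ∈ normalSpan q n l := by
        intro y hy
        induction hy using Submodule.span_induction with
        | mem y hy =>
          obtain ⟨m, hm, rfl⟩ := hy
          have hb := hlk.trans_below (between_below hne hm)
          exact normalSpan_mono hb.1 (hbelow m hb v)
        | zero => simp
        | add y z _ _ hy hz =>
          rw [TensorProduct.add_tmul, map_add]
          exact Submodule.add_mem _ hy hz
        | smul c y _ hy =>
          rw [← TensorProduct.smul_tmul', map_smul]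
          exact Submodule.smul_mem _ c hy
      have h1 := hint _ hg
      have h2 := normalSpan_mono hlk (hkmem (sOp q i j v))
      rw [TensorProduct.sub_tmul, map_sub, Lam_gOp hq0 hij, ← TensorProduct.smul_tmul',
        map_smul] at h1
      have h3 := Submodule.smul_mem _ q (Submodule.sub_mem _ h2 h1)
      rwa [sub_sub_cancel, smul_smul, mul_inv_cancel₀ hq0, one_smul] at h3
  obtain ⟨t, ht⟩ : ∃ t, majRank l = t := ⟨_, rfl⟩
  induction t using Nat.strong_induction_on generalizing l v with
  | _ t ih =>
  exact inner _ l rfl (fun m hm v => ih _ (ht ▸ hm.majRank_lt) m v rfl) v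

theorem Lam_tmul_mem_of_monoSpan (hq0 : q ≠ 0) (hq : ∀ a : ℕ, 0 < a → q ^ a = 1 → q = 1)
    {S : Set (Fin N → ℤ)} {U : Submodule ℂ (Wedge q n N)} (hS : ∀ l ∈ S, normalSpan q n l ≤ U)
    {f : Laurent N} (hf : f ∈ monoSpan S) (v : Spin n N) : Lam q n N (f ⊗ₜ v) ∈ U := by
  induction hf using Submodule.span_induction with
  | mem y hy =>
    obtain ⟨m, hm, rfl⟩ := hy
    exact hS m hm (Lam_mono_mem_normalSpan hq0 hq m v)
  | zero => simp
  | add y z _ _ hy hz =>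
    rw [TensorProduct.add_tmul, map_add]
    exact Submodule.add_mem _ hy hz
  | smul c y _ hy =>
    rw [← TensorProduct.smul_tmul', map_smul]
    exact Submodule.smul_mem _ c hy

end QWedge

end

noncomputable section

namespace QWedge

/-! ### An antisymmetrizer -/

section Braid

variable {R : Type*} [Ring R] (x : ℕ → R)

/-- The sum `1 + x_{k-1} + x_{k-2} x_{k-1} + ⋯ + x_0 ⋯ x_{k-1}`. -/
def cosetSum : ℕ → R
  | 0 => 1
  | k + 1 => 1 + cosetSum k * x k

/-- The product of the coset sums: the sum of the lifts of all permutations. -/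
def permSum : ℕ → R
  | 0 => 1
  | k + 1 => cosetSum x (k + 1) * permSum k

variable {x}

theorem cosetSum_commute {y : R} {k : ℕ} (h : ∀ j < k, Commute (x j) y) :
    Commute (cosetSum x k) y := by
  induction k with
  | zero => exact Commute.one_left _
  | succ k ih =>
    exact (Commute.one_left _).add_left
      ((ih fun j hj => h j (by omega)).mul_left (h k (by omega)))

theorem permSum_commute {y : R} {k : ℕ} (h : ∀ j < k, Commute (x j) y) :
    Commute (permSum x k) y := by
  induction k with
  | zero => exact Commute.one_left _
  | succ k ih => exact (cosetSum_commute h).mul_left (ih fun j hj => h j (by omega))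

/-- By the braid relation (1 + x_k)x_{k+1}x_k = x_{k+1}x_k(1 + x_{k+1}), which passes the right
factor 1 + x_k from one step to the next. -/
theorem exists_cosetSum_mul (hb : ∀ k, x k * x (k + 1) * x k = x (k + 1) * x k * x (k + 1))
    (hc : ∀ j k, j + 1 < k → Commute (x j) (x k)) (k : ℕ) :
    ∃ y, cosetSum x (k + 1) * cosetSum x k = y * (1 + x k) := by
  induction k with
  | zero => exact ⟨1, by simp [cosetSum]⟩
  | succ k ih =>
    obtain ⟨y, hy⟩ := ih
    refine ⟨cosetSum x (k + 1) + y * (x (k + 1) * x k), ?_⟩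
    have h1 : Commute (cosetSum x k) (x (k + 1)) := cosetSum_commute fun j hj => hc j _ (by omega)
    have h2 : cosetSum x (k + 2) * cosetSum x (k + 1) = cosetSum x (k + 1) * (1 + x (k + 1))
        + cosetSum x (k + 1) * (x (k + 1) * cosetSum x k) * x k := by
      conv_lhs => rw [cosetSum]
      rw [add_mul, one_mul, mul_assoc]
      nth_rewrite 3 [cosetSum]
      noncomm_ring
    have h3 : (1 + x k) * (x (k + 1) * x k) = x (k + 1) * x k * (1 + x (k + 1)) := by
      rw [add_mul, one_mul, mul_add, mul_one, ← mul_assoc, hb]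
    rw [h2, ← h1.eq, ← mul_assoc, hy, mul_assoc, mul_assoc, h3, add_mul, mul_assoc y]

/-- For the last generator, u commutes past the inner product and meets the right factor 1 + x of
the two outermost coset sums; smaller indices follow by induction. -/
theorem permSum_mul_eq_zero {u : ℕ → R}
    (hb : ∀ k, x k * x (k + 1) * x k = x (k + 1) * x k * x (k + 1))
    (hc : ∀ j k, j + 1 < k → Commute (x j) (x k)) (hu : ∀ k, (1 + x k) * u k = 0)
    (hcu : ∀ j k, j + 1 < k → Commute (x j) (u k)) {k m : ℕ} (hk : k < m) :
    permSum x m * u k = 0 := by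
  induction m with
  | zero => omega
  | succ m ih =>
    rcases Nat.lt_succ_iff_lt_or_eq.1 hk with h | rfl
    · rw [permSum, mul_assoc, ih h, mul_zero]
    · obtain ⟨y, hy⟩ := exists_cosetSum_mul hb hc k
      cases k with
      | zero =>
        simp only [permSum, mul_one]
        rw [cosetSum, mul_one] at hy
        rw [hy, mul_assoc, hu, mul_zero]
      | succ k =>
        have h1 : Commute (permSum x k) (u (k + 1)) :=
          permSum_commute fun j hj => hcu j _ (by omega)
        rw [permSum, permSum, ← mul_assoc, hy, mul_assoc, h1.eq, mul_assoc, ← mul_assoc _ (u _),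
          hu, zero_mul, mul_zero]

end Braid

variable {n N : ℕ} {q p : ℂ}

/-- `g_k ⊗ S_k` for neighbouring places `k, k + 1` (and `0` if there are none). -/
def crossOp (q : ℂ) (n N : ℕ) (k : ℕ) : Module.End ℂ (Tens n N) :=
  if h : k + 1 < N then
    TensorProduct.map (gOp q ⟨k, by omega⟩ ⟨k + 1, h⟩) (sOp q ⟨k, by omega⟩ ⟨k + 1, h⟩)
  else 0

/-- `g_k ⊗ 1 - 1 ⊗ S_k` for neighbouring places `k, k + 1` (and `0` if there are none). -/
def diffOp (q : ℂ) (n N : ℕ) (k : ℕ) : Module.End ℂ (Tens n N) :=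
  if h : k + 1 < N then
    gTens q n ⟨k, by omega⟩ ⟨k + 1, h⟩ - sTens q ⟨k, by omega⟩ ⟨k + 1, h⟩
  else 0

theorem crossOp_apply {i j : Fin N} (hij : (i : ℕ) + 1 = j) (x : Tens n N) :
    crossOp q n N i x = TensorProduct.map (gOp q i j) (sOp q i j) x := by
  have hi : (i : ℕ) + 1 < N := hij ▸ j.isLt
  obtain rfl : j = ⟨i + 1, hi⟩ := Fin.ext hij.symm
  rw [crossOp, dif_pos hi]

theorem diffOp_apply {i j : Fin N} (hij : (i : ℕ) + 1 = j) (x : Tens n N) :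
    diffOp q n N i x = gTens q n i j x - sTens q i j x := by
  have hi : (i : ℕ) + 1 < N := hij ▸ j.isLt
  obtain rfl : j = ⟨i + 1, hi⟩ := Fin.ext hij.symm
  rw [diffOp, dif_pos hi, LinearMap.sub_apply]

theorem crossOp_of_le {k : ℕ} (h : N ≤ k + 1) : crossOp q n N k = 0 := dif_neg (by omega)

theorem diffOp_of_le {k : ℕ} (h : N ≤ k + 1) : diffOp q n N k = 0 := dif_neg (by omega)

theorem crossOp_braid (hq0 : q ≠ 0) (k : ℕ) :
    crossOp q n N k * crossOp q n N (k + 1) * crossOp q n N k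
      = crossOp q n N (k + 1) * crossOp q n N k * crossOp q n N (k + 1) := by
  by_cases h : k + 2 < N
  · rw [crossOp, crossOp, dif_pos h, dif_pos (by omega)]
    rw [← TensorProduct.map_mul, ← TensorProduct.map_mul, ← TensorProduct.map_mul,
      ← TensorProduct.map_mul]
    have h1 : (⟨k, by omega⟩ : Fin N) ≠ ⟨k + 1, by omega⟩ := by simp
    have h2 : (⟨k, by omega⟩ : Fin N) ≠ ⟨k + 2, h⟩ := by simp
    have h3 : (⟨k + 1, by omega⟩ : Fin N) ≠ ⟨k + 2, h⟩ := by simp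
    exact congrArg₂ TensorProduct.map (gOp_braid hq0 h1 h2 h3) (sOp_braid hq0 h1 h2 h3)
  · rw [crossOp_of_le (k := k + 1) (by omega)]
    refine LinearMap.ext fun x => ?_
    simp only [Module.End.mul_apply, LinearMap.zero_apply, map_zero]

theorem crossOp_commute {j k : ℕ} (hjk : j + 1 < k) :
    Commute (crossOp q n N j) (crossOp q n N k) := by
  by_cases h : k + 1 < N
  · rw [crossOp, crossOp, dif_pos h, dif_pos (by omega)]
    rw [Commute, SemiconjBy, ← TensorProduct.map_mul, ← TensorProduct.map_mul]
    refine congrArg₂ TensorProduct.map (gOp_commute ?_ ?_ ?_ ?_ ?_ ?_).eq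
      (sOp_commute ?_ ?_ ?_ ?_).eq <;> rw [ne_eq, Fin.mk.injEq] <;> omega
  · rw [crossOp_of_le (k := k) (by omega)]
    exact Commute.zero_right (G₀ := Module.End ℂ (Tens n N)) _

theorem crossOp_commute_diffOp {j k : ℕ} (hjk : j + 1 < k) :
    Commute (crossOp q n N j) (diffOp q n N k) := by
  by_cases h : k + 1 < N
  · rw [crossOp, diffOp, dif_pos h, dif_pos (by omega), gTens, sTens]
    refine Commute.sub_right (R := Module.End ℂ (Tens n N)) ?_ ?_
    · rw [Commute, SemiconjBy, ← TensorProduct.map_mul, ← TensorProduct.map_mul]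
      refine congrArg₂ TensorProduct.map (gOp_commute ?_ ?_ ?_ ?_ ?_ ?_).eq rfl <;>
        rw [ne_eq, Fin.mk.injEq] <;> omega
    · rw [Commute, SemiconjBy, ← TensorProduct.map_mul, ← TensorProduct.map_mul]
      refine congrArg₂ TensorProduct.map rfl (sOp_commute ?_ ?_ ?_ ?_).eq <;>
        rw [ne_eq, Fin.mk.injEq] <;> omega
  · rw [diffOp_of_le (k := k) (by omega)]
    exact Commute.zero_right (G₀ := Module.End ℂ (Tens n N)) _

/-- Expand (1 + gS)(g - S) = g - S + g²S - gS² and insert the two quadratic relations. -/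
theorem one_add_crossOp_mul_diffOp (hq0 : q ≠ 0) (k : ℕ) :
    (1 + crossOp q n N k) * diffOp q n N k = 0 := by
  by_cases h : k + 1 < N
  · refine LinearMap.ext fun x => ?_
    set i : Fin N := ⟨k, by omega⟩
    set j : Fin N := ⟨k + 1, h⟩
    have hij : (i : ℕ) + 1 = j := rfl
    have hne := ne_of_succ hij
    have hx : ∀ y, crossOp q n N k y = gTens q n i j (sTens q i j y) := fun y => by
      rw [show k = (i : ℕ) from rfl, crossOp_apply hij, gTens, sTens, ← LinearMap.comp_apply,
        ← TensorProduct.map_comp]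
      rfl
    have hd : diffOp q n N k x = gTens q n i j x - sTens q i j x := diffOp_apply hij x
    rw [Module.End.mul_apply, LinearMap.add_apply, hx, hd, Module.End.one_apply]
    simp only [map_sub, ← gTens_sTens, gTens_gTens hq0 hne, sTens_sTens hq0 hne, map_add, map_smul,
      LinearMap.zero_apply]
    abel
  · rw [diffOp_of_le (by omega)]
    exact mul_zero (M₀ := Module.End ℂ (Tens n N)) _

/-- The antisymmetrizer of `⊗^N V(z)`. -/
def antisym (q : ℂ) (n N : ℕ) : Module.End ℂ (Tens n N) :=
  permSum (R := Module.End ℂ (Tens n N)) (crossOp q n N) (N - 1)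

/-- Any coefficient of an antisymmetrized tensor thereby becomes a linear functional on the wedge
product. -/
theorem omega_le_ker_antisym (hq0 : q ≠ 0) (hq : ∀ a : ℕ, 0 < a → q ^ a = 1 → q = 1) :
    Omega q n N ≤ LinearMap.ker (antisym q n N) := by
  refine omega_le hq0 hq fun i j hij f v => ?_
  have h := permSum_mul_eq_zero (R := Module.End ℂ (Tens n N)) (x := crossOp q n N)
    (u := diffOp q n N) (crossOp_braid hq0) (fun _ _ => crossOp_commute)
    (one_add_crossOp_mul_diffOp hq0) (fun _ _ => crossOp_commute_diffOp) (k := i) (m := N - 1)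
    (by omega)
  rw [LinearMap.mem_ker]
  have h' := LinearMap.congr_fun h (f ⊗ₜ v)
  rw [Module.End.mul_apply, diffOp_apply hij] at h'
  exact h'

end QWedge

end

noncomputable section

namespace QWedge

/-! ### Leading terms of the antisymmetrizer -/

variable {n N : ℕ} {q p : ℂ}

theorem cosetSum_mem {V : Type*} [AddCommGroup V] [Module ℂ V] {x : ℕ → Module.End ℂ V}
    {W : Submodule ℂ V} (h : ∀ k, ∀ y ∈ W, x k y ∈ W) (k : ℕ) : ∀ y ∈ W, cosetSum x k y ∈ W := by
  induction k with
  | zero => exact fun y hy => hy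
  | succ k ih => exact fun y hy => W.add_mem hy (ih _ (h k y hy))

theorem permSum_mem {V : Type*} [AddCommGroup V] [Module ℂ V] {x : ℕ → Module.End ℂ V}
    {W : Submodule ℂ V} (h : ∀ k, ∀ y ∈ W, x k y ∈ W) (k : ℕ) : ∀ y ∈ W, permSum x k y ∈ W := by
  induction k with
  | zero => exact fun y hy => hy
  | succ k ih => exact fun y hy => cosetSum_mem h (k + 1) _ (ih y hy)

/-- The span of the `z^l ⊗ v` with `l` below `m`. -/
def lowTens (n : ℕ) {N : ℕ} (m : Fin N → ℤ) : Submodule ℂ (Tens n N) :=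
  Submodule.span ℂ {y | ∃ l v, Below m l ∧ y = mono l ⊗ₜ[ℂ] v}

theorem tmul_mem_lowTens {m : Fin N → ℤ} {f : Laurent N} (hf : f ∈ monoSpan {l | Below m l})
    (v : Spin n N) : f ⊗ₜ[ℂ] v ∈ lowTens n m := by
  induction hf using Submodule.span_induction with
  | mem y hy =>
    obtain ⟨l, hl, rfl⟩ := hy
    exact Submodule.subset_span ⟨l, v, hl, rfl⟩
  | zero => simp
  | add y z _ _ hy hz =>
    rw [TensorProduct.add_tmul]
    exact Submodule.add_mem _ hy hz
  | smul c y _ hy =>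
    rw [← TensorProduct.smul_tmul']
    exact Submodule.smul_mem _ c hy

theorem crossOp_mem_lowTens (m : Fin N → ℤ) (k : ℕ) :
    ∀ y ∈ lowTens n m, crossOp q n N k y ∈ lowTens n m := by
  by_cases h : k + 1 < N
  · change lowTens n m ≤ (lowTens n m).comap (crossOp q n N k)
    rw [lowTens, Submodule.span_le]
    rintro _ ⟨l, v, hl, rfl⟩
    rw [SetLike.mem_coe, Submodule.mem_comap, crossOp, dif_pos h, TensorProduct.map_tmul]
    exact tmul_mem_lowTens (gOp_mem_below (ne_of_succ rfl) (mono_mem hl)) _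
  · intro y _
    rw [crossOp_of_le (by omega), LinearMap.zero_apply]
    exact Submodule.zero_mem _

/-- The possible leading terms of the `τ`-summand of the antisymmetrizer on `z^m ⊗ v_e`. -/
def leadSpan {n N : ℕ} (m : Fin N → ℤ) (e : Fin N → Fin n) (τ : Equiv.Perm (Fin N)) :
    Submodule ℂ (Tens n N) :=
  Submodule.span ℂ {y | ∃ f : Fin N → Fin n, (m ∘ τ = m → f = e ∘ τ) ∧
    y = mono (m ∘ τ) ⊗ₜ[ℂ] vec f} ⊔ lowTens n m

theorem tmul_mem_leadSpan {m : Fin N → ℤ} {e : Fin N → Fin n} {τ : Equiv.Perm (Fin N)}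
    (h : m ∘ τ ≠ m) (v : Spin n N) : mono (m ∘ τ) ⊗ₜ[ℂ] v ∈ leadSpan m e τ := by
  induction v using Finsupp.induction_linear with
  | zero => simp
  | add v w hv hw => rw [TensorProduct.tmul_add]; exact Submodule.add_mem _ hv hw
  | single f c =>
    have : (Finsupp.single f c : Spin n N) = c • vec f := by simp [vec]
    rw [this, TensorProduct.tmul_smul]
    exact Submodule.smul_mem _ _ (Submodule.mem_sup_left
      (Submodule.subset_span ⟨f, fun h' => absurd h' h, rfl⟩))

/-- Since τi < τj the exponents do not descend. If they are equal, g is the scalar q, and where m ∘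
τ = m the decreasing labels leave S only its exchange term. If they increase, g exchanges them up to
lower terms, and no condition on the spin remains because the result differs from m. -/
theorem crossOp_mem_leadSpan {m : Fin N → ℤ} (hm : Monotone m) {e : Fin N → Fin n}
    (he : e ∈ seqE n m) {τ : Equiv.Perm (Fin N)} {i j : Fin N} (hij : (i : ℕ) + 1 = j)
    (hτ : τ i < τ j) : ∀ y ∈ leadSpan m e τ,
      crossOp q n N i y ∈ leadSpan m e (τ * Equiv.swap i j) := by
  have hne := ne_of_succ hij
  change leadSpan m e τ ≤ (leadSpan m e (τ * Equiv.swap i j)).comap (crossOp q n N i)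
  refine sup_le ?_ fun y hy => Submodule.mem_sup_right (crossOp_mem_lowTens m i y hy)
  rw [Submodule.span_le]
  rintro _ ⟨f, hf, rfl⟩
  rw [SetLike.mem_coe, Submodule.mem_comap, crossOp_apply hij, TensorProduct.map_tmul]
  have hcomp : m ∘ (τ * Equiv.swap i j) = (m ∘ τ) ∘ Equiv.swap i j := rfl
  rcases (hm hτ.le).eq_or_lt with h | h
  · have h' : (m ∘ τ) i = (m ∘ τ) j := h
    rw [gOp_mono_of_eq h', ← TensorProduct.smul_tmul']
    refine Submodule.smul_mem _ _ ?_
    have hms : m ∘ (τ * Equiv.swap i j) = m ∘ τ := by rw [hcomp, comp_swap_of_eq h']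
    by_cases hmτ : m ∘ τ = m
    · rw [hf hmτ]
      have hlt : (e ∘ τ) j < (e ∘ τ) i := seqE_lt hm he hτ h
      rw [sOp_vec hne, if_neg hlt.ne', if_neg hlt.not_gt, TensorProduct.tmul_neg]
      refine Submodule.neg_mem _ (Submodule.mem_sup_left (Submodule.subset_span
        ⟨_, fun _ => rfl, ?_⟩))
      rw [hms]
      rfl
    · rw [← hms] at hmτ ⊢
      exact tmul_mem_leadSpan hmτ _
  · have hg := gOp_mono_of_lt (q := q) (l := m ∘ τ) h
    have hmne : m ∘ (τ * Equiv.swap i j) ≠ m := fun hc => by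
      have h1 := congrFun hc i
      have h2 := congrFun hc j
      simp only [Function.comp, Equiv.Perm.mul_apply, Equiv.swap_apply_left,
        Equiv.swap_apply_right] at h1 h2
      have : m i ≤ m j := hm (Fin.le_def.2 (by omega))
      omega
    have h1 : gOp q i j (mono (m ∘ τ)) - q⁻¹ • mono (m ∘ (τ * Equiv.swap i j))
        ∈ monoSpan {l | Below m l} :=
      monoSpan_mono (fun l hl => (maj_comp_perm m τ).trans_below (between_below hne hl)) hg
    have h2 := Submodule.add_mem _
      (Submodule.mem_sup_right (tmul_mem_lowTens h1 (sOp q i j (vec f))))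
      (Submodule.smul_mem _ q⁻¹ (tmul_mem_leadSpan (e := e) hmne (sOp q i j (vec f))))
    rwa [TensorProduct.smul_tmul', ← TensorProduct.add_tmul, sub_add_cancel] at h2

/-- The sum of the `leadSpan m e τ` with `τ ∈ P`. -/
def leadSum {n N : ℕ} (m : Fin N → ℤ) (e : Fin N → Fin n) (P : Set (Equiv.Perm (Fin N))) :
    Submodule ℂ (Tens n N) := ⨆ τ ∈ P, leadSpan m e τ

theorem leadSum_mono {m : Fin N → ℤ} {e : Fin N → Fin n} {P Q : Set (Equiv.Perm (Fin N))}
    (h : P ⊆ Q) : leadSum m e P ≤ leadSum m e Q := biSup_mono h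

theorem leadSpan_le_leadSum {m : Fin N → ℤ} {e : Fin N → Fin n} {P : Set (Equiv.Perm (Fin N))}
    {τ : Equiv.Perm (Fin N)} (h : τ ∈ P) : leadSpan m e τ ≤ leadSum m e P :=
  le_biSup (leadSpan m e) h

/-- The permutations that fix all places after `k`. -/
def fixAfter (N k : ℕ) : Set (Equiv.Perm (Fin N)) := {τ | ∀ i : Fin N, k < i → τ i = i}

/-- The value c travels to the left from place b, always past smaller values, so
`crossOp_mem_leadSpan` applies at every step. As c never returns to its own place, the identity
permutation cannot occur. -/
theorem cosetSum_mem_leadSum {m : Fin N → ℤ} (hm : Monotone m) {e : Fin N → Fin n}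
    (he : e ∈ seqE n m) {c : Fin N} (a : ℕ) : ∀ (b : Fin N) (τ : Equiv.Perm (Fin N)),
      (b : ℕ) = a → b < c → τ ∈ fixAfter N c → τ b = c → ∀ y ∈ leadSpan m e τ,
        cosetSum (R := Module.End ℂ (Tens n N)) (crossOp q n N) a y
          ∈ leadSum m e {τ | τ ∈ fixAfter N c ∧ τ c ≠ c} := by
  induction a with
  | zero =>
    intro b τ hb hbc hfix hτ y hy
    exact leadSpan_le_leadSum (P := {τ | τ ∈ fixAfter N c ∧ τ c ≠ c})
      ⟨hfix, fun h => hbc.ne (τ.injective (hτ.trans h.symm))⟩ hy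
  | succ a ih =>
    intro b τ hb hbc hfix hτ y hy
    have hbc' : (b : ℕ) < c := hbc
    obtain ⟨d, hd⟩ : ∃ d : Fin N, (d : ℕ) = a := ⟨⟨a, by omega⟩, rfl⟩
    have hdb : (d : ℕ) + 1 = b := by omega
    have hdc : d < c := Fin.lt_def.2 (by omega)
    have hle : τ d ≤ c := by
      by_contra! h
      have := τ.injective (hfix _ h)
      exact absurd (this ▸ h) hdc.not_gt
    have hlt : τ d < τ b := hτ ▸ lt_of_le_of_ne hle fun h =>
      (ne_of_succ hdb) (τ.injective (h.trans hτ.symm))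
    refine Submodule.add_mem _
      (leadSpan_le_leadSum (P := {τ | τ ∈ fixAfter N c ∧ τ c ≠ c})
        ⟨hfix, fun h => hbc.ne (τ.injective (hτ.trans h.symm))⟩ hy) ?_
    refine ih d (τ * Equiv.swap d b) hd hdc (fun i hi => ?_) ?_ _ ?_
    · rw [Equiv.Perm.mul_apply, Equiv.swap_apply_of_ne_of_ne, hfix i hi]
      · exact fun h => by omega
      · exact fun h => by omega
    · rw [Equiv.Perm.mul_apply, Equiv.swap_apply_left, hτ]
    · rw [← hd]
      exact crossOp_mem_leadSpan hm he hdb hlt y hy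

/-- In each coset sum the term 1 reproduces the inductive statement, and every other term moves the
value k + 1 off its place. The identity therefore arises exactly once, with coefficient 1. -/
theorem permSum_sub_mem_leadSum {m : Fin N → ℤ} (hm : Monotone m) {e : Fin N → Fin n}
    (he : e ∈ seqE n m) (k : ℕ) :
    permSum (R := Module.End ℂ (Tens n N)) (crossOp q n N) k (mono m ⊗ₜ vec e) - mono m ⊗ₜ vec e
      ∈ leadSum m e {τ | τ ∈ fixAfter N k ∧ τ ≠ 1} := by
  induction k with
  | zero =>
    rw [permSum, Module.End.one_apply, sub_self]
    exact Submodule.zero_mem _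
  | succ k ih =>
    set z : Tens n N := mono m ⊗ₜ vec e
    set y := permSum (R := Module.End ℂ (Tens n N)) (crossOp q n N) k z with hy
    have hz : z ∈ leadSpan m e 1 :=
      Submodule.mem_sup_left (Submodule.subset_span ⟨e, fun _ => rfl, rfl⟩)
    have hy' : y ∈ leadSum m e (fixAfter N k) := by
      have h1 : z ∈ leadSum m e (fixAfter N k) :=
        leadSpan_le_leadSum (P := fixAfter N k) (τ := 1) (fun i _ => rfl) hz
      have h2 : y - z ∈ leadSum m e (fixAfter N k) := leadSum_mono (Set.sep_subset _ _) ih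
      simpa using Submodule.add_mem _ h2 h1
    have hs : permSum (R := Module.End ℂ (Tens n N)) (crossOp q n N) (k + 1) z - z
        = (y - z) + cosetSum (R := Module.End ℂ (Tens n N)) (crossOp q n N) k
          (crossOp q n N k y) := by
      rw [permSum, cosetSum, Module.End.mul_apply, ← hy, LinearMap.add_apply,
        Module.End.one_apply, Module.End.mul_apply]
      abel
    rw [hs]
    refine Submodule.add_mem _
      (leadSum_mono (P := {τ | τ ∈ fixAfter N k ∧ τ ≠ 1})
        (Q := {τ | τ ∈ fixAfter N (k + 1) ∧ τ ≠ 1})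
        (fun τ h => ⟨fun i hi => h.1 i (by omega), h.2⟩) ih) ?_
    by_cases hk : k + 1 < N
    · set b : Fin N := ⟨k, by omega⟩
      set c : Fin N := ⟨k + 1, hk⟩
      have hbc : (b : ℕ) + 1 = c := rfl
      have hle : leadSum m e (fixAfter N k) ≤
          (leadSum m e {τ | τ ∈ fixAfter N (k + 1) ∧ τ ≠ 1}).comap
          (cosetSum (R := Module.End ℂ (Tens n N)) (crossOp q n N) k * crossOp q n N k) := by
        refine iSup₂_le fun τ hτ y hy => ?_
        have hτc : τ c = c := hτ c (Nat.lt_succ_self k)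
        have hle : τ b ≤ c := by
          by_contra! h
          have h3 := τ.injective (hτ (τ b) ((Nat.lt_succ_self k).trans h))
          rw [h3] at h
          exact absurd h (Fin.lt_def.2 (by omega) : b < c).not_gt
        have hlt : τ b < τ c := (lt_of_le_of_ne hle fun h =>
          (ne_of_succ hbc) (τ.injective (h.trans hτc.symm))).trans_eq hτc.symm
        have h1 := crossOp_mem_leadSpan (q := q) hm he hbc hlt y hy
        refine leadSum_mono ?_ (cosetSum_mem_leadSum hm he (c := c) k b (τ * Equiv.swap b c) rfl
          (Fin.lt_def.2 (by omega)) (fun i hi => ?_) ?_ _ h1)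
        · rintro τ ⟨h, h'⟩
          exact ⟨h, fun h1 => h' (by rw [h1]; rfl)⟩
        · have hi' : k + 1 < (i : ℕ) := hi
          rw [Equiv.Perm.mul_apply, Equiv.swap_apply_of_ne_of_ne, hτ i (by omega)]
          · exact fun h => by rw [h] at hi'; omega
          · exact fun h => by rw [h] at hi'; exact lt_irrefl _ hi'
        · rw [Equiv.Perm.mul_apply, Equiv.swap_apply_left, hτc]
      exact hle hy'
    · rw [crossOp_of_le (by omega), LinearMap.zero_apply, map_zero]
      exact Submodule.zero_mem _

/-! ### Coefficient functionals on the wedge product and linear independence. -/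

/-- The coefficient of `z^l ⊗ v_f`. -/
def coeffAt {n N : ℕ} (l : Fin N → ℤ) (f : Fin N → Fin n) : Tens n N →ₗ[ℂ] ℂ :=
  TensorProduct.lid ℂ ℂ ∘ₗ TensorProduct.map
    ((AddMonoidAlgebra.basis (Fin N → ℤ) ℂ).coord l) (Finsupp.lapply f)

theorem coeffAt_tmul (l : Fin N → ℤ) (f : Fin N → Fin n) (k : Fin N → ℤ) (v : Spin n N) :
    coeffAt l f (mono k ⊗ₜ v) = if k = l then v f else 0 := by
  have : (AddMonoidAlgebra.basis (Fin N → ℤ) ℂ).coord l (mono k) = if k = l then 1 else 0 := by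
    have h := (AddMonoidAlgebra.basis (Fin N → ℤ) ℂ).repr_self_apply k l
    rw [AddMonoidAlgebra.basis_apply] at h
    exact h
  rw [coeffAt, LinearMap.comp_apply, TensorProduct.map_tmul, this]
  split_ifs <;> simp

theorem lowTens_le_ker_coeffAt {m l : Fin N → ℤ} (h : ¬ Below m l) (f : Fin N → Fin n) :
    lowTens n m ≤ LinearMap.ker (coeffAt l f) := by
  rw [lowTens, Submodule.span_le]
  rintro _ ⟨k, v, hk, rfl⟩
  rw [SetLike.mem_coe, LinearMap.mem_ker, coeffAt_tmul, if_neg]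
  rintro rfl
  exact h hk

/-- On a level set of m both e and e ∘ τ are strictly decreasing, so τ is increasing there; between
level sets m ∘ τ = m makes it increasing. A monotone permutation is the identity. -/
theorem eq_one_of_seqE {m : Fin N → ℤ} (hm : Monotone m) {e : Fin N → Fin n} (he : e ∈ seqE n m)
    {τ : Equiv.Perm (Fin N)} (hτ : m ∘ τ = m) (heτ : e ∘ τ ∈ seqE n m) : τ = 1 := by
  have hmono : StrictMono τ := fun i j hij => by
    have hi : m (τ i) = m i := congrFun hτ i
    have hj : m (τ j) = m j := congrFun hτ j
    rcases (hm hij.le).eq_or_lt with h | h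
    · by_contra! hle
      have hne : τ j ≠ τ i := fun h' => hij.ne' (τ.injective h')
      have h1 := seqE_lt hm he (lt_of_le_of_ne hle hne) (by omega)
      exact absurd (seqE_lt hm heτ hij h) h1.not_gt
    · by_contra! hle
      have := hm hle
      omega
  have : (τ : Fin N → Fin N) = id :=
    Tuple.unique_monotone (f := id) (σ := τ) (τ := 1) hmono.monotone monotone_id
  exact Equiv.ext fun i => congrFun this i

/-- Lower terms are excluded by hypothesis. A leading term could contribute only if m ∘ τ = l, hence
m = l by monotonicity, and if f = e ∘ τ, which forces τ = 1. -/
theorem leadSum_le_ker_coeffAt {m l : Fin N → ℤ} (hm : Monotone m) (hl : Monotone l)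
    {e f : Fin N → Fin n} (he : e ∈ seqE n m) (hf : f ∈ seqE n l) (h : ¬ Below m l) :
    leadSum m e {τ | τ ≠ 1} ≤ LinearMap.ker (coeffAt l f) := by
  refine iSup₂_le fun τ hτ => sup_le ?_ (lowTens_le_ker_coeffAt h f)
  rw [Submodule.span_le]
  rintro _ ⟨g, hg, rfl⟩
  rw [SetLike.mem_coe, LinearMap.mem_ker, coeffAt_tmul]
  split_ifs with hml
  · have hlm : m = l := Maj.of_monotone_eq hm hl (hml ▸ maj_comp_perm m τ)
      (hml ▸ comp_perm_maj m τ)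
    subst hlm
    rw [hg hml, vec, Finsupp.single_apply, if_neg]
    intro hef
    exact hτ (eq_one_of_seqE hm he hml (hef ▸ hf))
  · rfl

/-- The coefficient of the antisymmetrization at `z^l ⊗ v_f`, as a function on the wedges. -/
def wedgeCoeff (hq0 : q ≠ 0) (hq : ∀ a : ℕ, 0 < a → q ^ a = 1 → q = 1) (l : Fin N → ℤ)
    (f : Fin N → Fin n) : Wedge q n N →ₗ[ℂ] ℂ :=
  (Omega q n N).liftQ (coeffAt l f ∘ₗ antisym q n N) fun x hx => by
    rw [LinearMap.mem_ker, LinearMap.comp_apply,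
      LinearMap.mem_ker.1 (omega_le_ker_antisym hq0 hq hx), map_zero]

/-- The functionals are unitriangular against the ordered wedges, and terms of F strictly below m do
not matter. Taking F = Φ^m applies this to φ(m, e). -/
theorem wedgeCoeff_Lam (hq0 : q ≠ 0) (hq : ∀ a : ℕ, 0 < a → q ^ a = 1 → q = 1)
    {m l : Fin N → ℤ} (hm : Monotone m) (hl : Monotone l) {e f : Fin N → Fin n}
    (he : e ∈ seqE n m) (hf : f ∈ seqE n l) (h : ¬ Below m l) {F : Laurent N}
    (hF : F - mono m ∈ monoSpan {k | Below m k}) :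
    wedgeCoeff hq0 hq l f (Lam q n N (F ⊗ₜ vec e)) = if m = l ∧ e = f then 1 else 0 := by
  have h1 : antisym q n N ((F - mono m) ⊗ₜ vec e) ∈ lowTens n m :=
    permSum_mem (crossOp_mem_lowTens m) _ _ (tmul_mem_lowTens hF _)
  have h2 := leadSum_mono (fun τ h => h.2) (permSum_sub_mem_leadSum (q := q) hm he (N - 1))
  have h3 := lowTens_le_ker_coeffAt h f h1
  have h4 := leadSum_le_ker_coeffAt hm hl he hf h h2
  rw [LinearMap.mem_ker, TensorProduct.sub_tmul, map_sub, map_sub, sub_eq_zero] at h3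
  rw [LinearMap.mem_ker, map_sub, sub_eq_zero] at h4
  change coeffAt l f (antisym q n N (F ⊗ₜ vec e)) = _
  rw [h3]
  refine h4.trans ?_
  rw [coeffAt_tmul, vec, Finsupp.single_apply, ite_and]

theorem linearIndependent_phiVec (hq0 : q ≠ 0) (hq : ∀ a : ℕ, 0 < a → q ^ a = 1 → q = 1)
    (hp0 : p ≠ 0) (hp : ∀ a b : ℕ, 0 < b → p ^ b ≠ q ^ (2 * a)) {A : Set (Fin N → ℤ)}
    (hA : A ⊆ seqM n N) :
    LinearIndependent ℂ fun x : pairs n A => phiVec q p x.1.1 x.1.2 := by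
  rw [linearIndependent_iff]
  intro c hc
  by_contra h0
  -- With x of maximal rank in a supposed relation, no other label in it has x strictly below, so
  -- the functional at x reads off the coefficient of x alone.
  obtain ⟨x, hx, hmax⟩ := c.support.exists_max_image (fun x : pairs n A => majRank x.1.1)
    (Finsupp.support_nonempty_iff.2 h0)
  have h1 := congrArg (wedgeCoeff hq0 hq x.1.1 x.1.2) hc
  rw [map_zero, Finsupp.linearCombination_apply, Finsupp.sum, map_sum] at h1
  refine Finsupp.mem_support_iff.1 hx (Eq.trans ?_ h1)
  rw [Finset.sum_eq_single x]
  · have hm := (hA x.2.1).1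
    rw [map_smul, phiVec, wedgeCoeff_Lam hq0 hq hm hm x.2.2 x.2.2 (fun h => h.2 (Maj.refl _))
      (lower_eq_below hm ▸ (isMacdonald_macdonald hq0 hq hp0 hp hm).2), if_pos ⟨rfl, rfl⟩,
      smul_eq_mul, mul_one]
  · intro y hy hyx
    have hm := (hA y.2.1).1
    rw [map_smul, phiVec, wedgeCoeff_Lam hq0 hq hm (hA x.2.1).1 y.2.2 x.2.2
      (fun h => absurd h.majRank_lt (hmax y hy).not_gt)
      (lower_eq_below hm ▸ (isMacdonald_macdonald hq0 hq hp0 hp hm).2), if_neg, smul_zero]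
    exact fun h => hyx (Subtype.ext (Prod.ext h.1 h.2))
  · exact fun h => absurd hx h

end QWedge

end

noncomputable section

namespace QWedge

/-! ### The decomposition -/

variable {n N : ℕ} {q p : ℂ}

theorem isU0Submodule_of_wedgeAct {P : Submodule ℂ (Wedge q n N)}
    (h : ∀ x, ∀ w ∈ P, wedgeAct q p n N x w ∈ P) : IsU0Submodule q p P := by
  intro u hu
  induction hu using Algebra.adjoin_induction with
  | mem u hu =>
    obtain ⟨x, rfl⟩ := hu
    exact h x
  | algebraMap c =>
    intro w hw
    rw [Module.algebraMap_end_apply]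
    exact P.smul_mem c hw
  | add u v _ _ hu hv => exact fun w hw => P.add_mem (hu w hw) (hv w hw)
  | mul u v _ _ hu hv => exact fun w hw => hu _ (hv w hw)

theorem isU0Submodule_iSup {ι : Type*} {P : ι → Submodule ℂ (Wedge q n N)}
    (h : ∀ i, IsU0Submodule q p (P i)) : IsU0Submodule q p (⨆ i, P i) := by
  intro u hu
  have : ⨆ i, P i ≤ (⨆ i, P i).comap u :=
    iSup_le fun i w hw => Submodule.mem_iSup_of_mem i (h i u hu w hw)
  exact this

theorem wedgeAct_Lam {x : Gen n} (h : Descends (q := q) (tensAct q p n N x)) (y : Tens n N) :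
    wedgeAct q p n N x (Lam q n N y) = Lam q n N (tensAct q p n N x y) := by
  rw [wedgeAct, dif_pos h]
  rfl

/-- The polynomial factor of every generator is 1 or y_i^{±1}, a scalar on f, so only the spin part
changes. -/
theorem tensAct_tmul_mem {f : Laurent N} {U : Submodule ℂ (Tens n N)}
    (hU : ∀ v : Spin n N, f ⊗ₜ[ℂ] v ∈ U) (hy : ∀ i, ∃ c : ℂ, yHecke q p i f = c • f)
    (hy' : ∀ i, ∃ c : ℂ, Ring.inverse (yHecke q p i) f = c • f) (x : Gen n) (v : Spin n N) :
    tensAct q p n N x (f ⊗ₜ v) ∈ U := by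
  have key : ∀ {Z : Module.End ℂ (Laurent N)} (X : Module.End ℂ (Spin n N)),
      (∃ c : ℂ, Z f = c • f) → TensorProduct.map Z X (f ⊗ₜ v) ∈ U := by
    rintro Z X ⟨c, hc⟩
    rw [TensorProduct.map_tmul, hc, ← TensorProduct.smul_tmul']
    exact U.smul_mem c (hU _)
  have hone : ∃ c : ℂ, (1 : Module.End ℂ (Laurent N)) f = c • f := ⟨1, by simp⟩
  cases x with
  | E a =>
    rw [tensAct, LinearMap.sum_apply]
    refine Submodule.sum_mem _ fun i _ => key _ ?_
    split_ifs
    · exact hy' i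
    · exact hone
  | F a =>
    rw [tensAct, LinearMap.sum_apply]
    refine Submodule.sum_mem _ fun i _ => key _ ?_
    split_ifs
    · exact hy i
    · exact hone
  | K a => exact key _ hone
  | Kinv a => exact key _ hone

theorem normalSpan_le {A : Set (Fin N → ℤ)}
    (hlow : ∀ m ∈ A, ∀ k ∈ seqM n N, Maj m k → k ∈ A) {m l : Fin N → ℤ} (hm : m ∈ A)
    (h : Maj m l) :
    normalSpan q n l ≤ Submodule.span ℂ ((fun x => wedgeVec q x.1 x.2) '' pairs n A) :=
  Submodule.span_mono (Set.image_mono fun _ hx => ⟨hlow m hm _ hx.1.1 (h.trans hx.1.2), hx.2⟩)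

theorem iSup_blockE (A : Set (Fin N → ℤ)) : ⨆ m : A, blockE q p n (m : Fin N → ℤ)
    = Submodule.span ℂ (Set.range fun x : pairs n A => phiVec q p x.1.1 x.1.2) := by
  refine le_antisymm (iSup_le fun m => Submodule.span_mono ?_) (Submodule.span_le.2 ?_)
  · rintro _ ⟨e, he, rfl⟩
    exact ⟨⟨(m, e), m.2, he⟩, rfl⟩
  · rintro _ ⟨x, rfl⟩
    exact Submodule.mem_iSup_of_mem ⟨x.1.1, x.2.1⟩ (Submodule.subset_span ⟨x.1.2, x.2.2, rfl⟩)

theorem iSupIndep_blockE {A : Set (Fin N → ℤ)}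
    (h : LinearIndependent ℂ fun x : pairs n A => phiVec q p x.1.1 x.1.2) :
    iSupIndep fun m : A => blockE q p n (m : Fin N → ℤ) := by
  rw [iSupIndep_def]
  intro m
  have hle : ∀ k : A, blockE q p n (k : Fin N → ℤ) ≤ Submodule.span ℂ
      ((fun x : pairs n A => phiVec q p x.1.1 x.1.2) '' {x | x.1.1 = k}) := fun k => by
    refine Submodule.span_mono ?_
    rintro _ ⟨e, he, rfl⟩
    exact ⟨⟨(k, e), k.2, he⟩, rfl, rfl⟩
  refine (h.disjoint_span_image (s := {x | x.1.1 = m}) (t := {x | x.1.1 ≠ m}) ?_).mono (hle m)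
    (iSup₂_le fun k hk => (hle k).trans (Submodule.span_mono (Set.image_mono ?_)))
  · exact Set.disjoint_left.2 fun x hx hx' => hx' hx
  · exact fun x hx hx' => hk (Subtype.ext (hx.symm.trans hx'))

section Blocks

variable (hq0 : q ≠ 0) (hq : ∀ a : ℕ, 0 < a → q ^ a = 1 → q = 1)
  (hp0 : p ≠ 0) (hp : ∀ a b : ℕ, 0 < b → p ^ b ≠ q ^ (2 * a))

include hq0 hq hp0 hp

theorem Lam_macdonald_mem_blockE {m : Fin N → ℤ} (hm : Monotone m) (v : Spin n N) :
    Lam q n N (macdonald q p m ⊗ₜ v) ∈ blockE q p n m :=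
  Lam_tmul_mem_span hq0 hq (fun _ _ hij h =>
    (isMacdonald_macdonald hq0 hq hp0 hp hm).gOp_eq hq0 hq hp0 hp hm hij h) v

theorem isU0Submodule_blockE (hn : 2 ≤ n) {m : Fin N → ℤ} (hm : Monotone m) :
    IsU0Submodule q p (blockE q p n m) := by
  have hM := isMacdonald_macdonald hq0 hq hp0 hp hm
  have hy : ∀ i, ∃ c : ℂ, c ≠ 0 ∧ yHecke q p i (macdonald q p m) = c • macdonald q p m :=
    fun i => ⟨q ^ (1 - (N : ℤ)) * zeta q p m i,
      mul_ne_zero (zpow_ne_zero _ hq0) (mul_ne_zero (zpow_ne_zero _ hp0) (zpow_ne_zero _ hq0)), by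
      rw [yHecke, LinearMap.smul_apply, hM.1 i, smul_smul]⟩
  have hy' : ∀ i, ∃ c : ℂ, Ring.inverse (yHecke q p i) (macdonald q p m)
      = c • macdonald q p m := fun i => by
    obtain ⟨c, hc, h⟩ := hy i
    have h1 := LinearMap.congr_fun
      (Ring.inverse_mul_cancel _ (isUnit_yHecke (p := p) hq0 hp0 i)) (macdonald q p m)
    rw [Module.End.mul_apply, h, map_smul, Module.End.one_apply] at h1
    exact ⟨c⁻¹, (eq_inv_smul_iff₀ hc).2 h1⟩
  refine isU0Submodule_of_wedgeAct fun x => ?_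
  have : blockE q p n m ≤ (blockE q p n m).comap (wedgeAct q p n N x) := by
    rw [blockE, Submodule.span_le]
    rintro _ ⟨e, _, rfl⟩
    rw [SetLike.mem_coe, Submodule.mem_comap, phiVec,
      wedgeAct_Lam (descends_tensAct hn hq0 hq hp0 x)]
    -- The generators leave the admissible labels 𝓔(m), so it is essential that Λ(Φ^m ⊗ v) lies in
    -- the block for every spin v.
    exact tensAct_tmul_mem (U := (blockE q p n m).comap (Lam q n N))
      (Lam_macdonald_mem_blockE hq0 hq hp0 hp hm) (fun i => (hy i).imp fun _ h => h.2) hy' x _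
  exact this

theorem phiVec_sub_wedgeVec_mem {m : Fin N → ℤ} (hm : Monotone m) (e : Fin N → Fin n)
    {U : Submodule ℂ (Wedge q n N)} (hU : ∀ l, Below m l → normalSpan q n l ≤ U) :
    phiVec q p m e - wedgeVec q m e ∈ U := by
  rw [phiVec, wedgeVec, ← map_sub, ← TensorProduct.sub_tmul]
  exact Lam_tmul_mem_of_monoSpan hq0 hq (S := {l | Below m l}) hU
    (lower_eq_below hm ▸ (isMacdonald_macdonald hq0 hq hp0 hp hm).2) _

/-- The two families agree up to wedges strictly below m, which straightening keeps inside A because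
A is downward closed; the converse inclusion inverts this triangular relation by induction on
`majRank`. -/
theorem span_phiVec {A : Set (Fin N → ℤ)} (hA : A ⊆ seqM n N)
    (hlow : ∀ m ∈ A, ∀ k ∈ seqM n N, Maj m k → k ∈ A) :
    Submodule.span ℂ (Set.range fun x : pairs n A => phiVec q p x.1.1 x.1.2)
      = Submodule.span ℂ ((fun x => wedgeVec q x.1 x.2) '' pairs n A) := by
  refine le_antisymm (Submodule.span_le.2 ?_) (Submodule.span_le.2 ?_)
  · rintro _ ⟨⟨x, hx⟩, rfl⟩
    have h := phiVec_sub_wedgeVec_mem hq0 hq hp0 hp (hA hx.1).1 x.2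
      fun l hl => normalSpan_le hlow hx.1 hl.1
    have h' := Submodule.add_mem _ h (Submodule.subset_span ⟨x, hx, rfl⟩)
    rwa [sub_add_cancel] at h'
  · have key : ∀ (t : ℕ) (x : (Fin N → ℤ) × (Fin N → Fin n)), x ∈ pairs n A →
        majRank x.1 = t → wedgeVec q x.1 x.2
          ∈ Submodule.span ℂ (Set.range fun x : pairs n A => phiVec q p x.1.1 x.1.2) := fun t => by
      induction t using Nat.strong_induction_on with
      | _ t ih =>
      intro x hx ht
      have h := phiVec_sub_wedgeVec_mem hq0 hq hp0 hp (hA hx.1).1 x.2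
        (U := Submodule.span ℂ (Set.range fun x : pairs n A => phiVec q p x.1.1 x.1.2))
        fun l hl => Submodule.span_le.2 <| by
          rintro _ ⟨y, hy, rfl⟩
          have hb : Below x.1 y.1 := hl.trans_maj hy.1.2
          exact ih _ (ht ▸ hb.majRank_lt) y ⟨hlow _ hx.1 _ hy.1.1 hb.1, hy.2⟩ rfl
      have h' := Submodule.sub_mem _ (Submodule.subset_span
        (s := Set.range fun x : pairs n A => phiVec q p x.1.1 x.1.2) ⟨⟨x, hx⟩, rfl⟩) h
      rwa [sub_sub_cancel] at h'
    rintro _ ⟨x, hx, rfl⟩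
    exact key _ x hx rfl

theorem decomposesInto (hn : 2 ≤ n) {A : Set (Fin N → ℤ)} (hA : A ⊆ seqM n N)
    (hlow : ∀ m ∈ A, ∀ k ∈ seqM n N, Maj m k → k ∈ A) :
    DecomposesInto q p (Submodule.span ℂ ((fun x => wedgeVec q x.1 x.2) '' pairs n A)) A := by
  have hli := linearIndependent_phiVec hq0 hq hp0 hp hA
  have hspan := span_phiVec hq0 hq hp0 hp hA hlow
  have hsup := (iSup_blockE (q := q) (p := p) (n := n) A).trans hspan
  have hblock : ∀ m ∈ A, IsU0Submodule q p (blockE q p n m) := fun m hm =>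
    isU0Submodule_blockE hq0 hq hp0 hp hn (hA hm).1
  exact ⟨hsup ▸ isU0Submodule_iSup fun m => hblock m m.2, hblock, iSupIndep_blockE hli, hsup, hli,
    hspan⟩

end Blocks

/-! ### The truncated index sets are downward closed under majorization. -/

/-- The last entry of a non-decreasing sequence is its largest, and majorization cannot raise the
largest entry. -/
theorem truncM_lower {s : ℕ} {M : ℤ} {m k : Fin N → ℤ} (hm : m ∈ truncM n s M N)
    (hk : k ∈ seqM n N) (h : Maj m k) : k ∈ truncM n s M N :=
  ⟨hk, fun i hi => h.le_of_forall_le (fun j => (hm.1.1 (Fin.le_def.2 (by omega))).trans (hm.2 i hi))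
    i⟩

/-- The degree depends on the sequence only through its total, which majorization preserves. -/
theorem truncMk_lower {s d : ℕ} {M : ℤ} {m k : Fin N → ℤ} (hm : m ∈ truncMk n s M N d)
    (hk : k ∈ seqM n N) (h : Maj m k) : k ∈ truncMk n s M N d := by
  refine ⟨truncM_lower hm.1 hk h, ?_⟩
  have := hm.2
  rw [degM, Finset.sum_sub_distrib] at this ⊢
  rw [← h.1, this]

end QWedge

end

theorem propositionp (n : ℕ) (hn : 2 ≤ n) (s r : ℕ) (hs : s < n) (M : ℤ)
    (hM : M ≡ (s : ℤ) [ZMOD n]) (q p : ℂ)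
    (hq0 : q ≠ 0) (hq : ∀ a : ℕ, 0 < a → q ^ a = 1 → q = 1)
    (hp0 : p ≠ 0) (hp : ∀ a b : ℕ, 0 < b → p ^ b ≠ q ^ (2 * a)) :
    (∀ x : Gen n, Descends (q := q) (tensAct q p n (s + n * r) x)) ∧
    DecomposesInto q p (spaceV q n s M (s + n * r)) (truncM n s M (s + n * r)) ∧
    ∀ k : ℕ, DecomposesInto q p (spaceVk q n s M (s + n * r) k)
      (truncMk n s M (s + n * r) k) :=
  ⟨descends_tensAct hn hq0 hq hp0,
    decomposesInto hq0 hq hp0 hp hn (fun _ h => h.1) fun _ hm _ => truncM_lower hm,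
    fun _ => decomposesInto hq0 hq hp0 hp hn (fun _ h => h.1.1) fun _ hm _ => truncMk_lower hm⟩
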